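/- Let $n\ge 3$ be an odd integer, let $B_0\neq -1$ be a squarefree integer, let $f,C$ be nonzero integers with $\gcd(f,C)=1$, and put $B=f^2B_0$. Let $K=\mathbb{Q}(\sqrt{-B_0})$, with ring of integers $\mathcal{O}_K$; conjugation is denoted by a bar. Let $\mathcal{O}\subseteq\mathcal{O}_K$ be the order $$\mathcal{O}=\begin{cases}\mathbb{Z}\big[f\tfrac{1+\sqrt{-B_0}}{2}\big] & \text{if } B_0\equiv 7 \pmod 8,\text{ or if } B_0\equiv 3\pmod 8 \text{ and } C \text{ is even},\\ \mathbb{Z}[f\sqrt{-B_0}] & \text{otherwise,}\end{cases}$$ and let $\mathfrak{f}$ be its conductor, so that $\mathfrak{f}=2|f|$ if $B_0\equiv 3\pmod 8$ and $C$ is odd, and $\mathfrak{f}=|f|$ otherwise. Let $I(\mathcal{O},\mathfrak{f})$ be the group of fractional $\mathcal{O}$-ideals prime to $\mathfrak{f}$ (generated by the invertible integral ideals of norm prime to $\mathfrak{f}$), let $P(\mathcal{O},\mathfrak{f})$ be its subgroup of principal ideals, let $P(\mathcal{O}_K)$ be the group of principal fractional ideals of $\mathcal{O}_K$, let $\mathrm{Cl}(\mathcal{O})$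 be the group of invertible fractional $\mathcal{O}$-ideals modulo principal ones, and let $\psi_{\mathcal{O}}\colon P(\mathcal{O},\mathfrak{f})/nP(\mathcal{O},\mathfrak{f})\to P(\mathcal{O}_K)/nP(\mathcal{O}_K)$ be the map induced by $\mathfrak{a}\mapsto\mathfrak{a}\mathcal{O}_K$. Let $\mathcal{S}$ be a finite set of primes of $K$ that contains all primes above $2nCf$ and whose classes generate $\mathrm{Cl}(\mathcal{O}_K)$, and let $R_K=\mathcal{O}_{K,\mathcal{S}}$ be the ring of $\mathcal{S}$-integers. Let $A_{B,C}\subseteq R_K^\times/(R_K^\times)^n$ be the set of classes of those $d\in R_K^\times$ such that * for every prime number $p\mid C$ that splits in $K$ and every prime $\mathfrak{p}$ above $p$, one has $v_{\mathfrak{p}}(d)\equiv v_p(C)\frac{n\pm1}{2}$ and $v_{\bar{\mathfrak{p}}}(d)\equiv v_p(C)\frac{n\mp1}{2}\pmod n$ for some choice of the sign; * $v_{\mathfrak{p}}(d)\equiv 0\pmod n$ for every other $\mathfrak{p}\in\mathcal{S}$; * the class of $d\mathcal{O}_K$ in $P(\mathcal{O}_K)/nP(\mathcal{O}_K)$ lies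 in the image of $\psi_{\mathcal{O}}$. Call a primitive integer solution $(x,y,z)$ (that is, $\gcd(x,y,z)=1$) of $x^2+By^2=Cz^n$ a $*^0$ point if $x+f\sqrt{-B_0}\,y\notin p\mathcal{O}_K$ for every prime number $p$. Then $A_{B,C}$ is finite. If moreover $C$ is odd in the case $B_0\equiv 3\pmod 4$, then the following are equivalent: (i) for every nonzero integer $M$ there is a $*^0$ point $(x,y,z)$ with $\gcd(z,M)=1$; (ii) $p\nmid C$ for all prime numbers $p$ that are inert in $K$, $v_p(C)\le 1$ for all prime numbers $p$ that ramify in $K$, and $A_{B,C}\neq\emptyset$; (iii) $C\mathcal{O}_K=\mathfrak{j}_+\mathfrak{j}_-\mathfrak{r}^2$ for some ideals $\mathfrak{j}_+,\mathfrak{j}_-,\mathfrak{r}$ of $\mathcal{O}_K$ such that $\mathfrak{j}_+$ and $\mathfrak{j}_-$ are coprime and supported on primes above split prime numbers, $\mathfrak{j}_+=\overline{\mathfrak{j}_-}$, the classes $[\mathfrak{j}_\pm\cap\mathcal{O}]$ are both in $n\,\mathrm{Cl}(\mathcal{O})$, and $\mathfrak{r}$ is a product of distinct ramified primes. If $B_0\equiv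 3\pmod 4$ and $C$ is even, then there are no $*^0$ points. -/

import Mathlib

open NumberField IsDedekindDomain
open scoped nonZeroDivisors

noncomputable section

namespace FermatDescent

/-! ### Integral points of `x² + B y² = C zⁿ` -/

/-- `(x, y, z)` is a primitive integer solution of `x² + B y² = C zⁿ`. -/
def IsPrimitiveSolution (B C : ℤ) (n : ℕ) (x y z : ℤ) : Prop :=
  x ^ 2 + B * y ^ 2 = C * z ^ n ∧ Int.gcd (Int.gcd x y) z = 1

section

variable {K : Type*} [Field K] [NumberField K]

/-- The condition `*⁰`: for every prime number `p`, the element `u = x + f √(-B₀) y` does not lie in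
`p 𝓞_K`. Here `s` stands for `√(-B₀)`. -/
def StarZero (s : 𝓞 K) (f x y : ℤ) : Prop :=
  ∀ p : ℕ, p.Prime → (x : 𝓞 K) + (f : 𝓞 K) * s * (y : 𝓞 K) ∉ Ideal.span {(p : 𝓞 K)}

/-! ### Decomposition of primes in the quadratic field `K` -/

/-- The image `σ(I)` of an ideal `I` of `𝓞_K` under an automorphism `σ` of `K`. When `σ` is the
nontrivial automorphism of the quadratic field `K`, this is the conjugate ideal. -/
def conjIdeal (σ : K ≃ₐ[ℚ] K) (I : Ideal (𝓞 K)) : Ideal (𝓞 K) :=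
  I.map (RingOfIntegers.mapRingEquiv σ)

/-- The prime number `p` is inert in `K`. -/
def IsInert (K : Type*) [Field K] [NumberField K] (p : ℕ) : Prop :=
  p.Prime ∧ (Ideal.span {(p : 𝓞 K)}).IsPrime

/-- `p` is a prime number with `p 𝓞_K = v²`; that is, `p` is ramified and `v` is the prime
above it. -/
def RamifiesAs (p : ℕ) (v : HeightOneSpectrum (𝓞 K)) : Prop :=
  p.Prime ∧ Ideal.span {(p : 𝓞 K)} = v.asIdeal ^ 2

/-- `p` is a prime number with `p 𝓞_K = v w`, where `w` is the conjugate of `v` and `w ≠ v`; that is,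
`p` is split and `v`, `w` are the two primes above it. -/
def SplitsAs (σ : K ≃ₐ[ℚ] K) (p : ℕ) (v w : HeightOneSpectrum (𝓞 K)) : Prop :=
  p.Prime ∧ w.asIdeal = conjIdeal σ v.asIdeal ∧ v ≠ w ∧
    Ideal.span {(p : 𝓞 K)} = v.asIdeal * w.asIdeal

/-- The prime `v` of `K` is ramified over `ℚ`. -/
def IsRamifiedPrime (v : HeightOneSpectrum (𝓞 K)) : Prop :=
  ∃ p : ℕ, RamifiesAs p v

/-- The prime `v` of `K` lies above a split prime number. -/
def IsSplitPrime (σ : K ≃ₐ[ℚ] K) (v : HeightOneSpectrum (𝓞 K)) : Prop :=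
  ∃ (p : ℕ) (w : HeightOneSpectrum (𝓞 K)), SplitsAs σ p v w

/-- The normalized additive valuation `v_𝔭(d)`: the exponent of the prime `v` in the fractional ideal
`d 𝓞_K`. -/
def val (v : HeightOneSpectrum (𝓞 K)) (d : K) : ℤ :=
  FractionalIdeal.count K v (FractionalIdeal.spanSingleton (𝓞 K)⁰ d)

/-! ### The order `𝓞` and its class group -/

open Classical in
/-- The order `𝓞` of `K`: it is `ℤ[f (1 + √(-B₀))/2]` if `B₀ ≡ 7 (mod 8)`, or if `B₀ ≡ 3 (mod 8)` and
`C` is even; otherwise it is `ℤ[f √(-B₀)]`. In the first case the generator is the only element `t`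
of `𝓞_K` with `2 t = f (1 + √(-B₀))`. -/
def quadOrder (s : 𝓞 K) (f B₀ C : ℤ) : Subalgebra ℤ (𝓞 K) :=
  if B₀ ≡ 7 [ZMOD 8] ∨ (B₀ ≡ 3 [ZMOD 8] ∧ Even C) then
    Algebra.adjoin ℤ {t : 𝓞 K | 2 * t = (f : 𝓞 K) * (1 + s)}
  else
    Algebra.adjoin ℤ {(f : 𝓞 K) * s}

open Classical in
/-- The conductor of the order `quadOrder s f B₀ C`. -/
def quadConductor (f B₀ C : ℤ) : ℕ :=
  if B₀ ≡ 3 [ZMOD 8] ∧ Odd C then 2 * f.natAbs else f.natAbs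

/-- `I(𝓞, 𝔣)`: the group of fractional `𝓞`-ideals prime to `𝔣`, generated by the invertible integral
ideals whose norm is prime to `𝔣`. -/
def idealsPrimeTo (O : Subalgebra ℤ (𝓞 K)) (𝔣 : ℕ) : Subgroup (FractionalIdeal (O)⁰ K)ˣ :=
  Subgroup.closure
    {I | ∃ 𝔞 : Ideal O, (I : FractionalIdeal (O)⁰ K) = (𝔞 : FractionalIdeal (O)⁰ K) ∧
      Nat.Coprime (Nat.card (O ⧸ 𝔞)) 𝔣}

/-- `P(𝓞, 𝔣)`: the principal fractional ideals `α 𝓞`, `α ∈ Kˣ`, that belong to `I(𝓞, 𝔣)`. -/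
def principalPrimeTo (O : Subalgebra ℤ (𝓞 K)) (𝔣 : ℕ) : Set (FractionalIdeal (O)⁰ K)ˣ :=
  {I | I ∈ idealsPrimeTo O 𝔣 ∧
    ∃ α : Kˣ, ((I : FractionalIdeal (O)⁰ K) : Submodule O K) = Submodule.span O {(α : K)}}

/-- The class of `d 𝓞_K` in `P(𝓞_K)/n P(𝓞_K)` lies in the image of the map
`ψ : P(𝓞, 𝔣)/n P(𝓞, 𝔣) → P(𝓞_K)/n P(𝓞_K)` induced by `𝔞 ↦ 𝔞 𝓞_K`: there are `𝔞 ∈ P(𝓞, 𝔣)` and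
`β ∈ Kˣ` with `d 𝓞_K = 𝔞 𝓞_K · (β 𝓞_K)ⁿ`. -/
def DivMemImagePsi (O : Subalgebra ℤ (𝓞 K)) (𝔣 n : ℕ) (d : K) : Prop :=
  ∃ 𝔞 ∈ principalPrimeTo O 𝔣, ∃ β : Kˣ,
    Submodule.span (𝓞 K) {d} =
      Submodule.span (𝓞 K) ((𝔞 : FractionalIdeal (O)⁰ K) : Set K) *
        Submodule.span (𝓞 K) {(β : K)} ^ n

/-- The ideal `𝔧 ∩ 𝓞` of `𝓞` is invertible, and its class lies in `n Cl(𝓞)` (the class group, written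
multiplicatively here, is that of invertible fractional `𝓞`-ideals modulo principal ones). -/
def ClassMemMultiples (O : Subalgebra ℤ (𝓞 K)) (n : ℕ) (𝔧 : Ideal (𝓞 K)) : Prop :=
  ∃ I : (FractionalIdeal (O)⁰ (FractionRing O))ˣ,
    (I : FractionalIdeal (O)⁰ (FractionRing O)) =
        ((𝔧.comap (algebraMap O (𝓞 K)) : Ideal O) : FractionalIdeal (O)⁰ (FractionRing O)) ∧
      ∃ c : ClassGroup O, ClassGroup.mk (FractionRing O) I = c ^ n

/-! ### Admissible twists -/

/-- The condition on the finite set `S` of primes of `K` to be inverted: it contains all primes above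
`2 n C f`, and the classes of its members generate `Cl(𝓞_K)`. The ring `R_K` is then `S.integer K`. -/
def IsInvertedSet (n : ℕ) (C f : ℤ) (S : Set (HeightOneSpectrum (𝓞 K))) : Prop :=
  S.Finite ∧
    (∀ v : HeightOneSpectrum (𝓞 K), ((2 * n * C * f : ℤ) : 𝓞 K) ∈ v.asIdeal → v ∈ S) ∧
    Subgroup.closure
      {c : ClassGroup (𝓞 K) | ∃ v ∈ S,
        c = ClassGroup.mk0 ⟨v.asIdeal, mem_nonZeroDivisors_of_ne_zero v.ne_bot⟩} = ⊤

/-- The conditions on `d ∈ Kˣ` that define admissible twists: for each split prime `p` dividing `C`,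
with primes `𝔭`, `𝔭̄` above it,
`v_𝔭(d) ≡ v_p(C) (n ± 1)/2` and `v_𝔭̄(d) ≡ v_p(C) (n ∓ 1)/2` modulo `n`;
`v_𝔭(d) ≡ 0` modulo `n` for all other `𝔭 ∈ S`; and `div(d)` is in the image of `ψ`. -/
def IsAdmissible (σ : K ≃ₐ[ℚ] K) (s : 𝓞 K) (n : ℕ) (f B₀ C : ℤ)
    (S : Set (HeightOneSpectrum (𝓞 K))) (d : K) : Prop :=
  (∀ (p : ℕ) (v w : HeightOneSpectrum (𝓞 K)), SplitsAs σ p v w → (p : ℤ) ∣ C →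
    (val v d ≡ (padicValInt p C : ℤ) * (((n : ℤ) + 1) / 2) [ZMOD n] ∧
      val w d ≡ (padicValInt p C : ℤ) * (((n : ℤ) - 1) / 2) [ZMOD n]) ∨
    (val v d ≡ (padicValInt p C : ℤ) * (((n : ℤ) - 1) / 2) [ZMOD n] ∧
      val w d ≡ (padicValInt p C : ℤ) * (((n : ℤ) + 1) / 2) [ZMOD n])) ∧
  (∀ v ∈ S, ¬ (IsSplitPrime σ v ∧ (C : 𝓞 K) ∈ v.asIdeal) → val v d ≡ 0 [ZMOD n]) ∧
  DivMemImagePsi (quadOrder s f B₀ C) (quadConductor f B₀ C) n d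

/-- The set `A_{B,C} ⊆ R_Kˣ / (R_Kˣ)ⁿ` of admissible twists, where `B = f² B₀` and `R_K` is the ring of
`S`-integers of `K`. -/
def admissibleTwists (σ : K ≃ₐ[ℚ] K) (s : 𝓞 K) (n : ℕ) (f B₀ C : ℤ)
    (S : Set (HeightOneSpectrum (𝓞 K))) :
    Set ((S.integer K)ˣ ⧸ (powMonoidHom n : (S.integer K)ˣ →* (S.integer K)ˣ).range) :=
  {t | ∃ d : (S.integer K)ˣ, QuotientGroup.mk d = t ∧
    IsAdmissible σ s n f B₀ C S ((d : S.integer K) : K)}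

/-- The factorization `C 𝓞_K = 𝔧₊ 𝔧₋ 𝔯²`, where `𝔧₊` and `𝔧₋` are coprime, conjugate and supported on
split primes, the classes of `𝔧₊ ∩ 𝓞` and `𝔧₋ ∩ 𝓞` are in `n Cl(𝓞)`, and `𝔯` is a product of distinct
ramified primes. -/
def HasClassFactorization (σ : K ≃ₐ[ℚ] K) (s : 𝓞 K) (n : ℕ) (f B₀ C : ℤ) : Prop :=
  ∃ (jp jm r : Ideal (𝓞 K)) (T : Finset (HeightOneSpectrum (𝓞 K))),
    Ideal.span {(C : 𝓞 K)} = jp * jm * r ^ 2 ∧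
    IsCoprime jp jm ∧
    jp = conjIdeal σ jm ∧
    (∀ v : HeightOneSpectrum (𝓞 K), v.asIdeal ∣ jp → IsSplitPrime σ v) ∧
    (∀ v : HeightOneSpectrum (𝓞 K), v.asIdeal ∣ jm → IsSplitPrime σ v) ∧
    ClassMemMultiples (quadOrder s f B₀ C) n jp ∧
    ClassMemMultiples (quadOrder s f B₀ C) n jm ∧
    r = ∏ v ∈ T, v.asIdeal ∧
    ∀ v ∈ T, IsRamifiedPrime v

end

end FermatDescent

end

/-! The proof compares `x² + B y² = C zⁿ` with the ideal of `α = x + f √(-B₀) y`, whose norm is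
`C zⁿ`.

**Classes.** Everything is expressed by fractional ideals of `𝓞 K`. For a natural number `g` with
`g 𝓞_K ⊆ O`, contraction and extension are inverse bijections between the ideals of `𝓞 K` and of
the order `O` that are prime to `g`. Hence the class of `j ∩ O` is in `n Cl(O)` if and only if
`j = x Lⁿ`, where `x` is a quotient of elements of `O` prime to `g` and `L` is prime to `g`; these
fractional ideals form the group `nthClasses O g n` (`classMemMultiples_iff`). The condition on
the image of `ψ` has a similar form (`divMemImagePsi_iff`). In these terms `g` may be any nonzero
multiple of the conductor.

**Points to factorizations.** Since `α` is not divisible by a prime number, inert primes do not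
divide `α`, ramified primes divide it at most once, and at most one of two conjugate split primes
divides it. If `z` is prime to `2 f C`, comparing exponents in `(α)(ᾱ) = (C)(z)ⁿ` shows that inert
primes do not divide `C`, that ramified ones divide it at most once, and that `(α) = j₊ r Lⁿ`,
where `j₊` is the part of `C` at the split primes dividing `α`, and `r` is the product of the
ramified primes dividing `C`. The ideal `r` equals its conjugate, so its class is killed by `2`
and is an `n`-th power, as `n` is odd. Hence the class of `j₊` is an `n`-th power
(`IsPointElement.hasClassFactorization`).

**Factorizations to points.** If `n Cl` contains the class of `j₊`, then `j₊ r Zⁿ = (β)` with `β`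
in the order and `Z` prime to any given integer (`exists_mul_pow_eq_span`); rational prime factors
of `Z` can be removed, and then `β` is not divisible by a prime number. The element `β` has to be
in `ℤ[f √(-B₀)]`, which for `B₀ ≡ 7 (mod 8)` is smaller than the order of the theorem; but it
contains the squares of the elements of that order that are prime to `2 f`
(`IsQuadratic.sq_mem_rootOrder`), which suffices, again because `n` is odd. The norm of `β` is
`± C Nⁿ`, where `N` is the norm of `Z`, and the sign is absorbed in `z = ± N`
(`IsFactorization.exists_element`).

**Twists.** Write `n = 2k + 1`. A twist with the prescribed exponents has divisor `(j₊ j₋)ᵏ j₊` up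
to `n`-th powers, where `j₊` collects the primes at which the exponent is `v_p(C) (n + 1)/2`. As
`j₊ j₋` is generated by an integer, the twist lies in the image of `ψ` if and only if the class of
`j₊` is an `n`-th power; since the classes of the primes in `S` generate `Cl(𝓞 K)`, the twist can
be chosen to be an `S`-unit (`IsQuadratic.hasClassFactorization_of_isAdmissible`,
`IsFactorization.exists_isAdmissible`). Finiteness of the set of twists follows from the finite
generation of the group of `S`-units (`fg_sUnits`).

If `B₀ ≡ 3 (mod 4)` and `C` is even, then `x ≡ y (mod 2)`, and `2` divides `α`. -/

noncomputable section

namespace FermatDescent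

set_option linter.unusedSectionVars false

variable {K : Type*} [Field K] [NumberField K]

/-! ### Orders and their elements prime to the conductor -/

theorem exists_dvd_pow_sub_one {g : ℕ} (hg : g ≠ 0) {u : 𝓞 K} (hu : IsCoprime u (g : 𝓞 K)) :
    ∃ k, 0 < k ∧ (g : 𝓞 K) ∣ u ^ k - 1 := by
  have hne : Ideal.span {(g : 𝓞 K)} ≠ ⊥ := by
    rw [Ne, Ideal.span_singleton_eq_bot]; exact_mod_cast hg
  have : Finite (𝓞 K ⧸ Ideal.span {(g : 𝓞 K)}) := Ideal.finiteQuotientOfFreeOfNeBot _ hne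
  have hunit : IsUnit (Ideal.Quotient.mk (Ideal.span {(g : 𝓞 K)}) u) := by
    obtain ⟨a, b, hab⟩ := hu
    refine IsUnit.of_mul_eq_one (Ideal.Quotient.mk _ a) ?_
    rw [← map_mul, ← map_one (Ideal.Quotient.mk _), Ideal.Quotient.eq,
      Ideal.mem_span_singleton]
    exact ⟨-b, by linear_combination hab⟩
  obtain ⟨v, hv⟩ := hunit
  obtain ⟨k, hk, hk1⟩ := (isOfFinOrder_of_finite v).exists_pow_eq_one
  refine ⟨k, hk, ?_⟩
  rw [← Ideal.mem_span_singleton, ← Ideal.Quotient.eq, map_pow, ← hv, ← Units.val_pow_eq_pow_val,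
    hk1, Units.val_one, map_one]

/-- Division by elements prime to the conductor does not lead out of an order: modulo the conductor
the inverse of such an element is one of its powers. -/
theorem mem_of_mul_mem {O : Subalgebra ℤ (𝓞 K)} {g : ℕ} (hg : g ≠ 0)
    (hO : ∀ t : 𝓞 K, (g : 𝓞 K) * t ∈ O) {u β : 𝓞 K} (hu : u ∈ O)
    (hug : IsCoprime u (g : 𝓞 K)) (h : u * β ∈ O) : β ∈ O := by
  obtain ⟨k, hk, c, hc⟩ := exists_dvd_pow_sub_one hg hug
  obtain ⟨k, rfl⟩ := Nat.exists_eq_succ_of_ne_zero hk.ne'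
  have : β = u ^ k * (u * β) - g * (c * β) := by
    rw [pow_succ] at hc; linear_combination (-β) * hc
  rw [this]
  exact O.sub_mem (O.mul_mem (O.pow_mem hu k) h) (hO _)

theorem isCoprime_coe_iff {O : Subalgebra ℤ (𝓞 K)} {g : ℕ} (hg : g ≠ 0)
    (hO : ∀ t : 𝓞 K, (g : 𝓞 K) * t ∈ O) {a : O} :
    IsCoprime (a : 𝓞 K) (g : 𝓞 K) ↔ IsCoprime a (g : O) := by
  refine ⟨fun h => ?_, fun h => by simpa using h.map O.val.toRingHom⟩
  obtain ⟨x, y, hxy⟩ : IsCoprime (a : 𝓞 K) ((g : 𝓞 K) * g) := h.mul_right h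
  have hx : x ∈ O := by
    refine mem_of_mul_mem hg hO a.2 h ?_
    have : (a : 𝓞 K) * x = 1 - g * (g * y) := by linear_combination hxy
    rw [this]
    exact O.sub_mem O.one_mem (hO _)
  exact ⟨⟨x, hx⟩, ⟨g * y, hO _⟩, Subtype.ext (by push_cast; linear_combination hxy)⟩

/-- The contraction of an ideal of `𝓞 K` to the order `O`. -/
def contract (O : Subalgebra ℤ (𝓞 K)) (I : Ideal (𝓞 K)) : Ideal O := I.comap (algebraMap O (𝓞 K))

/-- The extension of an ideal of the order `O` to `𝓞 K`. -/
def extend {O : Subalgebra ℤ (𝓞 K)} (I : Ideal O) : Ideal (𝓞 K) := I.map (algebraMap O (𝓞 K))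

/-- The ideal `I` is prime to the integer `g`. -/
def IsPrimeTo {R : Type*} [CommRing R] (g : ℕ) (I : Ideal R) : Prop :=
  IsCoprime I (Ideal.span {(g : R)})

theorem isPrimeTo_iff {R : Type*} [CommRing R] {g : ℕ} {I : Ideal R} :
    IsPrimeTo g I ↔ ∃ a ∈ I, ∃ b, a + g * b = 1 := by
  rw [IsPrimeTo, Ideal.isCoprime_iff_exists]
  constructor
  · rintro ⟨a, ha, c, hc, h⟩
    obtain ⟨b, rfl⟩ := Ideal.mem_span_singleton.1 hc
    exact ⟨a, ha, b, h⟩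
  · rintro ⟨a, ha, b, h⟩
    exact ⟨a, ha, _, Ideal.mem_span_singleton.2 ⟨b, rfl⟩, h⟩

theorem isPrimeTo_span_iff {R : Type*} [CommRing R] {g : ℕ} {a : R} :
    IsPrimeTo g (Ideal.span {a}) ↔ IsCoprime a (g : R) := by
  rw [IsPrimeTo, Ideal.isCoprime_span_singleton_iff]

theorem IsPrimeTo.mul {R : Type*} [CommRing R] {g : ℕ} {I J : Ideal R} (hI : IsPrimeTo g I)
    (hJ : IsPrimeTo g J) : IsPrimeTo g (I * J) := IsCoprime.mul_left hI hJ

theorem IsPrimeTo.pow {R : Type*} [CommRing R] {g : ℕ} {I : Ideal R} (hI : IsPrimeTo g I) (n : ℕ) :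
    IsPrimeTo g (I ^ n) := IsCoprime.pow_left hI

theorem IsPrimeTo.of_dvd {R : Type*} [CommRing R] {g : ℕ} {I J : Ideal R} (hI : IsPrimeTo g I)
    (h : J ∣ I) : IsPrimeTo g J := IsCoprime.of_isCoprime_of_dvd_left hI h

theorem IsPrimeTo.of_dvd_right {R : Type*} [CommRing R] {g h : ℕ} {I : Ideal R}
    (hI : IsPrimeTo g I) (hd : h ∣ g) : IsPrimeTo h I := by
  obtain ⟨c, rfl⟩ := hd
  refine IsCoprime.of_isCoprime_of_dvd_right hI ⟨Ideal.span {(c : R)}, ?_⟩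
  rw [Ideal.span_singleton_mul_span_singleton]; push_cast; rfl

theorem IsPrimeTo.mul_right {R : Type*} [CommRing R] {g h : ℕ} {I : Ideal R}
    (hg : IsPrimeTo g I) (hh : IsPrimeTo h I) : IsPrimeTo (g * h) I := by
  have := IsCoprime.mul_right hg hh
  rw [Ideal.span_singleton_mul_span_singleton] at this
  rw [IsPrimeTo]; push_cast; exact this

theorem IsPrimeTo.contract {O : Subalgebra ℤ (𝓞 K)} {g : ℕ}
    (hO : ∀ t : 𝓞 K, (g : 𝓞 K) * t ∈ O) {I : Ideal (𝓞 K)} (hI : IsPrimeTo g I) :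
    IsPrimeTo g (contract O I) := by
  obtain ⟨a, ha, b, h⟩ := isPrimeTo_iff.1 (hI.mul_right hI)
  push_cast at h
  have haO : a ∈ O := by
    have : a = 1 - g * (g * b) := by linear_combination h
    rw [this]; exact O.sub_mem O.one_mem (hO _)
  exact isPrimeTo_iff.2 ⟨⟨a, haO⟩, ha, ⟨g * b, hO _⟩,
    Subtype.ext (by push_cast; linear_combination h)⟩

theorem IsPrimeTo.extend {O : Subalgebra ℤ (𝓞 K)} {g : ℕ} {I : Ideal O} (hI : IsPrimeTo g I) :
    IsPrimeTo g (extend I) := by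
  obtain ⟨a, ha, b, h⟩ := isPrimeTo_iff.1 hI
  refine isPrimeTo_iff.2 ⟨a, Ideal.mem_map_of_mem _ ha, b, ?_⟩
  simpa using congrArg O.val h

theorem extend_contract {O : Subalgebra ℤ (𝓞 K)} {g : ℕ}
    (hO : ∀ t : 𝓞 K, (g : 𝓞 K) * t ∈ O) {I : Ideal (𝓞 K)} (hI : IsPrimeTo g I) :
    extend (contract O I) = I := by
  refine le_antisymm Ideal.map_comap_le fun x hx => ?_
  obtain ⟨a, ha, b, h⟩ := isPrimeTo_iff.1 hI
  have haO : a ∈ O := by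
    have : a = 1 - g * b := by linear_combination h
    rw [this]; exact O.sub_mem O.one_mem (hO _)
  have hx' : x = x * a + b * (g * x) := by linear_combination (-x) * h
  rw [hx']
  refine Ideal.add_mem _ (Ideal.mul_mem_left _ _ ?_) (Ideal.mul_mem_left _ _ ?_)
  · exact Ideal.mem_map_of_mem (algebraMap O (𝓞 K))
      (show (⟨a, haO⟩ : O) ∈ FermatDescent.contract O I from ha)
  · exact Ideal.mem_map_of_mem (algebraMap O (𝓞 K))
      (show (⟨g * x, hO x⟩ : O) ∈ FermatDescent.contract O I from I.mul_mem_left _ hx)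

theorem contract_extend {O : Subalgebra ℤ (𝓞 K)} {g : ℕ}
    (hO : ∀ t : 𝓞 K, (g : 𝓞 K) * t ∈ O) {I : Ideal O} (hI : IsPrimeTo g I) :
    contract O (extend I) = I := by
  refine le_antisymm (fun x hx => ?_) Ideal.le_comap_map
  have key : ∀ y ∈ extend I, ∀ c : 𝓞 K, (⟨g * (c * y), hO _⟩ : O) ∈ I := by
    intro y hy
    refine Submodule.span_induction
      (p := fun y _ => ∀ c : 𝓞 K, (⟨g * (c * y), hO _⟩ : O) ∈ I) ?_ ?_ ?_ ?_ hy
    · rintro _ ⟨z, hz, rfl⟩ c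
      have : (⟨g * (c * algebraMap O (𝓞 K) z), hO _⟩ : O) = ⟨g * c, hO c⟩ * z :=
        Subtype.ext (mul_assoc _ _ _).symm
      rw [this]; exact I.mul_mem_left _ hz
    · intro c
      convert I.zero_mem using 1
      exact Subtype.ext (by simp)
    · intro y z _ _ hy hz c
      convert I.add_mem (hy c) (hz c) using 1
      exact Subtype.ext (by simp [mul_add])
    · intro c y _ hy d
      convert hy (d * c) using 1
      exact Subtype.ext (by simp [mul_assoc])
  obtain ⟨a, ha, b, h⟩ := isPrimeTo_iff.1 hI
  have hx' : x = x * a + b * (⟨g * (x : 𝓞 K), hO x⟩ : O) := by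
    refine Subtype.ext ?_
    have := congrArg O.val h
    simp only [map_add, map_mul, Subalgebra.coe_val, map_natCast, map_one] at this
    push_cast
    linear_combination (-(x : 𝓞 K)) * this
  rw [hx']
  exact I.add_mem (I.mul_mem_left _ ha) (I.mul_mem_left _ (by simpa using key _ hx 1))

theorem contract_mul {O : Subalgebra ℤ (𝓞 K)} {g : ℕ}
    (hO : ∀ t : 𝓞 K, (g : 𝓞 K) * t ∈ O) {I J : Ideal (𝓞 K)} (hI : IsPrimeTo g I)
    (hJ : IsPrimeTo g J) : contract O (I * J) = contract O I * contract O J := by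
  have h : extend (contract O I * contract O J) = I * J := by
    rw [extend, Ideal.map_mul]
    exact congrArg₂ _ (extend_contract hO hI) (extend_contract hO hJ)
  rw [← h, contract_extend hO ((hI.contract hO).mul (hJ.contract hO))]

theorem contract_pow {O : Subalgebra ℤ (𝓞 K)} {g : ℕ}
    (hO : ∀ t : 𝓞 K, (g : 𝓞 K) * t ∈ O) {I : Ideal (𝓞 K)} (hI : IsPrimeTo g I) (n : ℕ) :
    contract O (I ^ n) = contract O I ^ n := by
  induction n with
  | zero => simp [contract]
  | succ n ih => rw [pow_succ, contract_mul hO (hI.pow n) hI, ih, pow_succ]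

theorem extend_span (O : Subalgebra ℤ (𝓞 K)) (a : O) :
    extend (Ideal.span {a}) = Ideal.span {(a : 𝓞 K)} := by
  rw [extend, Ideal.map_span, Set.image_singleton]; rfl

theorem contract_span {O : Subalgebra ℤ (𝓞 K)} {g : ℕ} (hg : g ≠ 0)
    (hO : ∀ t : 𝓞 K, (g : 𝓞 K) * t ∈ O) {a : O} (ha : IsCoprime (a : 𝓞 K) (g : 𝓞 K)) :
    contract O (Ideal.span {(a : 𝓞 K)}) = Ideal.span {a} := by
  rw [← extend_span, contract_extend hO]
  exact isPrimeTo_span_iff.2 ((isCoprime_coe_iff hg hO).1 ha)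

/-! ### Representatives prime to a given integer -/

theorem IsPrimeTo.pow_right {R : Type*} [CommRing R] {g : ℕ} {I : Ideal R} (hI : IsPrimeTo g I)
    (n : ℕ) : IsPrimeTo (g ^ n) I := by
  induction n with
  | zero => exact isPrimeTo_iff.2 ⟨0, I.zero_mem, 1, by simp⟩
  | succ n ih => rw [pow_succ]; exact ih.mul_right hI

/-- The prime-to-`g` part of `M`, up to taking powers. -/
theorem exists_coprime_dvd_pow (g M : ℕ) (hM : M ≠ 0) :
    ∃ M' k : ℕ, M' ≠ 0 ∧ Nat.Coprime M' g ∧ M ∣ (g * M') ^ k := by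
  induction M using Nat.strong_induction_on with
  | _ M ih =>
    by_cases h : Nat.Coprime M g
    · exact ⟨M, 1, hM, h, by rw [pow_one]; exact dvd_mul_left _ _⟩
    · obtain ⟨c, hc⟩ := Nat.gcd_dvd_left M g
      have hd : 1 < Nat.gcd M g := by
        have := Nat.gcd_pos_of_pos_left g (Nat.pos_of_ne_zero hM)
        have h' : Nat.gcd M g ≠ 1 := h
        omega
      have hc0 : c ≠ 0 := by rintro rfl; simp at hc; exact hM hc
      have hlt : c < M := by
        rw [hc]; exact lt_mul_of_one_lt_left (Nat.pos_of_ne_zero hc0) hd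
      obtain ⟨M', k, h0, h1, h2⟩ := ih c hlt hc0
      refine ⟨M', k + 1, h0, h1, ?_⟩
      rw [hc, pow_succ, mul_comm]
      exact mul_dvd_mul h2 ((Nat.gcd_dvd_right M g).trans (dvd_mul_right _ _))

theorem natCast_isUnit_iff {m : ℕ} : IsUnit (m : 𝓞 K) ↔ m = 1 := by
  refine ⟨fun h => ?_, fun h => by simp [h]⟩
  have h1 : IsUnit (Algebra.norm ℤ (m : 𝓞 K)) := h.map _
  have h2 : Algebra.norm ℤ (m : 𝓞 K) = (m : ℤ) ^ Module.finrank ℤ (𝓞 K) := by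
    have := Algebra.norm_algebraMap_of_basis (Module.Free.chooseBasis ℤ (𝓞 K)) (m : ℤ)
    simpa [Module.finrank_eq_card_chooseBasisIndex] using this
  rw [h2, isUnit_pow_iff (Module.finrank_pos).ne'] at h1
  rw [Int.isUnit_iff] at h1
  omega

/-- An ideal class of an order of conductor dividing `g` contains ideals prime to any given integer:
the ideal `A` has a multiple `A * A'` with a generator congruent to `1` modulo `g`, where `A'` is
prime to `g * M`. -/
theorem exists_mul_eq_span {g : ℕ} (hg : g ≠ 0) {A : Ideal (𝓞 K)} (hA0 : A ≠ ⊥)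
    (hA : IsPrimeTo g A) (M : ℕ) (hM : M ≠ 0) :
    ∃ (γ : 𝓞 K) (A' : Ideal (𝓞 K)), γ ≠ 0 ∧ (g : 𝓞 K) ∣ γ - 1 ∧ IsPrimeTo (g * M) A' ∧
      A * A' = Ideal.span {γ} := by
  -- An auxiliary prime `p` keeps the ideal `A * (M')` below different from `A`, whence `γ ≠ 0`.
  obtain ⟨p, hpg, hp⟩ := Nat.exists_infinite_primes (g + 1)
  obtain ⟨M', k, hM'0, hM'g, hM'⟩ := exists_coprime_dvd_pow g (M * p) (mul_ne_zero hM hp.ne_zero)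
  have hM'ne : M' ≠ 1 := by
    rintro rfl
    rw [mul_one] at hM'
    have := (hp.dvd_of_dvd_pow ((dvd_mul_left p M).trans hM'))
    have := Nat.le_of_dvd (Nat.pos_of_ne_zero hg) this
    omega
  have hM'bot : Ideal.span {(M' : 𝓞 K)} ≠ ⊥ := by
    rw [Ne, Ideal.span_singleton_eq_bot]; exact_mod_cast hM'0
  have hcop : IsPrimeTo g (Ideal.span {(M' : 𝓞 K)}) := by
    rw [isPrimeTo_span_iff]
    simpa using (Nat.isCoprime_iff_coprime.2 hM'g).map (Int.castRingHom (𝓞 K))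
  obtain ⟨a, ha⟩ := IsDedekindDomain.exists_sup_span_eq
    (I := A * Ideal.span {(M' : 𝓞 K)}) (J := A) Ideal.mul_le_left (mul_ne_zero hA0 hM'bot)
  obtain ⟨i, hi, t, hit⟩ := isPrimeTo_iff.1 (hA.mul hcop)
  have hsup : A * Ideal.span {(M' : 𝓞 K)} ⊔ Ideal.span {a * (g * t) + i} = A := by
    refine le_antisymm (sup_le Ideal.mul_le_left ?_) ?_
    · rw [Ideal.span_singleton_le_iff_mem]
      refine A.add_mem (A.mul_mem_right _ ?_) (Ideal.mul_le_left hi)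
      rw [← ha]; exact Ideal.mem_sup_right (Ideal.mem_span_singleton_self a)
    · conv_lhs => rw [← ha]
      refine sup_le le_sup_left ?_
      rw [Ideal.span_singleton_le_iff_mem]
      have : a = (i * (a - 1)) + (a * (g * t) + i) := by linear_combination (-a) * hit
      have hm := Ideal.add_mem (A * Ideal.span {(M' : 𝓞 K)} ⊔ Ideal.span {a * (g * t) + i})
        (Ideal.mem_sup_left (Ideal.mul_mem_right (a - 1) _ hi))
        (Ideal.mem_sup_right (Ideal.mem_span_singleton_self _))
      rwa [← this] at hm
  set γ := a * (g * t) + i with hγ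
  have hdvd : A ∣ Ideal.span {γ} := Ideal.dvd_iff_le.2 (by conv_rhs => rw [← hsup]
                                                           exact le_sup_right)
  obtain ⟨A', hA'⟩ := hdvd
  have hMA' : IsCoprime (Ideal.span {(M' : 𝓞 K)}) A' := by
    rw [Ideal.isCoprime_iff_sup_eq]
    rw [hA', ← Ideal.mul_sup] at hsup
    have h1 : A * (Ideal.span {(M' : 𝓞 K)} ⊔ A') = A * 1 := by rw [hsup, mul_one]
    rw [mul_left_cancel₀ hA0 h1, Ideal.one_eq_top]
  have hγ1 : (g : 𝓞 K) ∣ γ - 1 := ⟨(a - 1) * t, by rw [hγ]; linear_combination hit⟩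
  have hgγ : IsPrimeTo g (Ideal.span {γ}) := by
    obtain ⟨c, hc⟩ := hγ1
    exact isPrimeTo_span_iff.2 ⟨1, -c, by linear_combination hc⟩
  refine ⟨γ, A', ?_, hγ1, ?_, hA'.symm⟩
  · intro h0
    rw [h0, Ideal.span_singleton_eq_bot.2 rfl] at hA'
    have : A' = ⊥ := by
      rcases mul_eq_zero.1 hA'.symm with h | h
      · exact absurd h hA0
      · exact h
    rw [this, Ideal.isCoprime_iff_sup_eq, sup_bot_eq, Ideal.span_singleton_eq_top,
      natCast_isUnit_iff] at hMA'
    exact hM'ne hMA'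
  · have h1 : IsPrimeTo g A' := hgγ.of_dvd ⟨A, by rw [hA', mul_comm]⟩
    have h2 : IsPrimeTo (g * M') A' := h1.mul_right hMA'.symm
    exact h1.mul_right (((h2.pow_right k).of_dvd_right hM').of_dvd_right (dvd_mul_right _ _))

/-! ### Ideal classes of an order in terms of ideals of the maximal order -/

/-- The group of fractional ideals of `𝓞 K` prime to `g`. -/
def primeToGroup (K : Type*) [Field K] [NumberField K] (g : ℕ) :
    Subgroup (FractionalIdeal (𝓞 K)⁰ K)ˣ where
  carrier := {L | ∃ A B : (Ideal (𝓞 K))⁰, IsPrimeTo g (A : Ideal (𝓞 K)) ∧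
    IsPrimeTo g (B : Ideal (𝓞 K)) ∧ L * FractionalIdeal.mk0 K B = FractionalIdeal.mk0 K A}
  one_mem' := ⟨1, 1, isCoprime_one_left, isCoprime_one_left, by simp⟩
  mul_mem' := by
    rintro L M ⟨A, B, hA, hB, h⟩ ⟨A', B', hA', hB', h'⟩
    refine ⟨A * A', B * B', hA.mul hA', hB.mul hB', ?_⟩
    rw [map_mul, map_mul, ← h, ← h', mul_mul_mul_comm]
  inv_mem' := by
    rintro L ⟨A, B, hA, hB, h⟩
    exact ⟨B, A, hB, hA, by rw [← h, inv_mul_cancel_left]⟩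

/-- The group of the elements `a / b` of `Kˣ`, where `a` and `b` belong to the order `O` and are prime
to `g`. If `g` is a multiple of the conductor of `O`, these are the generators of the principal
fractional ideals of `O` prime to `g`. -/
def orderUnits (O : Subalgebra ℤ (𝓞 K)) (g : ℕ) : Subgroup Kˣ where
  carrier := {x | ∃ a ∈ O, ∃ b ∈ O, a ≠ 0 ∧ b ≠ 0 ∧ IsCoprime a (g : 𝓞 K) ∧
    IsCoprime b (g : 𝓞 K) ∧ (x : K) * algebraMap (𝓞 K) K b = algebraMap (𝓞 K) K a}
  one_mem' := ⟨1, O.one_mem, 1, O.one_mem, one_ne_zero, one_ne_zero, isCoprime_one_left,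
    isCoprime_one_left, by simp⟩
  mul_mem' := by
    rintro x y ⟨a, ha, b, hb, ha0, hb0, hag, hbg, h⟩ ⟨a', ha', b', hb', ha0', hb0', hag', hbg', h'⟩
    refine ⟨a * a', O.mul_mem ha ha', b * b', O.mul_mem hb hb', mul_ne_zero ha0 ha0',
      mul_ne_zero hb0 hb0', hag.mul_left hag', hbg.mul_left hbg', ?_⟩
    rw [map_mul, map_mul, ← h, ← h', Units.val_mul, mul_mul_mul_comm]
  inv_mem' := by
    rintro x ⟨a, ha, b, hb, ha0, hb0, hag, hbg, h⟩
    exact ⟨b, hb, a, ha, hb0, ha0, hbg, hag, by rw [← h, Units.inv_mul_cancel_left]⟩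

/-- The group of fractional ideals of `𝓞 K` of the form `x Lⁿ`, where `L` is prime to `g` and `x` is
a quotient of elements of `O` prime to `g`. If `g` is a multiple of the conductor of `O`, these are
the ideals prime to `g` whose contractions to `O` have class in `n Cl(O)`. -/
def nthClasses (O : Subalgebra ℤ (𝓞 K)) (g n : ℕ) : Subgroup (FractionalIdeal (𝓞 K)⁰ K)ˣ :=
  (orderUnits O g).map (toPrincipalIdeal (𝓞 K) K) ⊔ (primeToGroup K g).map (powMonoidHom n)

theorem mem_nthClasses {O : Subalgebra ℤ (𝓞 K)} {g n : ℕ} {I : (FractionalIdeal (𝓞 K)⁰ K)ˣ} :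
    I ∈ nthClasses O g n ↔ ∃ x ∈ orderUnits O g, ∃ L ∈ primeToGroup K g,
      toPrincipalIdeal (𝓞 K) K x * L ^ n = I := by
  simp only [nthClasses, Subgroup.mem_sup, Subgroup.mem_map, powMonoidHom_apply]
  simp only [exists_exists_and_eq_and]

theorem mem_nonZeroDivisors_span {γ : 𝓞 K} (hγ : γ ≠ 0) :
    Ideal.span {γ} ∈ (Ideal (𝓞 K))⁰ :=
  mem_nonZeroDivisors_of_ne_zero (by rwa [Ne, Ideal.zero_eq_bot, Ideal.span_singleton_eq_bot])

/-- The nonzero element `γ` of `𝓞 K` as a unit of `K`. -/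
def fieldUnit (γ : 𝓞 K) (hγ : γ ≠ 0) : Kˣ :=
  Units.mk0 (algebraMap (𝓞 K) K γ) (by simpa using hγ)

theorem mk0_span {γ : 𝓞 K} (hγ : γ ≠ 0) :
    FractionalIdeal.mk0 K ⟨Ideal.span {γ}, mem_nonZeroDivisors_span hγ⟩ =
      toPrincipalIdeal (𝓞 K) K (fieldUnit γ hγ) := by
  ext1
  rw [FractionalIdeal.coe_mk0, coe_toPrincipalIdeal, FractionalIdeal.coeIdeal_span_singleton]
  rfl

theorem mk0_eq_of_eq_span {γ : 𝓞 K} (hγ : γ ≠ 0) {I : (Ideal (𝓞 K))⁰}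
    (h : (I : Ideal (𝓞 K)) = Ideal.span {γ}) :
    FractionalIdeal.mk0 K I = toPrincipalIdeal (𝓞 K) K (fieldUnit γ hγ) := by
  rw [← mk0_span hγ]; congr 1; exact Subtype.ext h

theorem fieldUnit_mem_orderUnits {O : Subalgebra ℤ (𝓞 K)} {g : ℕ} {γ : 𝓞 K} (hγ : γ ≠ 0)
    (h : γ ∈ O) (hg : IsCoprime γ (g : 𝓞 K)) : fieldUnit γ hγ ∈ orderUnits O g :=
  ⟨γ, h, 1, O.one_mem, hγ, one_ne_zero, hg, isCoprime_one_left, by simp [fieldUnit]⟩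

theorem mk0_mem_primeToGroup {g : ℕ} {I : (Ideal (𝓞 K))⁰} (hI : IsPrimeTo g (I : Ideal (𝓞 K))) :
    FractionalIdeal.mk0 K I ∈ primeToGroup K g :=
  ⟨I, 1, hI, isCoprime_one_left, by simp⟩

theorem toPrincipalIdeal_mem_primeToGroup {O : Subalgebra ℤ (𝓞 K)} {g : ℕ} {x : Kˣ}
    (hx : x ∈ orderUnits O g) : toPrincipalIdeal (𝓞 K) K x ∈ primeToGroup K g := by
  obtain ⟨a, ha, b, hb, ha0, hb0, hag, hbg, h⟩ := hx
  refine ⟨⟨Ideal.span {a}, mem_nonZeroDivisors_span ha0⟩,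
    ⟨Ideal.span {b}, mem_nonZeroDivisors_span hb0⟩,
    isPrimeTo_span_iff.2 hag, isPrimeTo_span_iff.2 hbg, ?_⟩
  rw [mk0_span ha0, mk0_span hb0, ← map_mul]
  congr 1
  exact Units.ext h

theorem mem_of_dvd_sub_one {O : Subalgebra ℤ (𝓞 K)} {g : ℕ}
    (hO : ∀ t : 𝓞 K, (g : 𝓞 K) * t ∈ O) {γ : 𝓞 K} (h : (g : 𝓞 K) ∣ γ - 1) :
    γ ∈ O ∧ IsCoprime γ (g : 𝓞 K) := by
  obtain ⟨c, hc⟩ := h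
  refine ⟨?_, 1, -c, by linear_combination hc⟩
  have : γ = g * c + 1 := by linear_combination hc
  rw [this]; exact O.add_mem (hO _) O.one_mem

/-- The fractional ideals prime to `g` have inverse classes, modulo principal ideals generated by
`orderUnits O g`, that contain integral ideals prime to any given integer. -/
theorem exists_mul_mk0_eq {O : Subalgebra ℤ (𝓞 K)} {g : ℕ} (hg : g ≠ 0)
    (hO : ∀ t : 𝓞 K, (g : 𝓞 K) * t ∈ O) {L : (FractionalIdeal (𝓞 K)⁰ K)ˣ}
    (hL : L ∈ primeToGroup K g) (M : ℕ) (hM : M ≠ 0) :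
    ∃ y ∈ orderUnits O g, ∃ Z : (Ideal (𝓞 K))⁰, IsPrimeTo (g * M) (Z : Ideal (𝓞 K)) ∧
      L * FractionalIdeal.mk0 K Z = toPrincipalIdeal (𝓞 K) K y := by
  have step : ∀ A : (Ideal (𝓞 K))⁰, IsPrimeTo g (A : Ideal (𝓞 K)) →
      ∃ y ∈ orderUnits O g, ∃ Z : (Ideal (𝓞 K))⁰, IsPrimeTo (g * M) (Z : Ideal (𝓞 K)) ∧
      FractionalIdeal.mk0 K A * FractionalIdeal.mk0 K Z = toPrincipalIdeal (𝓞 K) K y := by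
    intro A hA
    obtain ⟨γ, A', hγ, h1, hA', h⟩ := exists_mul_eq_span hg (nonZeroDivisors.coe_ne_zero A) hA M hM
    have hA'0 : A' ≠ 0 := by
      rintro rfl
      rw [mul_zero, eq_comm, Ideal.zero_eq_bot, Ideal.span_singleton_eq_bot] at h
      exact hγ h
    obtain ⟨hγO, hγg⟩ := mem_of_dvd_sub_one hO h1
    refine ⟨_, fieldUnit_mem_orderUnits hγ hγO hγg,
      ⟨A', mem_nonZeroDivisors_of_ne_zero hA'0⟩, hA', ?_⟩
    rw [← map_mul]
    exact mk0_eq_of_eq_span hγ h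
  obtain ⟨A, B, hA, hB, h⟩ := hL
  obtain ⟨y, hy, A', hA', h1⟩ := step A hA
  obtain ⟨y₁, hy₁, B', hB', h2⟩ := step B hB
  obtain ⟨y₂, hy₂, B'', hB'', h3⟩ := step B' (hB'.of_dvd_right (dvd_mul_right _ _))
  refine ⟨y * y₁⁻¹ * y₂, mul_mem (mul_mem hy (inv_mem hy₁)) hy₂, A' * B'', hA'.mul hB'', ?_⟩
  rw [map_mul, map_mul, map_mul, map_inv, ← h1, ← h2, ← h3, eq_mul_inv_of_mul_eq h]
  simp only [mul_inv]
  rw [show ∀ a b b' a' b'' : (FractionalIdeal (𝓞 K)⁰ K)ˣ, a * a' * (b⁻¹ * b'⁻¹) * (b' * b'') =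
    a * b⁻¹ * (a' * b'') from fun a b b' a' b'' => by
      calc _ = a * a' * b⁻¹ * (b'⁻¹ * b') * b'' := by ac_rfl
        _ = _ := by rw [inv_mul_cancel]; simp only [mul_one]; ac_rfl]

/-- An ideal whose class lies in `n Cl(O)` becomes principal, with a generator in `O`, after
multiplication by the `n`-th power of an ideal prime to any given integer. -/
theorem exists_mul_pow_eq_span {O : Subalgebra ℤ (𝓞 K)} {g n : ℕ} (hg : g ≠ 0)
    (hO : ∀ t : 𝓞 K, (g : 𝓞 K) * t ∈ O) {J : (Ideal (𝓞 K))⁰}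
    (hJ : FractionalIdeal.mk0 K J ∈ nthClasses O g n) (M : ℕ) (hM : M ≠ 0) :
    ∃ β ∈ O, ∃ Z : Ideal (𝓞 K), β ≠ 0 ∧ IsPrimeTo (g * M) Z ∧
      (J : Ideal (𝓞 K)) * Z ^ n = Ideal.span {β} := by
  obtain ⟨x, hx, L, hL, h⟩ := mem_nthClasses.1 hJ
  obtain ⟨y, hy, Z, hZ, h'⟩ := exists_mul_mk0_eq hg hO hL M hM
  have h2 : FractionalIdeal.mk0 K (J * Z ^ n) = toPrincipalIdeal (𝓞 K) K (x * y ^ n) := by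
    rw [map_mul, map_pow, map_mul, map_pow, ← h', ← h, mul_pow, mul_assoc]
  obtain ⟨a, ha, b, hb, ha0, hb0, hag, hbg, hab⟩ := mul_mem hx (pow_mem hy n)
  have h3 := congrArg Units.val h2
  rw [FractionalIdeal.coe_mk0, coe_toPrincipalIdeal] at h3
  have h4 : ((x * y ^ n : Kˣ) : K) ∈
      (((J * Z ^ n : (Ideal (𝓞 K))⁰) : Ideal (𝓞 K)) : FractionalIdeal (𝓞 K)⁰ K) := by
    rw [h3]; exact FractionalIdeal.mem_spanSingleton_self _ _
  obtain ⟨β, hβ, hβ'⟩ := (FractionalIdeal.mem_coeIdeal _).1 h4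
  have hβ0 : β ≠ 0 := by
    rintro rfl; rw [map_zero] at hβ'; exact (x * y ^ n).ne_zero hβ'.symm
  refine ⟨β, ?_, Z, hβ0, hZ, ?_⟩
  · refine mem_of_mul_mem hg hO hb hbg ?_
    rw [← hβ', ← map_mul] at hab
    rw [mul_comm, FaithfulSMul.algebraMap_injective (𝓞 K) K hab]
    exact ha
  · rw [← hβ', ← FractionalIdeal.coeIdeal_span_singleton] at h3
    simpa using FractionalIdeal.coeIdeal_injective h3

theorem IsPrimeTo.exists_isCoprime_mem {R : Type*} [CommRing R] {g : ℕ} {I : Ideal R}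
    (hI : IsPrimeTo g I) (h0 : I ≠ ⊥) : ∃ a ∈ I, a ≠ 0 ∧ IsCoprime a (g : R) := by
  obtain ⟨a, ha, b, h⟩ := isPrimeTo_iff.1 hI
  by_cases ha0 : a = 0
  · obtain ⟨c, hc, hc0⟩ := Submodule.exists_mem_ne_zero_of_ne_bot h0
    exact ⟨c, hc, hc0, 0, b, by rw [← h, ha0]; ring⟩
  · exact ⟨a, ha, ha0, 1, b, by linear_combination h⟩

/-- If multiplication by `α` maps an ideal of `O` prime to `g` onto another one, then `α` is a
quotient of elements of `O` prime to `g`. -/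
theorem mem_orderUnits_of_mul_ideal {O : Subalgebra ℤ (𝓞 K)} {g : ℕ} {I J : Ideal O} {α : Kˣ}
    (hI0 : I ≠ ⊥) (hI : IsPrimeTo g I) (hJ : IsPrimeTo g J)
    (h1 : ∀ i ∈ I, ∃ j ∈ J, (α : K) * algebraMap (𝓞 K) K i = algebraMap (𝓞 K) K j)
    (h2 : ∀ j ∈ J, ∃ i ∈ I, (α : K) * algebraMap (𝓞 K) K i = algebraMap (𝓞 K) K j) :
    α ∈ orderUnits O g := by
  obtain ⟨i, hi, hi0, hig⟩ := hI.exists_isCoprime_mem hI0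
  have hi0' : (i : 𝓞 K) ≠ 0 := by simpa using hi0
  obtain ⟨j, hj, hij⟩ := h1 i hi
  have hj0 : (j : 𝓞 K) ≠ 0 := by
    intro h
    rw [h, map_zero, mul_eq_zero] at hij
    rcases hij with hij | hij
    · exact α.ne_zero hij
    · exact hi0' (by simpa using hij)
  have hJ0 : J ≠ ⊥ := by
    rintro rfl; rw [Ideal.mem_bot] at hj; exact hj0 (by simp [hj])
  obtain ⟨j', hj', hj'0, hj'g⟩ := hJ.exists_isCoprime_mem hJ0
  obtain ⟨i', hi', hij'⟩ := h2 j' hj'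
  have key : (i : 𝓞 K) * j' = i' * j := by
    apply FaithfulSMul.algebraMap_injective (𝓞 K) K
    rw [map_mul, map_mul, ← hij, ← hij']; ring
  have hcop : ∀ {a : O}, IsCoprime a (g : O) → IsCoprime (a : 𝓞 K) (g : 𝓞 K) := fun h => by
    simpa using h.map O.val.toRingHom
  refine ⟨j, j.2, i, i.2, hj0, hi0', ?_, hcop hig, hij⟩
  have := (hcop hig).mul_left (hcop hj'g)
  rw [key] at this
  exact this.of_mul_left_right

/-! ### Invertible ideals of the order -/

/-- An invertible fractional ideal of a domain has, up to a principal factor, an integral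
representative prime to an element `g` that lies in only finitely many maximal ideals: as in the proof
that invertible ideals of semilocal rings are principal, the Chinese remainder theorem gives `v ∈ I⁻¹`
such that `v I` is contained in none of these maximal ideals. -/
theorem exists_spanSingleton_mul_eq {R F : Type*} [CommRing R] [IsDomain R] [Field F] [Algebra R F]
    [IsFractionRing R F] (g : R) (hfin : {I : Ideal R | I.IsMaximal ∧ g ∈ I}.Finite)
    (I : (FractionalIdeal R⁰ F)ˣ) :
    ∃ (v : Fˣ) (J : Ideal R), (J : FractionalIdeal R⁰ F) =
      ((toPrincipalIdeal R F v * I : (FractionalIdeal R⁰ F)ˣ) : FractionalIdeal R⁰ F) ∧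
      J ⊔ Ideal.span {g} = ⊤ := by
  classical
  have hinv : (I : FractionalIdeal R⁰ F) * (I⁻¹ : (FractionalIdeal R⁰ F)ˣ) = 1 := I.mul_inv
  suffices H : ∃ v ∈ ((I⁻¹ : (FractionalIdeal R⁰ F)ˣ) : FractionalIdeal R⁰ F), v ≠ 0 ∧
      ∀ J : Ideal R, (J : FractionalIdeal R⁰ F) = FractionalIdeal.spanSingleton R⁰ v * I →
        J ⊔ Ideal.span {g} = ⊤ by
    obtain ⟨v, hv, hv0, h⟩ := H
    have hle : FractionalIdeal.spanSingleton R⁰ v * I ≤ 1 := by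
      rw [← hinv, mul_comm]
      gcongr
      exact FractionalIdeal.spanSingleton_le_iff_mem.2 hv
    obtain ⟨J, hJ⟩ := FractionalIdeal.le_one_iff_exists_coeIdeal.1 hle
    exact ⟨Units.mk0 v hv0, J, by rw [Units.val_mul, coe_toPrincipalIdeal]; exact hJ, h J hJ⟩
  -- The general choice of `v` below could be zero if no maximal ideal contains `g`.
  by_cases hgu : IsUnit g
  · obtain ⟨v, hv, hv0⟩ := Submodule.exists_mem_ne_zero_of_ne_bot
      (p := (((I⁻¹ : (FractionalIdeal R⁰ F)ˣ) : FractionalIdeal R⁰ F) : Submodule R F))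
      (fun h => (I⁻¹).ne_zero (FractionalIdeal.coeToSubmodule_eq_bot.1 h))
    exact ⟨v, hv, hv0, fun J _ => by rw [Ideal.span_singleton_eq_top.2 hgu, sup_top_eq]⟩
  set s := hfin.toFinset with hs
  have hmem : ∀ M, M ∈ s ↔ M.IsMaximal ∧ g ∈ M := fun M => by simp [hs]
  have hprod : ∀ a ∈ (I : FractionalIdeal R⁰ F),
      ∀ b ∈ ((I⁻¹ : (FractionalIdeal R⁰ F)ˣ) : FractionalIdeal R⁰ F),
      ∃ c : R, algebraMap R F c = a * b := fun a ha b hb => by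
    have := FractionalIdeal.mul_mem_mul ha hb
    rw [hinv] at this
    exact (FractionalIdeal.mem_one_iff _).1 this
  -- Since `I I⁻¹ = 1`, for each `M` some product `a b` with `a ∈ I` and `b ∈ I⁻¹` is not in `M`.
  have h1 : ∀ M ∈ s, ∃ a ∈ (I : FractionalIdeal R⁰ F),
      ∃ b ∈ ((I⁻¹ : (FractionalIdeal R⁰ F)ˣ) : FractionalIdeal R⁰ F),
      ∃ c : R, algebraMap R F c = a * b ∧ c ∉ M := by
    intro M hM
    by_contra! h
    have hle : (I : FractionalIdeal R⁰ F) * (I⁻¹ : (FractionalIdeal R⁰ F)ˣ) ≤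
        (M : FractionalIdeal R⁰ F) := by
      rw [FractionalIdeal.mul_le]
      intro a ha b hb
      obtain ⟨c, hc⟩ := hprod a ha b hb
      exact (FractionalIdeal.mem_coeIdeal _).2 ⟨c, h a ha b hb c hc, hc⟩
    rw [hinv, ← FractionalIdeal.coeIdeal_top] at hle
    exact ((hmem M).1 hM).1.ne_top
      (top_le_iff.1 ((FractionalIdeal.coeIdeal_le_coeIdeal F).1 hle))
  choose! a ha b hb c hc hcM using h1
  -- The weights `u M` separate `M` from the other maximal ideals containing `g`.
  have h2 : ∀ M ∈ s, ∃ u, u ∉ M ∧ ∀ M' ∈ s, M' ≠ M → u ∈ M' := by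
    intro M hM
    have hsup : M ⊔ ⨅ M' ∈ s.erase M, M' = ⊤ := Ideal.sup_iInf_eq_top fun M' hM' => by
      rw [Finset.mem_erase] at hM'
      exact Ideal.IsMaximal.coprime_of_ne ((hmem M).1 hM).1 ((hmem M').1 hM'.2).1 hM'.1.symm
    have hnle : ¬ (⨅ M' ∈ s.erase M, M') ≤ M := fun h => by
      rw [sup_eq_left.2 h] at hsup
      exact ((hmem M).1 hM).1.ne_top hsup
    obtain ⟨u, hu, huM⟩ := SetLike.not_le_iff_exists.1 hnle
    refine ⟨u, huM, fun M' hM' hne => ?_⟩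
    simp only [Ideal.mem_iInf] at hu
    exact hu M' (Finset.mem_erase.2 ⟨hne, hM'⟩)
  choose! u huM hu using h2
  set v := ∑ M ∈ s, algebraMap R F (u M) * b M with hv
  have hvmem : v ∈ ((I⁻¹ : (FractionalIdeal R⁰ F)ˣ) : FractionalIdeal R⁰ F) := by
    refine Submodule.sum_mem _ fun M hM => ?_
    rw [← Algebra.smul_def]
    exact Submodule.smul_mem _ _ (hb M hM)
  have htop : ∀ J : Ideal R, (J : FractionalIdeal R⁰ F) = FractionalIdeal.spanSingleton R⁰ v * I →
      J ⊔ Ideal.span {g} = ⊤ := by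
    intro J hJ
    by_contra hne
    obtain ⟨M, hMmax, hM⟩ := Ideal.exists_le_maximal _ hne
    have hMs : M ∈ s := (hmem M).2 ⟨hMmax, hM (Ideal.mem_sup_right (Ideal.mem_span_singleton_self g))⟩
    have hav : v * a M ∈ (J : FractionalIdeal R⁰ F) := by
      rw [hJ]; exact FractionalIdeal.mem_singleton_mul.2 ⟨a M, ha M hMs, rfl⟩
    obtain ⟨r, hr, hra⟩ := (FractionalIdeal.mem_coeIdeal _).1 hav
    have hrM : r ∈ M := hM (Ideal.mem_sup_left hr)
    have h3 : ∀ M' ∈ s, ∃ e : R, algebraMap R F e = a M * b M' := fun M' hM' =>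
      hprod _ (ha M hMs) _ (hb M' hM')
    choose! e he using h3
    -- Modulo `M`, only the summand with index `M` of `v * a M` remains, and it is not in `M`.
    have h4 : r = u M * e M + ∑ M' ∈ s.erase M, u M' * e M' := by
      rw [Finset.add_sum_erase s (fun M' => u M' * e M') hMs]
      apply FaithfulSMul.algebraMap_injective R F
      rw [hra, hv, Finset.sum_mul, map_sum]
      refine Finset.sum_congr rfl fun M' hM' => ?_
      rw [map_mul, he M' hM']; ring
    have h5 : ∑ M' ∈ s.erase M, u M' * e M' ∈ M := Ideal.sum_mem _ fun M' hM' =>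
      Ideal.mul_mem_right _ _ (hu M' (Finset.mem_of_mem_erase hM') M hMs
        (Finset.ne_of_mem_erase hM').symm)
    have h6 : u M * e M ∈ M := by
      rw [h4] at hrM; exact (Ideal.add_mem_iff_left _ h5).1 hrM
    have h7 : e M = c M := by
      apply FaithfulSMul.algebraMap_injective R F
      rw [he M hMs, hc M hMs]
    rcases hMmax.isPrime.mem_or_mem h6 with h | h
    · exact huM M hMs h
    · exact hcM M hMs (h7 ▸ h)
  refine ⟨v, hvmem, fun hv0 => hgu ?_, htop⟩
  have := htop ⊥ (by rw [hv0, FractionalIdeal.spanSingleton_zero, zero_mul,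
    FractionalIdeal.coeIdeal_bot])
  rwa [bot_sup_eq, Ideal.span_singleton_eq_top] at this

theorem finite_quotient_order (O : Subalgebra ℤ (𝓞 K)) {I : Ideal O} (hI : I ≠ ⊥) :
    Finite (O ⧸ I) := by
  have : Module.Finite ℤ O := inferInstanceAs (Module.Finite ℤ (Subalgebra.toSubmodule O))
  have : Module.Free ℤ O := Module.free_of_finite_type_torsion_free'
  exact Ideal.finiteQuotientOfFreeOfNeBot _ hI

theorem finite_setOf_mem_maximal (O : Subalgebra ℤ (𝓞 K)) {x : O} (hx : x ≠ 0) :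
    {I : Ideal O | I.IsMaximal ∧ x ∈ I}.Finite := by
  have := finite_quotient_order O (I := Ideal.span {x}) (by rwa [Ne, Ideal.span_singleton_eq_bot])
  have : Finite (Ideal (O ⧸ Ideal.span {x})) :=
    Finite.of_injective (fun I => (I : Set (O ⧸ Ideal.span {x}))) SetLike.coe_injective
  refine Set.Finite.subset (Set.finite_range
    fun I : Ideal (O ⧸ Ideal.span {x}) => I.comap (Ideal.Quotient.mk _)) ?_
  rintro I ⟨-, hI⟩
  refine ⟨I.map (Ideal.Quotient.mk _), ?_⟩
  change (I.map (Ideal.Quotient.mk (Ideal.span {x}))).comap (Ideal.Quotient.mk _) = I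
  rw [Ideal.comap_map_quotientMk, sup_eq_right, Ideal.span_singleton_le_iff_mem]
  exact hI

/-- Every class of invertible ideals of `O` contains an integral ideal prime to `g`. -/
theorem exists_classGroup_rep (O : Subalgebra ℤ (𝓞 K)) {g : ℕ} (hg : g ≠ 0) (c : ClassGroup O) :
    ∃ (J : Ideal O) (I : (FractionalIdeal (O)⁰ (FractionRing O))ˣ),
      (I : FractionalIdeal (O)⁰ (FractionRing O)) = J ∧ IsPrimeTo g J ∧
      ClassGroup.mk (FractionRing O) I = c := by
  refine ClassGroup.induction (FractionRing O) (P := fun c => ∃ (J : Ideal O)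
    (I : (FractionalIdeal (O)⁰ (FractionRing O))ˣ),
      (I : FractionalIdeal (O)⁰ (FractionRing O)) = J ∧ IsPrimeTo g J ∧
      ClassGroup.mk (FractionRing O) I = c) (fun I => ?_) c
  have hg' : (g : O) ≠ 0 := by
    intro h; apply hg; have := congrArg O.val h; simpa using this
  obtain ⟨v, J, hJ, htop⟩ := exists_spanSingleton_mul_eq (g : O)
    (finite_setOf_mem_maximal O hg') I
  refine ⟨J, _, hJ.symm, Ideal.isCoprime_iff_sup_eq.2 htop, ?_⟩
  exact (ClassGroup.mk_eq_mk.2 ⟨v, mul_comm _ _⟩).symm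

/-- The contraction to `O` of a nonzero ideal prime to the conductor is invertible. -/
theorem exists_unit_eq_contract {O : Subalgebra ℤ (𝓞 K)} {g : ℕ} (hg : g ≠ 0)
    (hO : ∀ t : 𝓞 K, (g : 𝓞 K) * t ∈ O) {A : Ideal (𝓞 K)} (hA0 : A ≠ ⊥) (hA : IsPrimeTo g A) :
    ∃ I : (FractionalIdeal (O)⁰ (FractionRing O))ˣ,
      (I : FractionalIdeal (O)⁰ (FractionRing O)) = contract O A := by
  obtain ⟨γ, A', hγ, h1, hA', h⟩ := exists_mul_eq_span hg hA0 hA 1 one_ne_zero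
  obtain ⟨hγO, hγg⟩ := mem_of_dvd_sub_one hO h1
  have h2 : contract O A * contract O A' = Ideal.span {(⟨γ, hγO⟩ : O)} := by
    rw [← contract_mul hO hA (hA'.of_dvd_right (dvd_mul_right _ _)), h]
    exact contract_span hg hO (a := ⟨γ, hγO⟩) hγg
  have h3 : (algebraMap O (FractionRing O)) ⟨γ, hγO⟩ ≠ 0 := by
    rw [Ne, FaithfulSMul.algebraMap_eq_zero_iff]
    exact fun h => hγ (congrArg O.val h)
  have h4 : (contract O A : FractionalIdeal (O)⁰ (FractionRing O)) *
      ((contract O A' : FractionalIdeal (O)⁰ (FractionRing O)) *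
      FractionalIdeal.spanSingleton _ ((algebraMap O (FractionRing O)) ⟨γ, hγO⟩)⁻¹) = 1 := by
    rw [← mul_assoc, ← FractionalIdeal.coeIdeal_mul, h2, FractionalIdeal.coeIdeal_span_singleton,
      FractionalIdeal.spanSingleton_mul_spanSingleton, mul_inv_cancel₀ h3,
      FractionalIdeal.spanSingleton_one]
  exact ⟨Units.mkOfMulEqOne _ _ h4, rfl⟩

/-- For ideals prime to the conductor, `ClassMemMultiples` can be read off in `𝓞 K`. -/
theorem classMemMultiples_iff {O : Subalgebra ℤ (𝓞 K)} {g : ℕ} (hg : g ≠ 0)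
    (hO : ∀ t : 𝓞 K, (g : 𝓞 K) * t ∈ O) (n : ℕ) (j : (Ideal (𝓞 K))⁰)
    (hj : IsPrimeTo g (j : Ideal (𝓞 K))) :
    ClassMemMultiples O n j ↔ FractionalIdeal.mk0 K j ∈ nthClasses O g n := by
  have hinj : ∀ x : O, x ≠ 0 → (x : 𝓞 K) ≠ 0 := fun x hx h => hx (Subtype.ext h)
  constructor
  · rintro ⟨I, hI, c, hc⟩
    change (I : FractionalIdeal (O)⁰ (FractionRing O)) = (contract O (j : Ideal (𝓞 K)) : Ideal O)
      at hI
    obtain ⟨J, IJ, hIJ, hJ, rfl⟩ := exists_classGroup_rep O hg c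
    rw [← map_pow, ClassGroup.mk_eq_mk_of_coe_ideal hI (J' := J ^ n)
      (by rw [Units.val_pow_eq_pow_val, hIJ, FractionalIdeal.coeIdeal_pow])] at hc
    obtain ⟨x, y, hx, hy, hxy⟩ := hc
    have hJ0 : J ≠ ⊥ := by
      rintro rfl
      exact IJ.ne_zero (by rw [hIJ, FractionalIdeal.coeIdeal_bot])
    have hJe0 : extend J ≠ ⊥ := by
      obtain ⟨z, hz, hz0⟩ := Submodule.exists_mem_ne_zero_of_ne_bot hJ0
      intro h
      have : algebraMap O (𝓞 K) z ∈ extend J := Ideal.mem_map_of_mem _ hz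
      rw [h, Ideal.mem_bot] at this
      exact hinj z hz0 this
    set α := fieldUnit (y : 𝓞 K) (hinj y hy) / fieldUnit (x : 𝓞 K) (hinj x hx) with hα
    have hx0 : algebraMap (𝓞 K) K x ≠ 0 := by simpa using hx
    have hαv : ∀ i j : O, (α : K) * algebraMap (𝓞 K) K i = algebraMap (𝓞 K) K j ↔
        y * i = x * j := by
      intro i j
      have : (α : K) = algebraMap (𝓞 K) K y / algebraMap (𝓞 K) K x := by
        rw [hα, Units.val_div_eq_div_val]; rfl
      rw [this, div_mul_eq_mul_div, div_eq_iff hx0, ← map_mul, ← map_mul,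
        (FaithfulSMul.algebraMap_injective (𝓞 K) K).eq_iff, mul_comm (j : 𝓞 K)]
      exact_mod_cast Iff.rfl
    have hαO : α ∈ orderUnits O g := by
      refine mem_orderUnits_of_mul_ideal (I := J ^ n) (J := contract O (j : Ideal (𝓞 K)))
        (pow_ne_zero n hJ0) (hJ.pow n) (hj.contract hO) ?_ ?_
      · intro i hi
        have : y * i ∈ Ideal.span {x} * contract O (j : Ideal (𝓞 K)) := by
          rw [hxy]; exact Ideal.mul_mem_mul (Ideal.mem_span_singleton_self y) hi
        obtain ⟨k, hk, hk'⟩ := Ideal.mem_span_singleton_mul.1 this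
        exact ⟨k, hk, (hαv _ _).2 hk'.symm⟩
      · intro i hi
        have : x * i ∈ Ideal.span {y} * J ^ n := by
          rw [← hxy]; exact Ideal.mul_mem_mul (Ideal.mem_span_singleton_self x) hi
        obtain ⟨k, hk, hk'⟩ := Ideal.mem_span_singleton_mul.1 this
        exact ⟨k, hk, (hαv _ _).2 hk'⟩
    refine mem_nthClasses.2 ⟨α, hαO, _, mk0_mem_primeToGroup (K := K)
      (I := ⟨extend J, mem_nonZeroDivisors_of_ne_zero hJe0⟩) hJ.extend, ?_⟩
    rw [hα, map_div, ← mk0_span, ← mk0_span, div_mul_eq_mul_div, div_eq_iff_eq_mul, ← map_pow,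
      ← map_mul, ← map_mul]
    congr 1
    apply Subtype.ext
    have h := congrArg extend hxy
    simp only [extend, Ideal.map_mul, Ideal.map_pow] at h
    change Ideal.span {(y : 𝓞 K)} * (extend J) ^ n = (j : Ideal (𝓞 K)) * Ideal.span {(x : 𝓞 K)}
    rw [← extend_span, ← extend_span, mul_comm (j : Ideal (𝓞 K)), ← extend_contract hO hj]
    exact h.symm
  · intro h
    obtain ⟨α, ⟨a, ha, b, hb, ha0, hb0, hag, hbg, hab⟩, L, ⟨A, B, hA, hB, hAB⟩, h⟩ :=
      mem_nthClasses.1 h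
    have key : Ideal.span {b} * ((j : Ideal (𝓞 K)) * (B : Ideal (𝓞 K)) ^ n) =
        Ideal.span {a} * (A : Ideal (𝓞 K)) ^ n := by
      have hα : α * fieldUnit b hb0 = fieldUnit a ha0 := Units.ext hab
      have : FractionalIdeal.mk0 K (⟨_, mem_nonZeroDivisors_span hb0⟩ * (j * B ^ n)) =
          FractionalIdeal.mk0 K (⟨_, mem_nonZeroDivisors_span ha0⟩ * A ^ n) := by
        rw [map_mul, map_mul, map_mul, map_pow, map_pow, mk0_span hb0, mk0_span ha0, ← h, ← hAB,
          ← hα, map_mul, mul_pow]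
        ac_rfl
      have := congrArg Units.val this
      rw [FractionalIdeal.coe_mk0, FractionalIdeal.coe_mk0] at this
      simpa using FractionalIdeal.coeIdeal_injective this
    have key' : Ideal.span {(⟨b, hb⟩ : O)} * (contract O j * contract O B ^ n) =
        Ideal.span {(⟨a, ha⟩ : O)} * contract O A ^ n := by
      have := congrArg (contract O) key
      rwa [contract_mul hO (isPrimeTo_span_iff.2 hbg) (hj.mul (hB.pow n)),
        contract_mul hO hj (hB.pow n), contract_pow hO hB,
        contract_mul hO (isPrimeTo_span_iff.2 hag) (hA.pow n), contract_pow hO hA,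
        contract_span hg hO (a := ⟨b, hb⟩) hbg, contract_span hg hO (a := ⟨a, ha⟩) hag] at this
    obtain ⟨Ij, hIj⟩ := exists_unit_eq_contract hg hO (nonZeroDivisors.coe_ne_zero j) hj
    obtain ⟨IA, hIA⟩ := exists_unit_eq_contract hg hO (nonZeroDivisors.coe_ne_zero A) hA
    obtain ⟨IB, hIB⟩ := exists_unit_eq_contract hg hO (nonZeroDivisors.coe_ne_zero B) hB
    refine ⟨Ij, hIj, ClassGroup.mk _ IA * (ClassGroup.mk _ IB)⁻¹, ?_⟩
    rw [mul_pow, inv_pow, eq_mul_inv_iff_mul_eq, ← map_pow, ← map_pow, ← map_mul]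
    refine (ClassGroup.mk_eq_mk_of_coe_ideal (I' := contract O j * contract O B ^ n)
      (J' := contract O A ^ n) ?_ ?_).2 ⟨_, _, ?_, ?_, key'⟩
    · rw [Units.val_mul, Units.val_pow_eq_pow_val, hIj, hIB, FractionalIdeal.coeIdeal_mul,
        FractionalIdeal.coeIdeal_pow]
    · rw [Units.val_pow_eq_pow_val, hIA, FractionalIdeal.coeIdeal_pow]
    · exact fun h => hb0 (congrArg O.val h)
    · exact fun h => ha0 (congrArg O.val h)

/-! ### Principal ideals of the order prime to the conductor -/

theorem isFractionRing_order {O : Subalgebra ℤ (𝓞 K)} {g : ℕ} (hg : g ≠ 0)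
    (hO : ∀ t : 𝓞 K, (g : 𝓞 K) * t ∈ O) : IsFractionRing O K := by
  refine IsFractionRing.of_field _ _ fun z => ?_
  obtain ⟨x, y, hy, rfl⟩ := IsFractionRing.div_surjective (A := 𝓞 K) z
  have hy0 : algebraMap (𝓞 K) K y ≠ 0 := by simpa using nonZeroDivisors.ne_zero hy
  have hg0 : algebraMap (𝓞 K) K g ≠ 0 := by simpa using hg
  refine ⟨⟨g * x, hO x⟩, ⟨g * y, hO y⟩, ?_⟩
  change _ = algebraMap (𝓞 K) K (g * x) / algebraMap (𝓞 K) K (g * y)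
  rw [map_mul, map_mul, mul_div_mul_left _ _ hg0]

theorem isPrimeTo_of_coprime_card {R : Type*} [CommRing R] {g : ℕ} {I : Ideal R}
    (h : Nat.Coprime (Nat.card (R ⧸ I)) g) : IsPrimeTo g I := by
  have hmem : ((Nat.card (R ⧸ I) : ℕ) : R) ∈ I := by
    rw [← Ideal.Quotient.eq_zero_iff_mem, map_natCast, ← nsmul_one, card_nsmul_eq_zero']
  obtain ⟨x, y, hxy⟩ := Nat.isCoprime_iff_coprime.2 h
  refine isPrimeTo_iff.2 ⟨_, I.mul_mem_left (x : R) hmem, (y : R), ?_⟩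
  have := congrArg (Int.cast : ℤ → R) hxy
  push_cast at this
  linear_combination this

theorem coprime_card_quotient (O : Subalgebra ℤ (𝓞 K)) {g : ℕ} {I : Ideal O} (hI0 : I ≠ ⊥)
    (hI : IsPrimeTo g I) : Nat.Coprime (Nat.card (O ⧸ I)) g := by
  have := finite_quotient_order O hI0
  rw [Nat.coprime_iff_gcd_eq_one]
  by_contra hne
  obtain ⟨p, hp, hpd⟩ := Nat.exists_prime_and_dvd hne
  have := Fact.mk hp
  obtain ⟨x, hx⟩ := exists_prime_addOrderOf_dvd_card' (G := O ⧸ I) p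
    (hpd.trans (Nat.gcd_dvd_left _ _))
  obtain ⟨c, hc⟩ := hpd.trans (Nat.gcd_dvd_right _ _)
  obtain ⟨a, ha, b, hab⟩ := isPrimeTo_iff.1 hI
  have hgx : (g : O ⧸ I) * x = 0 := by
    rw [← nsmul_eq_mul, hc, mul_comm, mul_smul, ← hx, addOrderOf_nsmul_eq_zero, smul_zero]
  have h1 : (g : O ⧸ I) * Ideal.Quotient.mk I b = 1 := by
    have := congrArg (Ideal.Quotient.mk I) hab
    rwa [map_add, Ideal.Quotient.eq_zero_iff_mem.2 ha, zero_add, map_mul, map_natCast,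
      map_one] at this
  have hx0 : x = 0 := by
    calc x = ((g : O ⧸ I) * Ideal.Quotient.mk I b) * x := by rw [h1, one_mul]
      _ = Ideal.Quotient.mk I b * ((g : O ⧸ I) * x) := by ring
      _ = 0 := by rw [hgx, mul_zero]
  rw [hx0, addOrderOf_zero] at hx
  exact hp.one_lt.ne hx

theorem isPrimeTo_top {R : Type*} [CommRing R] {g : ℕ} : IsPrimeTo g (⊤ : Ideal R) := by
  rw [← Ideal.one_eq_top]; exact isCoprime_one_left

theorem exists_mul_eq_of_mem_idealsPrimeTo {O : Subalgebra ℤ (𝓞 K)} {g : ℕ}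
    {I : (FractionalIdeal (O)⁰ K)ˣ} (hI : I ∈ idealsPrimeTo O g) :
    ∃ A B : Ideal O, B ≠ ⊥ ∧ A ≠ ⊥ ∧ IsPrimeTo g A ∧ IsPrimeTo g B ∧
      (I : FractionalIdeal (O)⁰ K) * (B : FractionalIdeal (O)⁰ K) = A := by
  induction hI using Subgroup.closure_induction with
  | mem I hI =>
    obtain ⟨A, hA, hcard⟩ := hI
    refine ⟨A, ⊤, top_ne_bot, ?_, isPrimeTo_of_coprime_card hcard, ?_, ?_⟩
    · rintro rfl
      exact I.ne_zero (by rw [hA, FractionalIdeal.coeIdeal_bot])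
    · exact isPrimeTo_top
    · rw [hA, FractionalIdeal.coeIdeal_top, mul_one]
  | one => exact ⟨⊤, ⊤, top_ne_bot, top_ne_bot, isPrimeTo_top, isPrimeTo_top, by simp⟩
  | mul I J _ _ hI hJ =>
    obtain ⟨A, B, hB0, hA0, hA, hB, h⟩ := hI
    obtain ⟨A', B', hB0', hA0', hA', hB', h'⟩ := hJ
    refine ⟨A * A', B * B', mul_ne_zero hB0 hB0', mul_ne_zero hA0 hA0', hA.mul hA', hB.mul hB', ?_⟩
    rw [FractionalIdeal.coeIdeal_mul, FractionalIdeal.coeIdeal_mul, ← h, ← h', Units.val_mul,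
      mul_mul_mul_comm]
  | inv I _ hI =>
    obtain ⟨A, B, hB0, hA0, hA, hB, h⟩ := hI
    exact ⟨B, A, hA0, hB0, hB, hA, by rw [← h, Units.inv_mul_cancel_left]⟩

theorem mem_orderUnits_of_mem_idealsPrimeTo {O : Subalgebra ℤ (𝓞 K)} {g : ℕ}
    {I : (FractionalIdeal (O)⁰ K)ˣ} (hI : I ∈ idealsPrimeTo O g) {α : Kˣ}
    (hα : ((I : FractionalIdeal (O)⁰ K) : Submodule O K) = Submodule.span O {(α : K)}) :
    α ∈ orderUnits O g := by
  obtain ⟨A, B, hB0, hA0, hA, hB, h⟩ := exists_mul_eq_of_mem_idealsPrimeTo hI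
  have h' := congrArg (fun I : FractionalIdeal (O)⁰ K => (I : Submodule O K)) h
  simp only [FractionalIdeal.coe_mul, hα] at h'
  have hcoe : ∀ (C : Ideal O) (z : K), z ∈ ((C : FractionalIdeal (O)⁰ K) : Submodule O K) ↔
      ∃ c ∈ C, algebraMap (𝓞 K) K c = z := fun C z => by
    rw [FractionalIdeal.coe_coeIdeal, IsLocalization.mem_coeSubmodule]; rfl
  refine mem_orderUnits_of_mul_ideal hB0 hB hA ?_ ?_
  · intro i hi
    have : (α : K) * algebraMap (𝓞 K) K i ∈ ((A : FractionalIdeal (O)⁰ K) : Submodule O K) := by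
      rw [← h']
      exact Submodule.mul_mem_mul (Submodule.mem_span_singleton_self _) ((hcoe _ _).2 ⟨i, hi, rfl⟩)
    obtain ⟨j, hj, hj'⟩ := (hcoe _ _).1 this
    exact ⟨j, hj, hj'.symm⟩
  · intro j hj
    have : algebraMap (𝓞 K) K j ∈ ((A : FractionalIdeal (O)⁰ K) : Submodule O K) :=
      (hcoe _ _).2 ⟨j, hj, rfl⟩
    rw [← h'] at this
    obtain ⟨z, hz, hz'⟩ := Submodule.mem_span_singleton_mul.1 this
    obtain ⟨i, hi, rfl⟩ := (hcoe _ _).1 hz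
    exact ⟨i, hi, hz'⟩

theorem exists_mem_idealsPrimeTo {O : Subalgebra ℤ (𝓞 K)} {g : ℕ} (hg : g ≠ 0)
    (hO : ∀ t : 𝓞 K, (g : 𝓞 K) * t ∈ O) {α : Kˣ} (hα : α ∈ orderUnits O g) :
    ∃ I ∈ idealsPrimeTo O g,
      ((I : FractionalIdeal (O)⁰ K) : Submodule O K) = Submodule.span O {(α : K)} := by
  have := isFractionRing_order hg hO
  obtain ⟨a, ha, b, hb, ha0, hb0, hag, hbg, hab⟩ := hα
  have key : ∀ (c : 𝓞 K) (hc0 : c ≠ 0), c ∈ O → IsCoprime c (g : 𝓞 K) →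
      toPrincipalIdeal O K (fieldUnit c hc0) ∈ idealsPrimeTo O g := by
    intro c hc0 hc hcg
    refine Subgroup.subset_closure ⟨Ideal.span {(⟨c, hc⟩ : O)}, ?_, ?_⟩
    · rw [coe_toPrincipalIdeal, FractionalIdeal.coeIdeal_span_singleton]; rfl
    · refine coprime_card_quotient O ?_ ?_
      · rw [Ne, Ideal.span_singleton_eq_bot]; exact fun h => hc0 (congrArg O.val h)
      · exact isPrimeTo_span_iff.2 ((isCoprime_coe_iff hg hO (a := ⟨c, hc⟩)).1 hcg)
  have hα' : α = fieldUnit a ha0 * (fieldUnit b hb0)⁻¹ := by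
    rw [eq_mul_inv_iff_mul_eq]; exact Units.ext hab
  refine ⟨toPrincipalIdeal O K α, ?_, ?_⟩
  · rw [hα', map_mul, map_inv]
    exact mul_mem (key a ha0 ha hag) (inv_mem (key b hb0 hb hbg))
  · rw [coe_toPrincipalIdeal, FractionalIdeal.coe_spanSingleton]

theorem divMemImagePsi_iff {O : Subalgebra ℤ (𝓞 K)} {g : ℕ} (hg : g ≠ 0)
    (hO : ∀ t : 𝓞 K, (g : 𝓞 K) * t ∈ O) (n : ℕ) (d : Kˣ) :
    DivMemImagePsi O g n (d : K) ↔ ∃ α ∈ orderUnits O g, ∃ β : Kˣ,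
      toPrincipalIdeal (𝓞 K) K d =
        toPrincipalIdeal (𝓞 K) K α * toPrincipalIdeal (𝓞 K) K β ^ n := by
  have hspan : ∀ α β : Kˣ, (toPrincipalIdeal (𝓞 K) K d =
        toPrincipalIdeal (𝓞 K) K α * toPrincipalIdeal (𝓞 K) K β ^ n ↔
      Submodule.span (𝓞 K) {(d : K)} =
        Submodule.span (𝓞 K) {(α : K)} * Submodule.span (𝓞 K) {(β : K)} ^ n) := by
    intro α β
    rw [Units.ext_iff, ← FractionalIdeal.coeToSubmodule_inj]
    simp only [Units.val_mul, Units.val_pow_eq_pow_val, coe_toPrincipalIdeal,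
      FractionalIdeal.coe_mul, FractionalIdeal.coe_pow, FractionalIdeal.coe_spanSingleton]
  constructor
  · rintro ⟨I, ⟨hI, α, hα⟩, β, h⟩
    refine ⟨α, mem_orderUnits_of_mem_idealsPrimeTo hI hα, β, (hspan α β).2 ?_⟩
    have h1 : ((I : FractionalIdeal (O)⁰ K) : Set K) = (Submodule.span O {(α : K)} : Set K) := by
      rw [← hα]; rfl
    rwa [h1, Submodule.span_span_of_tower] at h
  · rintro ⟨α, hα, β, h⟩
    obtain ⟨I, hI, hα'⟩ := exists_mem_idealsPrimeTo hg hO hα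
    refine ⟨I, ⟨hI, α, hα'⟩, β, ?_⟩
    have h1 : ((I : FractionalIdeal (O)⁰ K) : Set K) = (Submodule.span O {(α : K)} : Set K) := by
      rw [← hα']; rfl
    rw [h1, Submodule.span_span_of_tower]
    exact (hspan α β).1 h

/-! ### Exponents of primes in fractional ideals -/

/-- The exponent of the prime `v` in an invertible fractional ideal. -/
def ord (v : HeightOneSpectrum (𝓞 K)) (I : (FractionalIdeal (𝓞 K)⁰ K)ˣ) : ℤ :=
  FractionalIdeal.count K v I

theorem ord_mul (v : HeightOneSpectrum (𝓞 K)) (I J : (FractionalIdeal (𝓞 K)⁰ K)ˣ) :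
    ord v (I * J) = ord v I + ord v J := by
  rw [ord, Units.val_mul, FractionalIdeal.count_mul K v I.ne_zero J.ne_zero]; rfl

theorem ord_one (v : HeightOneSpectrum (𝓞 K)) :
    ord v (1 : (FractionalIdeal (𝓞 K)⁰ K)ˣ) = 0 := by
  rw [ord, Units.val_one, FractionalIdeal.count_one]

theorem ord_pow (v : HeightOneSpectrum (𝓞 K)) (I : (FractionalIdeal (𝓞 K)⁰ K)ˣ) (n : ℕ) :
    ord v (I ^ n) = n * ord v I := by
  rw [ord, Units.val_pow_eq_pow_val, FractionalIdeal.count_pow]; rfl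

theorem ord_inv (v : HeightOneSpectrum (𝓞 K)) (I : (FractionalIdeal (𝓞 K)⁰ K)ˣ) :
    ord v I⁻¹ = - ord v I := by
  rw [eq_neg_iff_add_eq_zero, ← ord_mul, inv_mul_cancel, ord_one]

theorem ord_toPrincipalIdeal (v : HeightOneSpectrum (𝓞 K)) (x : Kˣ) :
    ord v (toPrincipalIdeal (𝓞 K) K x) = val v (x : K) := by
  rw [ord, coe_toPrincipalIdeal]; rfl

theorem ext_ord {I J : (FractionalIdeal (𝓞 K)⁰ K)ˣ} (h : ∀ v, ord v I = ord v J) : I = J := by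
  ext1
  rw [← FractionalIdeal.finprod_heightOneSpectrum_factorization' K I.ne_zero,
    ← FractionalIdeal.finprod_heightOneSpectrum_factorization' K J.ne_zero]
  exact finprod_congr fun v => congrArg _ (h v)

/-- The exponent of the prime `v` in the nonzero ideal `A` of `𝓞 K`. -/
def iord (v : HeightOneSpectrum (𝓞 K)) (A : Ideal (𝓞 K)) : ℤ :=
  FractionalIdeal.count K v (A : FractionalIdeal (𝓞 K)⁰ K)

theorem ord_mk0 (v : HeightOneSpectrum (𝓞 K)) (A : (Ideal (𝓞 K))⁰) :
    ord v (FractionalIdeal.mk0 K A) = iord v (A : Ideal (𝓞 K)) := by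
  rw [ord, FractionalIdeal.coe_mk0]; rfl

theorem iord_nonneg (v : HeightOneSpectrum (𝓞 K)) (A : Ideal (𝓞 K)) : 0 ≤ iord v A :=
  FractionalIdeal.count_coe_nonneg K v A

theorem iord_mul (v : HeightOneSpectrum (𝓞 K)) {A B : Ideal (𝓞 K)} (hA : A ≠ ⊥) (hB : B ≠ ⊥) :
    iord v (A * B) = iord v A + iord v B := by
  rw [iord, FractionalIdeal.coeIdeal_mul, FractionalIdeal.count_mul K v
    (FractionalIdeal.coeIdeal_ne_zero.2 hA) (FractionalIdeal.coeIdeal_ne_zero.2 hB)]; rfl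

theorem iord_pow (v : HeightOneSpectrum (𝓞 K)) (A : Ideal (𝓞 K)) (n : ℕ) :
    iord v (A ^ n) = n * iord v A := by
  rw [iord, FractionalIdeal.coeIdeal_pow, FractionalIdeal.count_pow]; rfl

theorem le_iord_iff (v : HeightOneSpectrum (𝓞 K)) {A : Ideal (𝓞 K)} (hA : A ≠ ⊥) (k : ℕ) :
    (k : ℤ) ≤ iord v A ↔ v.asIdeal ^ k ∣ A := by
  classical
  rw [iord, FractionalIdeal.count_coe K v hA, Nat.cast_le, ← Associates.prime_pow_dvd_iff_le
    (Associates.mk_ne_zero.2 hA) v.associates_irreducible, ← Associates.mk_pow,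
    Associates.mk_le_mk_iff_dvd]

theorem iord_pos_iff (v : HeightOneSpectrum (𝓞 K)) {A : Ideal (𝓞 K)} (hA : A ≠ ⊥) :
    0 < iord v A ↔ v.asIdeal ∣ A := by
  have := le_iord_iff v hA 1
  rw [pow_one] at this
  rw [← this]; exact Iff.rfl

theorem iord_eq_zero_iff (v : HeightOneSpectrum (𝓞 K)) {A : Ideal (𝓞 K)} (hA : A ≠ ⊥) :
    iord v A = 0 ↔ ¬ v.asIdeal ∣ A := by
  rw [← iord_pos_iff v hA]
  have := iord_nonneg v A
  omega

theorem iord_asIdeal (v w : HeightOneSpectrum (𝓞 K)) [Decidable (w = v)] :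
    iord v w.asIdeal = if w = v then 1 else 0 :=
  FractionalIdeal.count_maximal K v w

theorem iord_span (v : HeightOneSpectrum (𝓞 K)) (γ : 𝓞 K) :
    iord v (Ideal.span {γ}) = val v (algebraMap (𝓞 K) K γ) := by
  rw [iord, FractionalIdeal.coeIdeal_span_singleton]; rfl

theorem ext_iord {A B : Ideal (𝓞 K)} (hA : A ≠ ⊥) (hB : B ≠ ⊥) (h : ∀ v, iord v A = iord v B) :
    A = B := by
  have : FractionalIdeal.mk0 K ⟨A, mem_nonZeroDivisors_of_ne_zero hA⟩ =
      FractionalIdeal.mk0 K ⟨B, mem_nonZeroDivisors_of_ne_zero hB⟩ :=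
    ext_ord fun v => by rw [ord_mk0, ord_mk0]; exact h v
  have := congrArg Units.val this
  rw [FractionalIdeal.coe_mk0, FractionalIdeal.coe_mk0] at this
  exact FractionalIdeal.coeIdeal_injective this

theorem finite_iord_ne_zero {A : Ideal (𝓞 K)} (hA : A ≠ ⊥) : {v | iord v A ≠ 0}.Finite := by
  refine (Ideal.finite_factors hA).subset fun v hv => ?_
  by_contra h
  exact hv ((iord_eq_zero_iff v hA).2 h)

/-- The existence part of the factorization of ideals: any finitely supported family of exponents
is realized. -/
theorem exists_iord_eq (e : HeightOneSpectrum (𝓞 K) → ℕ) (he : {v | e v ≠ 0}.Finite) :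
    ∃ A : Ideal (𝓞 K), A ≠ ⊥ ∧ ∀ v, iord v A = e v := by
  classical
  refine ⟨∏ v ∈ he.toFinset, v.asIdeal ^ e v, ?_, fun w => ?_⟩
  · exact Finset.prod_ne_zero_iff.2 fun v _ => pow_ne_zero _ v.ne_bot
  · have hprod : ((∏ v ∈ he.toFinset, v.asIdeal ^ e v : Ideal (𝓞 K)) : FractionalIdeal (𝓞 K)⁰ K) =
        ∏ v ∈ he.toFinset, ((v.asIdeal ^ e v : Ideal (𝓞 K)) : FractionalIdeal (𝓞 K)⁰ K) :=
      map_prod (FractionalIdeal.coeIdealHom (𝓞 K)⁰ K) _ _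
    rw [iord, hprod, FractionalIdeal.count_prod]
    · simp_rw [FractionalIdeal.coeIdeal_pow, FractionalIdeal.count_pow,
        FractionalIdeal.count_maximal, mul_ite, mul_one, mul_zero]
      rw [Finset.sum_ite_eq']
      simp only [Set.Finite.mem_toFinset, Set.mem_ofPred_eq]
      split_ifs with h
      · rfl
      · rw [not_ne_iff.1 h, Nat.cast_zero]
    · intro v _
      exact FractionalIdeal.coeIdeal_ne_zero.2 (pow_ne_zero _ v.ne_bot)

theorem exists_eq_pow_of_dvd_iord {n : ℕ} (hn : n ≠ 0) {A : Ideal (𝓞 K)} (hA : A ≠ ⊥)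
    (h : ∀ v, (n : ℤ) ∣ iord v A) : ∃ B : Ideal (𝓞 K), B ≠ ⊥ ∧ A = B ^ n := by
  have h' : ∀ v, ∃ e : ℕ, iord v A = n * e := fun v => by
    obtain ⟨c, hc⟩ := h v
    have h0 := iord_nonneg v A
    refine ⟨c.toNat, ?_⟩
    rw [Int.toNat_of_nonneg, hc]
    rw [hc] at h0
    exact nonneg_of_mul_nonneg_right h0 (by positivity)
  choose e he using h'
  obtain ⟨B, hB, hBe⟩ := exists_iord_eq e ((finite_iord_ne_zero hA).subset fun v hv => by
    have hv' : e v ≠ 0 := hv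
    change iord v A ≠ 0
    rw [he]; positivity)
  exact ⟨B, hB, ext_iord hA (pow_ne_zero n hB) fun v => by rw [iord_pow, hBe, he]⟩

theorem exists_pow_eq_of_dvd_ord {g n : ℕ} (hn : n ≠ 0) {I : (FractionalIdeal (𝓞 K)⁰ K)ˣ}
    (hI : I ∈ primeToGroup K g) (h : ∀ v, (n : ℤ) ∣ ord v I) : ∃ L ∈ primeToGroup K g, L ^ n = I := by
  obtain ⟨A, B, hA, hB, hAB⟩ := hI
  obtain ⟨m, rfl⟩ := Nat.exists_eq_succ_of_ne_zero hn
  have h1 : FractionalIdeal.mk0 K (A * B ^ m) = I * FractionalIdeal.mk0 K B ^ (m + 1) := by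
    rw [map_mul, map_pow, ← hAB, pow_succ']; ac_rfl
  obtain ⟨N, hN0, hN⟩ := exists_eq_pow_of_dvd_iord hn (A := (A : Ideal (𝓞 K)) * (B : Ideal (𝓞 K)) ^ m)
    (nonZeroDivisors.coe_ne_zero (A * B ^ m)) fun v => by
      have := ord_mk0 v (A * B ^ m)
      rw [h1, ord_mul, ord_pow] at this
      have h2 := dvd_add (h v) (dvd_mul_right ((m + 1 : ℕ) : ℤ) (ord v (FractionalIdeal.mk0 K B)))
      rw [this] at h2
      exact h2
  have hNg : IsPrimeTo g N := by
    have h3 : IsPrimeTo g (N ^ (m + 1)) := hN ▸ hA.mul (hB.pow m)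
    exact h3.of_dvd (dvd_pow_self N hn)
  have hN' : A * B ^ m = (⟨N, mem_nonZeroDivisors_of_ne_zero hN0⟩ : (Ideal (𝓞 K))⁰) ^ (m + 1) :=
    Subtype.ext hN
  refine ⟨FractionalIdeal.mk0 K ⟨N, mem_nonZeroDivisors_of_ne_zero hN0⟩ *
    (FractionalIdeal.mk0 K B)⁻¹, mul_mem (mk0_mem_primeToGroup hNg)
    (inv_mem (mk0_mem_primeToGroup hB)), ?_⟩
  rw [mul_pow, ← map_pow, ← hN', h1, inv_pow, mul_inv_cancel_right]

theorem val_mul (v : HeightOneSpectrum (𝓞 K)) (x y : Kˣ) :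
    val v ((x * y : Kˣ) : K) = val v (x : K) + val v (y : K) := by
  rw [← ord_toPrincipalIdeal, map_mul, ord_mul, ord_toPrincipalIdeal, ord_toPrincipalIdeal]

theorem val_integer (v : HeightOneSpectrum (𝓞 K)) {γ : 𝓞 K} (hγ : γ ≠ 0) :
    v.valuation K (algebraMap (𝓞 K) K γ) = WithZero.exp (-val v (algebraMap (𝓞 K) K γ)) := by
  classical
  have h0 : Ideal.span {γ} ≠ ⊥ := by rwa [Ne, Ideal.span_singleton_eq_bot]
  rw [HeightOneSpectrum.valuation_of_algebraMap, HeightOneSpectrum.intValuation_if_neg _ hγ,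
    ← iord_span, iord, FractionalIdeal.count_coe K v h0]

theorem valuation_eq_exp (v : HeightOneSpectrum (𝓞 K)) (x : Kˣ) :
    v.valuation K (x : K) = WithZero.exp (-val v (x : K)) := by
  obtain ⟨a, b, hb, hab⟩ := IsFractionRing.div_surjective (A := 𝓞 K) (x : K)
  have hb0 : b ≠ 0 := nonZeroDivisors.ne_zero hb
  have ha0 : a ≠ 0 := by
    rintro rfl; rw [map_zero, zero_div] at hab; exact x.ne_zero hab.symm
  have hx : x * fieldUnit b hb0 = fieldUnit a ha0 := Units.ext <| by
    rw [Units.val_mul, ← hab]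
    exact div_mul_cancel₀ _ (fieldUnit b hb0).ne_zero
  have h1 := val_mul v x (fieldUnit b hb0)
  rw [hx] at h1
  rw [← hab, map_div₀, val_integer v ha0, val_integer v hb0, hab, ← WithZero.exp_sub]
  congr 1
  change val v (algebraMap (𝓞 K) K a) = val v (x : K) + val v (algebraMap (𝓞 K) K b) at h1
  linarith

theorem valuation_eq_one_iff (v : HeightOneSpectrum (𝓞 K)) (x : Kˣ) :
    v.valuation K (x : K) = 1 ↔ val v (x : K) = 0 := by
  rw [valuation_eq_exp, ← WithZero.exp_zero, WithZero.exp_inj, neg_eq_zero]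

/-! ### Finite generation of the group of `S`-units -/

/-- The unit of `K` underlying a unit of the ring of `S`-integers. -/
def sUnitVal (S : Set (HeightOneSpectrum (𝓞 K))) : (S.integer K)ˣ →* Kˣ :=
  Units.map (S.integer K).val

theorem val_sUnit {S : Set (HeightOneSpectrum (𝓞 K))} (d : (S.integer K)ˣ)
    {v : HeightOneSpectrum (𝓞 K)} (hv : v ∉ S) : val v ((d : S.integer K) : K) = 0 := by
  have := ((S.unitEquivUnitsInteger K).symm d).2 v hv
  rw [valuation_eq_one_iff] at this
  exact this

theorem exists_unit_of_val_eq_zero (x : Kˣ) (h : ∀ v : HeightOneSpectrum (𝓞 K), val v (x : K) = 0) :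
    ∃ u : (𝓞 K)ˣ, algebraMap (𝓞 K) K u = x := by
  have h1 : ∀ y : Kˣ, (∀ v : HeightOneSpectrum (𝓞 K), val v (y : K) = 0) →
      ∃ a : 𝓞 K, algebraMap (𝓞 K) K a = y := fun y hy =>
    HeightOneSpectrum.mem_integers_of_valuation_le_one K (y : K) fun v =>
      ((valuation_eq_one_iff v y).2 (hy v)).le
  obtain ⟨a, ha⟩ := h1 x h
  obtain ⟨b, hb⟩ := h1 x⁻¹ fun v => by
    have := val_mul v x x⁻¹
    rw [h v, mul_inv_cancel, zero_add, ← ord_toPrincipalIdeal, map_one, ord_one] at this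
    exact this.symm
  refine ⟨⟨a, b, ?_, ?_⟩, ha⟩
  · apply FaithfulSMul.algebraMap_injective (𝓞 K) K
    rw [map_mul, ha, hb, map_one, Units.mul_inv]
  · apply FaithfulSMul.algebraMap_injective (𝓞 K) K
    rw [map_mul, ha, hb, map_one, Units.inv_mul]

/-- The exponents at the primes of `S` map the `S`-units to a free abelian group of finite rank, with
kernel the unit group of `𝓞 K`, which is finitely generated by Dirichlet's unit theorem. -/
theorem fg_sUnits {S : Set (HeightOneSpectrum (𝓞 K))} (hS : S.Finite) :
    Group.FG (S.integer K)ˣ := by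
  have := hS.to_subtype
  let f : Additive (S.integer K)ˣ →+ (S → ℤ) :=
    { toFun := fun d v => val v.1 ((d.toMul : S.integer K) : K)
      map_zero' := by
        funext v
        have := ord_toPrincipalIdeal v.1 (1 : Kˣ)
        rw [map_one, ord_one] at this
        exact this.symm
      map_add' := fun x y => funext fun v => val_mul v.1 (sUnitVal S x.toMul) (sUnitVal S y.toMul) }
  let e : Additive (𝓞 K)ˣ →+ Additive (S.integer K)ˣ :=
    MonoidHom.toAdditive (Units.map (algebraMap (𝓞 K) (S.integer K)).toMonoidHom)
  rw [GroupFG.iff_add_fg, ← Module.Finite.iff_addGroup_fg, Module.finite_def]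
  refine Submodule.fg_of_fg_map_of_fg_inf_ker f.toIntLinearMap (IsNoetherian.noetherian _) ?_
  rw [top_inf_eq]
  have hker : LinearMap.ker f.toIntLinearMap = LinearMap.range e.toIntLinearMap := by
    ext x
    simp only [LinearMap.mem_ker, LinearMap.mem_range, AddMonoidHom.coe_toIntLinearMap]
    constructor
    · intro hx
      obtain ⟨u, hu⟩ := exists_unit_of_val_eq_zero (sUnitVal S x.toMul) fun v => by
        by_cases hv : v ∈ S
        · exact congrFun hx ⟨v, hv⟩
        · exact val_sUnit _ hv
      exact ⟨Additive.ofMul u, Additive.toMul.injective (Units.ext (Subtype.ext hu))⟩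
    · rintro ⟨u, rfl⟩
      funext v
      change val v.1 (algebraMap (𝓞 K) K (u.toMul : 𝓞 K)) = 0
      rw [← iord_span, Ideal.span_singleton_eq_top.2 u.toMul.isUnit, iord,
        FractionalIdeal.coeIdeal_top, FractionalIdeal.count_one]
  rw [hker, LinearMap.range_eq_map]
  exact Module.Finite.fg_top.map e.toIntLinearMap

theorem finite_quotient_sUnits {S : Set (HeightOneSpectrum (𝓞 K))} (hS : S.Finite) {n : ℕ}
    (hn : n ≠ 0) :
    Finite ((S.integer K)ˣ ⧸ (powMonoidHom n : (S.integer K)ˣ →* (S.integer K)ˣ).range) := by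
  have := fg_sUnits hS
  have := Subgroup.finiteIndex_range_powMonoidHom_of_fg (S.integer K)ˣ hn
  exact Subgroup.finite_quotient_of_finiteIndex

/-! ### The quadratic field and its ring of integers -/

/-- `K` is the quadratic field generated by the square root `s` of `-B₀`, where `B₀` is squarefree,
and `σ` is its nontrivial automorphism. -/
structure IsQuadratic (B₀ : ℤ) (s : 𝓞 K) (σ : K ≃ₐ[ℚ] K) : Prop where
  squarefree : Squarefree B₀
  sq : s ^ 2 = -(B₀ : 𝓞 K)
  adjoin : IntermediateField.adjoin ℚ {(s : K)} = ⊤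
  ne_one : σ ≠ 1

/-- The automorphism of `𝓞 K` induced by the automorphism `σ` of `K`. -/
def conj (σ : K ≃ₐ[ℚ] K) : 𝓞 K ≃+* 𝓞 K := RingOfIntegers.mapRingEquiv σ

theorem coe_conj (σ : K ≃ₐ[ℚ] K) (x : 𝓞 K) : (conj σ x : K) = σ (x : K) := rfl

theorem coe_two : algebraMap (𝓞 K) K 2 = 2 := map_ofNat _ 2

theorem conj_two (σ : K ≃ₐ[ℚ] K) : conj σ 2 = 2 := map_ofNat _ 2

section

variable {B₀ : ℤ} {s : 𝓞 K} {σ : K ≃ₐ[ℚ] K}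

theorem IsQuadratic.coe_sq (h : IsQuadratic B₀ s σ) : (s : K) ^ 2 = -(B₀ : K) := by
  have := congrArg (algebraMap (𝓞 K) K) h.sq
  simpa using this

theorem IsQuadratic.exists_eq_add (h : IsQuadratic B₀ s σ) (x : K) :
    ∃ a b : ℚ, x = a + b * (s : K) := by
  have hx : x ∈ (IntermediateField.adjoin ℚ {(s : K)}).toSubalgebra := by
    rw [h.adjoin]; trivial
  rw [IntermediateField.adjoin_simple_toSubalgebra_of_isAlgebraic
    (Algebra.IsAlgebraic.isAlgebraic _)] at hx
  induction hx using Algebra.adjoin_induction with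
  | mem x hx => exact ⟨0, 1, by rw [Set.mem_singleton_iff.1 hx]; simp⟩
  | algebraMap r => exact ⟨r, 0, by simp⟩
  | add x y _ _ hx hy =>
    obtain ⟨a, b, rfl⟩ := hx
    obtain ⟨c, d, rfl⟩ := hy
    exact ⟨a + c, b + d, by push_cast; ring⟩
  | mul x y _ _ hx hy =>
    obtain ⟨a, b, rfl⟩ := hx
    obtain ⟨c, d, rfl⟩ := hy
    refine ⟨a * c - b * d * B₀, a * d + b * c, ?_⟩
    push_cast
    linear_combination (b * d : K) * h.coe_sq

theorem IsQuadratic.map_s (h : IsQuadratic B₀ s σ) : σ (s : K) = -(s : K) := by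
  have h1 : (σ (s : K) - s) * (σ (s : K) + s) = 0 := by
    have h2 : σ (s : K) ^ 2 = -(B₀ : K) := by rw [← map_pow, h.coe_sq]; simp
    linear_combination h2 - h.coe_sq
  rcases mul_eq_zero.1 h1 with h1 | h1
  · exfalso
    apply h.ne_one
    ext x
    obtain ⟨a, b, rfl⟩ := h.exists_eq_add x
    simp [sub_eq_zero.1 h1]
  · exact eq_neg_of_add_eq_zero_left h1

theorem IsQuadratic.map_add (h : IsQuadratic B₀ s σ) (a b : ℚ) :
    σ (a + b * (s : K)) = a - b * (s : K) := by
  simp [h.map_s]; ring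

theorem IsQuadratic.conj_s (h : IsQuadratic B₀ s σ) : conj σ s = -s :=
  RingOfIntegers.ext (by rw [coe_conj, h.map_s]; simp)

theorem IsQuadratic.conj_conj (h : IsQuadratic B₀ s σ) (x : 𝓞 K) : conj σ (conj σ x) = x := by
  refine RingOfIntegers.ext ?_
  rw [coe_conj, coe_conj]
  obtain ⟨a, b, hab⟩ := h.exists_eq_add (x : K)
  rw [hab, h.map_add]
  have := h.map_add a (-b)
  push_cast at this
  rw [neg_mul, ← sub_eq_add_neg] at this
  rw [this]; ring

theorem IsQuadratic.exists_int_of_conj_eq (h : IsQuadratic B₀ s σ) {x : 𝓞 K} (hx : conj σ x = x) :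
    ∃ m : ℤ, x = m := by
  obtain ⟨a, b, hab⟩ := h.exists_eq_add (x : K)
  have h1 : (σ (x : K)) = x := congrArg (algebraMap (𝓞 K) K) hx
  rw [hab, h.map_add] at h1
  have h2 : (b : K) * (s : K) = 0 := by linear_combination (-1 / 2) * h1
  rw [h2, add_zero] at hab
  have h3 : IsIntegral ℤ a := by
    have : IsIntegral ℤ (algebraMap ℚ K a) := by
      rw [eq_ratCast, ← hab]; exact RingOfIntegers.isIntegral_coe x
    exact (isIntegral_algebraMap_iff (algebraMap ℚ K).injective).1 this
  obtain ⟨m, hm⟩ := IsIntegrallyClosed.isIntegral_iff.1 h3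
  refine ⟨m, RingOfIntegers.ext ?_⟩
  rw [hab, ← hm]; simp

theorem IsQuadratic.exists_trace (h : IsQuadratic B₀ s σ) (x : 𝓞 K) :
    ∃ m : ℤ, x + conj σ x = m :=
  h.exists_int_of_conj_eq (by rw [_root_.map_add, h.conj_conj, add_comm])

theorem IsQuadratic.exists_norm (h : IsQuadratic B₀ s σ) (x : 𝓞 K) :
    ∃ m : ℤ, x * conj σ x = m :=
  h.exists_int_of_conj_eq (by rw [map_mul, h.conj_conj, mul_comm])

/-- Since `B₀` is squarefree, a rational number `q` with `q² B₀` integral is an integer. -/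
theorem exists_int_of_sq_mul {B₀ : ℤ} (hB : Squarefree B₀) {q : ℚ} {k : ℤ}
    (hq : q ^ 2 * B₀ = k) : ∃ m : ℤ, q = m := by
  have h1 : q.num ^ 2 * B₀ = k * (q.den : ℤ) ^ 2 := by
    have hd : (q.den : ℚ) ≠ 0 := by exact_mod_cast q.den_ne_zero
    have h2 : (q.num : ℚ) = q * q.den := (Rat.mul_den_eq_num q).symm
    have : (q.num : ℚ) ^ 2 * B₀ = k * (q.den : ℚ) ^ 2 := by rw [h2, ← hq]; ring
    exact_mod_cast this
  have hcop : IsCoprime ((q.den : ℤ) ^ 2) (q.num ^ 2) := by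
    apply IsCoprime.pow
    rw [Int.isCoprime_iff_nat_coprime]
    simpa using q.reduced.symm
  have hdvd : (q.den : ℤ) * q.den ∣ B₀ := by
    rw [← sq]
    exact hcop.dvd_of_dvd_mul_left ⟨k, by rw [h1]; ring⟩
  have := hB _ hdvd
  rw [Int.isUnit_iff] at this
  refine ⟨q.num, ?_⟩
  have hden : q.den = 1 := by omega
  conv_lhs => rw [← Rat.num_div_den q, hden]
  simp

theorem IsQuadratic.exists_two_mul (h : IsQuadratic B₀ s σ) (x : 𝓞 K) :
    ∃ m q N : ℤ, 2 * x = m + q * s ∧ m ^ 2 + B₀ * q ^ 2 = 4 * N := by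
  obtain ⟨m, hm⟩ := h.exists_trace x
  obtain ⟨N, hN⟩ := h.exists_norm x
  obtain ⟨k, hk⟩ := h.exists_int_of_conj_eq (x := (x - conj σ x) ^ 2) (by
    rw [map_pow, map_sub, h.conj_conj]; ring)
  obtain ⟨a, b, hab⟩ := h.exists_eq_add (x : K)
  have hconj : ((conj σ x : 𝓞 K) : K) = a - b * (s : K) := by rw [coe_conj, hab, h.map_add]
  have hk' : ((x : K) - (conj σ x : 𝓞 K)) ^ 2 = (k : K) := by
    have := congrArg (algebraMap (𝓞 K) K) hk
    simpa using this
  have hsq : (2 * b) ^ 2 * (B₀ : ℚ) = (-k : ℤ) := by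
    rw [hab, hconj] at hk'
    have : (((2 * b) ^ 2 * (B₀ : ℚ) : ℚ) : K) = (((-k : ℤ) : ℚ) : K) := by
      push_cast
      linear_combination (4 * b ^ 2 : K) * h.coe_sq - hk'
    exact_mod_cast this
  obtain ⟨q, hq⟩ := exists_int_of_sq_mul h.squarefree hsq
  have hqK : (2 * b : K) = q := by exact_mod_cast congrArg (Rat.cast : ℚ → K) hq
  have h2 : 2 * x = m + q * s := by
    refine RingOfIntegers.ext ?_
    have hm' : (x : K) + (conj σ x : 𝓞 K) = (m : K) := by
      have := congrArg (algebraMap (𝓞 K) K) hm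
      simpa using this
    have : (2 * x : K) = m + q * s := by
      rw [← hm', hconj, ← hqK, hab]; ring
    calc algebraMap (𝓞 K) K (2 * x) = 2 * algebraMap (𝓞 K) K x := by rw [map_mul, coe_two]
      _ = m + q * s := this
      _ = _ := by simp
  refine ⟨m, q, N, h2, ?_⟩
  have h3 : 2 * conj σ x = m - q * s := by
    have := congrArg (conj σ) h2
    simpa [h.conj_s, sub_eq_add_neg, conj_two] using this
  have : ((m ^ 2 + B₀ * q ^ 2 : ℤ) : 𝓞 K) = ((4 * N : ℤ) : 𝓞 K) := by
    push_cast
    rw [← hN, show (4 : 𝓞 K) * (x * conj σ x) = (2 * x) * (2 * conj σ x) by ring, h2, h3]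
    linear_combination (q : 𝓞 K) ^ 2 * h.sq
  exact_mod_cast this

theorem IsQuadratic.exists_omega (h : IsQuadratic B₀ s σ) (hB : B₀ ≡ 3 [ZMOD 4]) :
    ∃ ω : 𝓞 K, 2 * ω = 1 + s := by
  have hdiv : (4 : ℤ) ∣ 1 + B₀ := by
    rw [Int.ModEq] at hB; omega
  obtain ⟨c, hc⟩ := hdiv
  have hcK : (1 + B₀ : K) = 4 * c := by exact_mod_cast congrArg (Int.cast : ℤ → K) hc
  have hint : IsIntegral ℤ ((1 + (s : K)) / 2) := by
    refine ⟨Polynomial.X ^ 2 - Polynomial.X + Polynomial.C c, by monicity!, ?_⟩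
    rw [Polynomial.eval₂_add, Polynomial.eval₂_sub, Polynomial.eval₂_X_pow, Polynomial.eval₂_X,
      Polynomial.eval₂_C, eq_intCast]
    linear_combination (1 / 4 : K) * h.coe_sq - (1 / 4 : K) * hcK
  obtain ⟨ω, hω⟩ : ∃ ω : 𝓞 K, algebraMap (𝓞 K) K ω = (1 + (s : K)) / 2 := ⟨⟨_, hint⟩, rfl⟩
  refine ⟨ω, FaithfulSMul.algebraMap_injective (𝓞 K) K ?_⟩
  rw [map_mul, coe_two, _root_.map_add, map_one, hω, mul_div_cancel₀ _ two_ne_zero]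

/-! ### The order of the theorem and the suborder `ℤ[f √(-B₀)]` -/

/-- The order `ℤ[f √(-B₀)]`, which contains the elements `x + f √(-B₀) y`. -/
def rootOrder (s : 𝓞 K) (f : ℤ) : Subalgebra ℤ (𝓞 K) := Algebra.adjoin ℤ {(f : 𝓞 K) * s}

theorem int_mem (O : Subalgebra ℤ (𝓞 K)) (m : ℤ) : (m : 𝓞 K) ∈ O := by simp

theorem add_mem_rootOrder (s : 𝓞 K) (f a b : ℤ) : (a : 𝓞 K) + f * s * b ∈ rootOrder s f :=
  Subalgebra.add_mem _ (int_mem _ a)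
    (Subalgebra.mul_mem _ (Algebra.subset_adjoin rfl) (int_mem _ b))

theorem IsQuadratic.mem_rootOrder (h : IsQuadratic B₀ s σ) {f : ℤ} {x : 𝓞 K}
    (hx : x ∈ rootOrder s f) : ∃ a b : ℤ, x = a + f * s * b := by
  induction hx using Algebra.adjoin_induction with
  | mem x hx => exact ⟨0, 1, by rw [Set.mem_singleton_iff.1 hx]; simp⟩
  | algebraMap r => exact ⟨r, 0, by simp⟩
  | add x y _ _ hx hy =>
    obtain ⟨a, b, rfl⟩ := hx
    obtain ⟨c, d, rfl⟩ := hy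
    exact ⟨a + c, b + d, by push_cast; ring⟩
  | mul x y _ _ hx hy =>
    obtain ⟨a, b, rfl⟩ := hx
    obtain ⟨c, d, rfl⟩ := hy
    refine ⟨a * c - b * d * f ^ 2 * B₀, a * d + b * c, ?_⟩
    push_cast
    linear_combination (b * d * f ^ 2 : 𝓞 K) * h.sq

theorem four_dvd_not_squarefree {B₀ : ℤ} (hB : Squarefree B₀) : ¬ (4 : ℤ) ∣ B₀ := by
  intro hd
  have := hB 2 (by simpa using hd)
  rw [Int.isUnit_iff] at this
  omega

/-- If `B₀ ≢ 3 (mod 4)` then `𝓞 K = ℤ[√(-B₀)]`. -/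
theorem IsQuadratic.exists_eq_int (h : IsQuadratic B₀ s σ) (hB : ¬ B₀ ≡ 3 [ZMOD 4]) (x : 𝓞 K) :
    ∃ a b : ℤ, x = a + b * s := by
  obtain ⟨m, q, N, h1, h2⟩ := h.exists_two_mul x
  have h4 := four_dvd_not_squarefree h.squarefree
  have hmq : 2 ∣ m ∧ 2 ∣ q := by
    rw [Int.ModEq] at hB
    obtain ⟨c, hc⟩ : ∃ c, c = B₀ / 4 := ⟨_, rfl⟩
    have hB' : B₀ = 4 * c + 1 ∨ B₀ = 4 * c + 2 := by omega
    rcases Int.even_or_odd' m with ⟨m', rfl | rfl⟩ <;> rcases Int.even_or_odd' q with ⟨q', rfl | rfl⟩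
      <;> rcases hB' with rfl | rfl <;> ring_nf at h2 <;> omega
  obtain ⟨⟨a, rfl⟩, ⟨b, rfl⟩⟩ := hmq
  refine ⟨a, b, ?_⟩
  have : (2 : 𝓞 K) * x = 2 * (a + b * s) := by rw [h1]; push_cast; ring
  exact mul_left_cancel₀ two_ne_zero this

theorem IsQuadratic.exists_eq_omega (h : IsQuadratic B₀ s σ) (hB : B₀ ≡ 3 [ZMOD 4]) {ω : 𝓞 K}
    (hω : 2 * ω = 1 + s) (x : 𝓞 K) : ∃ a b : ℤ, x = a + b * ω := by
  obtain ⟨m, q, N, h1, h2⟩ := h.exists_two_mul x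
  have hmq : 2 ∣ m - q := by
    rw [Int.ModEq] at hB
    obtain ⟨c, hc⟩ : ∃ c, B₀ = 4 * c + 3 := ⟨B₀ / 4, by omega⟩
    have h3 : (2 : ℤ) ∣ (m - q) * (m + q) :=
      ⟨2 * N - 2 * c * q ^ 2 - 2 * q ^ 2, by rw [hc] at h2; linear_combination h2⟩
    rcases Int.prime_two.dvd_or_dvd h3 with h3 | h3 <;> omega
  obtain ⟨a, ha⟩ := hmq
  refine ⟨a, q, ?_⟩
  have ha' : (m : 𝓞 K) - q = 2 * a := by exact_mod_cast congrArg (Int.cast : ℤ → 𝓞 K) ha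
  have : (2 : 𝓞 K) * x = 2 * (a + q * ω) := by
    rw [h1]; linear_combination ha' - (q : 𝓞 K) * hω
  exact mul_left_cancel₀ two_ne_zero this

theorem natAbs_mul_mem {O : Subalgebra ℤ (𝓞 K)} {f : ℤ} {t : 𝓞 K} (h : (f : 𝓞 K) * t ∈ O) :
    (f.natAbs : 𝓞 K) * t ∈ O := by
  rcases Int.natAbs_eq f with hf | hf
  · rw [hf] at h; simpa using h
  · rw [hf] at h
    simpa using O.neg_mem h

/-- The conductor of `ℤ[f √(-B₀)]`. -/
def rootConductor (f B₀ : ℤ) : ℕ :=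
  open Classical in if B₀ ≡ 3 [ZMOD 4] then 2 * f.natAbs else f.natAbs

theorem IsQuadratic.conductor_mul_mem_rootOrder (h : IsQuadratic B₀ s σ) (f : ℤ) (t : 𝓞 K) :
    (rootConductor f B₀ : 𝓞 K) * t ∈ rootOrder s f := by
  rw [rootConductor]
  split_ifs with hB
  · obtain ⟨m, q, N, h1, h2⟩ := h.exists_two_mul t
    have : (f : 𝓞 K) * (2 * t) ∈ rootOrder s f := by
      have h3 := add_mem_rootOrder s f (f * m) q
      have h4 : (f : 𝓞 K) * (2 * t) = ((f * m : ℤ) : 𝓞 K) + f * s * q := by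
        rw [h1]; push_cast; ring
      rwa [h4]
    have h5 : ((2 * f.natAbs : ℕ) : 𝓞 K) * t = (f.natAbs : 𝓞 K) * (2 * t) := by push_cast; ring
    rw [h5]
    exact natAbs_mul_mem this
  · obtain ⟨a, b, rfl⟩ := h.exists_eq_int hB t
    apply natAbs_mul_mem
    have h4 : (f : 𝓞 K) * (a + b * s) = ((f * a : ℤ) : 𝓞 K) + f * s * b := by push_cast; ring
    rw [h4]
    exact add_mem_rootOrder s f _ _

theorem modEq_four_of_modEq_eight {B₀ : ℤ} (h : B₀ ≡ 7 [ZMOD 8]) : B₀ ≡ 3 [ZMOD 4] := by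
  rw [Int.ModEq] at *; omega

theorem quadOrder_of_modEq (s : 𝓞 K) (f C : ℤ) {B₀ : ℤ} (hB : B₀ ≡ 7 [ZMOD 8]) {ω : 𝓞 K}
    (hω : 2 * ω = 1 + s) : quadOrder s f B₀ C = Algebra.adjoin ℤ {(f : 𝓞 K) * ω} := by
  rw [quadOrder, if_pos (Or.inl hB)]
  congr 1
  ext t
  simp only [Set.mem_ofPred_eq, Set.mem_singleton_iff]
  rw [← hω]
  refine ⟨fun ht => mul_left_cancel₀ two_ne_zero (ht.trans (by ring)), fun ht => by rw [ht]; ring⟩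

theorem quadOrder_of_not_modEq (s : 𝓞 K) (f : ℤ) {B₀ C : ℤ} (hB : ¬ B₀ ≡ 7 [ZMOD 8])
    (hC : B₀ ≡ 3 [ZMOD 4] → Odd C) : quadOrder s f B₀ C = rootOrder s f := by
  rw [quadOrder, if_neg]
  · rfl
  · rintro (h | ⟨h1, h2⟩)
    · exact hB h
    · have : B₀ ≡ 3 [ZMOD 4] := by rw [Int.ModEq] at *; omega
      exact (Int.not_even_iff_odd.2 (hC this)) h2

theorem quadConductor_of_modEq (f C : ℤ) {B₀ : ℤ} (hB : B₀ ≡ 7 [ZMOD 8]) :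
    quadConductor f B₀ C = f.natAbs := by
  rw [quadConductor, if_neg]
  rintro ⟨h, -⟩
  rw [Int.ModEq] at *; omega

theorem quadConductor_of_not_modEq (f : ℤ) {B₀ C : ℤ} (hB : ¬ B₀ ≡ 7 [ZMOD 8])
    (hC : B₀ ≡ 3 [ZMOD 4] → Odd C) : quadConductor f B₀ C = rootConductor f B₀ := by
  rw [quadConductor, rootConductor]
  have : (B₀ ≡ 3 [ZMOD 8] ∧ Odd C) ↔ B₀ ≡ 3 [ZMOD 4] := by
    constructor
    · rintro ⟨h, -⟩; rw [Int.ModEq] at *; omega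
    · intro h
      refine ⟨?_, hC h⟩
      rw [Int.ModEq] at *; omega
  simp only [this]

theorem IsQuadratic.conductor_mul_mem_quadOrder (h : IsQuadratic B₀ s σ) (f : ℤ) {C : ℤ}
    (hC : B₀ ≡ 3 [ZMOD 4] → Odd C) (t : 𝓞 K) :
    (quadConductor f B₀ C : 𝓞 K) * t ∈ quadOrder s f B₀ C := by
  by_cases hB : B₀ ≡ 7 [ZMOD 8]
  · obtain ⟨ω, hω⟩ := h.exists_omega (modEq_four_of_modEq_eight hB)
    rw [quadConductor_of_modEq f C hB, quadOrder_of_modEq s f C hB hω]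
    obtain ⟨a, b, rfl⟩ := h.exists_eq_omega (modEq_four_of_modEq_eight hB) hω t
    apply natAbs_mul_mem
    have h4 : (f : 𝓞 K) * (a + b * ω) = ((f * a : ℤ) : 𝓞 K) + f * ω * b := by push_cast; ring
    rw [h4]
    exact Subalgebra.add_mem _ (int_mem _ _)
      (Subalgebra.mul_mem _ (Algebra.subset_adjoin rfl) (int_mem _ b))
  · rw [quadConductor_of_not_modEq f hB hC, quadOrder_of_not_modEq s f hB hC]
    exact h.conductor_mul_mem_rootOrder f t

theorem IsQuadratic.rootOrder_le (h : IsQuadratic B₀ s σ) (f : ℤ) {C : ℤ}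
    (hC : B₀ ≡ 3 [ZMOD 4] → Odd C) : rootOrder s f ≤ quadOrder s f B₀ C := by
  by_cases hB : B₀ ≡ 7 [ZMOD 8]
  · obtain ⟨ω, hω⟩ := h.exists_omega (modEq_four_of_modEq_eight hB)
    rw [quadOrder_of_modEq s f C hB hω, rootOrder, Algebra.adjoin_le_iff, Set.singleton_subset_iff]
    have : (f : 𝓞 K) * s = f * ω * (2 : ℤ) - (f : ℤ) := by
      push_cast; linear_combination (-f : 𝓞 K) * hω
    rw [this]
    exact Subalgebra.sub_mem _
      (Subalgebra.mul_mem _ (Algebra.subset_adjoin rfl) (int_mem _ 2)) (int_mem _ _)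
  · rw [quadOrder_of_not_modEq s f hB hC]

/-- If `B₀ ≡ 7 (mod 8)`, the order `ℤ[f √(-B₀)]` has index `2` in `quadOrder`, but it contains the
squares of all elements of `quadOrder` of odd norm. -/
theorem IsQuadratic.sq_mem_rootOrder (h : IsQuadratic B₀ s σ) (f : ℤ) {C : ℤ}
    (hC : B₀ ≡ 3 [ZMOD 4] → Odd C) {a : 𝓞 K} (ha : a ∈ quadOrder s f B₀ C)
    (hag : IsCoprime a (rootConductor f B₀ : 𝓞 K)) : a ^ 2 ∈ rootOrder s f := by
  by_cases hB : B₀ ≡ 7 [ZMOD 8]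
  · have hB4 := modEq_four_of_modEq_eight hB
    obtain ⟨ω, hω⟩ := h.exists_omega hB4
    obtain ⟨c, hc⟩ : ∃ c : ℤ, 1 + B₀ = 8 * c := by
      rw [Int.ModEq] at hB; exact ⟨(1 + B₀) / 8, by omega⟩
    have hcK : (1 : 𝓞 K) + B₀ = 8 * c := by exact_mod_cast congrArg (Int.cast : ℤ → 𝓞 K) hc
    have hω2 : ω ^ 2 = ω - 2 * c := by
      have : (4 : 𝓞 K) * ω ^ 2 = 4 * (ω - 2 * c) := by
        linear_combination (2 * ω + 1 + s - 2) * hω + h.sq - hcK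
      exact mul_left_cancel₀ (by norm_num : (4 : 𝓞 K) ≠ 0) this
    have hconj : conj σ ω = 1 - ω := by
      have : (2 : 𝓞 K) * conj σ ω = 2 * (1 - ω) := by
        have h1 := congrArg (conj σ) hω
        rw [map_mul, conj_two, _root_.map_add, map_one, h.conj_s] at h1
        linear_combination h1 + hω
      exact mul_left_cancel₀ two_ne_zero this
    have hrep : ∃ u v : ℤ, a = u + f * ω * v := by
      clear hag
      rw [quadOrder_of_modEq s f C hB hω] at ha
      induction ha using Algebra.adjoin_induction with
      | mem x hx => exact ⟨0, 1, by rw [Set.mem_singleton_iff.1 hx]; simp⟩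
      | algebraMap r => exact ⟨r, 0, by simp⟩
      | add x y _ _ hx hy =>
        obtain ⟨u, v, rfl⟩ := hx
        obtain ⟨u', v', rfl⟩ := hy
        exact ⟨u + u', v + v', by push_cast; ring⟩
      | mul x y _ _ hx hy =>
        obtain ⟨u, v, rfl⟩ := hx
        obtain ⟨u', v', rfl⟩ := hy
        refine ⟨u * u' - 2 * c * f ^ 2 * v * v', u * v' + u' * v + f * v * v', ?_⟩
        push_cast
        linear_combination (f ^ 2 * v * v' : 𝓞 K) * hω2
    obtain ⟨u, v, rfl⟩ := hrep
    have htwo : 2 * (f * ω) ∈ rootOrder s f := by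
      have h1 := add_mem_rootOrder s f f 1
      have : 2 * (f * ω) = (f : 𝓞 K) + f * s * (1 : ℤ) := by
        push_cast; linear_combination (f : 𝓞 K) * hω
      rwa [this]
    -- If `v f` were odd, then the norm `u (u + v f) + 2 c (v f)²` would be even.
    have hvf : (2 : ℤ) ∣ v * f := by
      by_contra hodd
      have hN : (2 : ℤ) ∣ u ^ 2 + u * (v * f) + 2 * c * (v * f) ^ 2 := by
        have h1 : (2 : ℤ) ∣ u * (u + v * f) := by
          rcases Int.even_or_odd' u with ⟨w, hw | hw⟩
          · exact Dvd.dvd.mul_right ⟨w, hw⟩ _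
          · exact Dvd.dvd.mul_left (by omega) _
        exact (dvd_add h1 ⟨c * (v * f) ^ 2, rfl⟩).trans (dvd_of_eq (by ring))
      obtain ⟨N, hN⟩ := hN
      have hN' : ((u : 𝓞 K) + f * ω * v) * conj σ (u + f * ω * v) = 2 * N := by
        have : ((u : 𝓞 K) ^ 2 + u * (v * f) + 2 * c * (v * f) ^ 2) = 2 * N := by
          exact_mod_cast congrArg (Int.cast : ℤ → 𝓞 K) hN
        rw [_root_.map_add, map_mul, map_mul, hconj, map_intCast, map_intCast, map_intCast]
        linear_combination this - (f ^ 2 * v ^ 2 : 𝓞 K) * hω2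
      have h2 : IsCoprime ((u : 𝓞 K) + f * ω * v) 2 := by
        rw [rootConductor, if_pos hB4] at hag
        push_cast at hag
        exact hag.of_mul_right_left
      have h3 : IsCoprime (conj σ (u + f * ω * v)) (2 : 𝓞 K) := by
        have := h2.map (conj σ).toRingHom
        change IsCoprime (conj σ (u + f * ω * v)) (conj σ 2) at this
        rwa [conj_two] at this
      have h4 := (h2.mul_left h3)
      rw [hN'] at h4
      have h5 : IsUnit ((2 : ℕ) : 𝓞 K) := by
        push_cast
        exact isCoprime_self.1 h4.of_mul_left_left
      rw [natCast_isUnit_iff] at h5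
      omega
    obtain ⟨w, hw⟩ := hvf
    have hw' : (v : 𝓞 K) * f = 2 * w := by exact_mod_cast congrArg (Int.cast : ℤ → 𝓞 K) hw
    have h6 : ((u : 𝓞 K) + f * ω * v) ^ 2 =
        ((u ^ 2 - 2 * c * (f * v) ^ 2 : ℤ) : 𝓞 K) + 2 * (f * ω) * ((u * v + w * v : ℤ) : 𝓞 K) := by
      push_cast
      linear_combination (f ^ 2 * v ^ 2 : 𝓞 K) * hω2 + (f * v * ω : 𝓞 K) * hw'
    rw [h6]
    exact Subalgebra.add_mem _ (int_mem _ _) (Subalgebra.mul_mem _ htwo (int_mem _ _))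
  · rw [quadOrder_of_not_modEq s f hB hC] at ha
    exact Subalgebra.pow_mem _ ha 2

end

/-! ### Conjugate ideals and the decomposition of primes -/

section

variable {B₀ : ℤ} {s : 𝓞 K} {σ : K ≃ₐ[ℚ] K}

theorem conjIdeal_mul (σ : K ≃ₐ[ℚ] K) (I J : Ideal (𝓞 K)) :
    conjIdeal σ (I * J) = conjIdeal σ I * conjIdeal σ J := Ideal.map_mul _ _ _

theorem conjIdeal_span (σ : K ≃ₐ[ℚ] K) (x : 𝓞 K) :
    conjIdeal σ (Ideal.span {x}) = Ideal.span {conj σ x} := by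
  rw [conjIdeal, Ideal.map_span, Set.image_singleton]; rfl

theorem mem_conjIdeal_of_mem (σ : K ≃ₐ[ℚ] K) {I : Ideal (𝓞 K)} {x : 𝓞 K} (hx : x ∈ I) :
    conj σ x ∈ conjIdeal σ I := Ideal.mem_map_of_mem _ hx

theorem IsQuadratic.conjIdeal_conjIdeal (h : IsQuadratic B₀ s σ) (I : Ideal (𝓞 K)) :
    conjIdeal σ (conjIdeal σ I) = I := by
  refine le_antisymm (Ideal.map_le_iff_le_comap.2 (Ideal.map_le_iff_le_comap.2 fun x hx => ?_))
    fun x hx => ?_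
  · change conj σ (conj σ x) ∈ I
    rwa [h.conj_conj]
  · rw [← h.conj_conj x]
    exact mem_conjIdeal_of_mem σ (mem_conjIdeal_of_mem σ hx)

theorem IsQuadratic.mem_conjIdeal (h : IsQuadratic B₀ s σ) {I : Ideal (𝓞 K)} {x : 𝓞 K} :
    x ∈ conjIdeal σ I ↔ conj σ x ∈ I := by
  constructor
  · intro hx
    have := mem_conjIdeal_of_mem σ hx
    rwa [h.conjIdeal_conjIdeal] at this
  · intro hx
    have := mem_conjIdeal_of_mem σ hx
    rwa [h.conj_conj] at this

theorem IsQuadratic.conjIdeal_ne_bot (h : IsQuadratic B₀ s σ) {I : Ideal (𝓞 K)} (hI : I ≠ ⊥) :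
    conjIdeal σ I ≠ ⊥ := by
  intro h0
  apply hI
  rw [← h.conjIdeal_conjIdeal I, h0]
  exact Ideal.map_bot

theorem conjIdeal_pow (σ : K ≃ₐ[ℚ] K) (I : Ideal (𝓞 K)) (n : ℕ) :
    conjIdeal σ (I ^ n) = conjIdeal σ I ^ n := Ideal.map_pow _ _ _

theorem conjIdeal_span_int (σ : K ≃ₐ[ℚ] K) (m : ℤ) :
    conjIdeal σ (Ideal.span {(m : 𝓞 K)}) = Ideal.span {(m : 𝓞 K)} := by
  rw [conjIdeal_span, map_intCast]

theorem conjIdeal_span_nat (σ : K ≃ₐ[ℚ] K) (m : ℕ) :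
    conjIdeal σ (Ideal.span {(m : 𝓞 K)}) = Ideal.span {(m : 𝓞 K)} := by
  rw [conjIdeal_span, map_natCast]

theorem conjIdeal_dvd (σ : K ≃ₐ[ℚ] K) {I J : Ideal (𝓞 K)} (hIJ : I ∣ J) :
    conjIdeal σ I ∣ conjIdeal σ J := by
  obtain ⟨c, rfl⟩ := hIJ
  exact ⟨conjIdeal σ c, conjIdeal_mul σ _ _⟩

/-- The conjugate of a prime of `𝓞 K`. -/
def conjPrime (σ : K ≃ₐ[ℚ] K) (v : HeightOneSpectrum (𝓞 K)) : HeightOneSpectrum (𝓞 K) where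
  asIdeal := conjIdeal σ v.asIdeal
  isPrime := Ideal.map_isPrime_of_equiv _
  ne_bot := by
    rw [conjIdeal, Ne, Ideal.map_eq_bot_iff_of_injective (RingEquiv.injective _)]
    exact v.ne_bot

theorem IsQuadratic.conjPrime_conjPrime (h : IsQuadratic B₀ s σ) (v : HeightOneSpectrum (𝓞 K)) :
    conjPrime σ (conjPrime σ v) = v :=
  HeightOneSpectrum.ext (h.conjIdeal_conjIdeal v.asIdeal)

theorem IsQuadratic.iord_conjPrime (h : IsQuadratic B₀ s σ) (v : HeightOneSpectrum (𝓞 K))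
    {A : Ideal (𝓞 K)} (hA : A ≠ ⊥) : iord (conjPrime σ v) A = iord v (conjIdeal σ A) := by
  have key : ∀ k : ℕ, (k : ℤ) ≤ iord (conjPrime σ v) A ↔ (k : ℤ) ≤ iord v (conjIdeal σ A) := by
    intro k
    rw [le_iord_iff _ hA, le_iord_iff _ (h.conjIdeal_ne_bot hA)]
    constructor
    · intro hd
      have := conjIdeal_dvd σ hd
      rwa [conjIdeal_pow, conjPrime, h.conjIdeal_conjIdeal] at this
    · intro hd
      have := conjIdeal_dvd σ hd
      rwa [conjIdeal_pow, h.conjIdeal_conjIdeal] at this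
  have h1 := iord_nonneg (conjPrime σ v) A
  have h2 := iord_nonneg v (conjIdeal σ A)
  have h3 := key (iord (conjPrime σ v) A).toNat
  have h4 := key (iord v (conjIdeal σ A)).toNat
  rw [Int.toNat_of_nonneg h1] at h3
  rw [Int.toNat_of_nonneg h2] at h4
  exact le_antisymm (h3.1 le_rfl) (h4.2 le_rfl)

theorem exists_prime_mem (v : HeightOneSpectrum (𝓞 K)) :
    ∃ p : ℕ, p.Prime ∧ (p : 𝓞 K) ∈ v.asIdeal := by
  have key : ∀ N : ℕ, N ≠ 0 → (N : 𝓞 K) ∈ v.asIdeal → ∃ p : ℕ, p.Prime ∧ (p : 𝓞 K) ∈ v.asIdeal := by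
    intro N
    induction N using Nat.strong_induction_on with
    | _ N ih =>
      intro hN hmem
      have hN1 : N ≠ 1 := by
        rintro rfl
        exact v.isPrime.ne_top ((Ideal.eq_top_iff_one _).2 (by simpa using hmem))
      obtain ⟨m, hm⟩ := Nat.minFac_dvd N
      have hp := Nat.minFac_prime hN1
      rw [hm, Nat.cast_mul] at hmem
      rcases v.isPrime.mem_or_mem hmem with h1 | h1
      · exact ⟨_, hp, h1⟩
      · have hm0 : m ≠ 0 := by rintro rfl; exact hN (by rw [hm, mul_zero])
        refine ih m ?_ hm0 h1
        conv_rhs => rw [hm]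
        exact lt_mul_of_one_lt_left (Nat.pos_of_ne_zero hm0) hp.one_lt
  refine key (Ideal.absNorm v.asIdeal) ?_ (Ideal.absNorm_mem _)
  rw [Ne, Ideal.absNorm_eq_zero_iff]
  exact v.ne_bot

theorem span_ne_bot {p : ℕ} (hp : p ≠ 0) : Ideal.span {(p : 𝓞 K)} ≠ ⊥ := by
  rw [Ne, Ideal.span_singleton_eq_bot]; exact_mod_cast hp

theorem span_int_ne_bot {m : ℤ} (hm : m ≠ 0) : Ideal.span {(m : 𝓞 K)} ≠ ⊥ := by
  rw [Ne, Ideal.span_singleton_eq_bot]; exact_mod_cast hm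

/-- The prime number below a prime of `𝓞 K` generates its intersection with `ℤ`. -/
theorem dvd_of_int_mem {v : HeightOneSpectrum (𝓞 K)} {p : ℕ} (hp : p.Prime)
    (hv : (p : 𝓞 K) ∈ v.asIdeal) {m : ℤ} (hm : (m : 𝓞 K) ∈ v.asIdeal) : (p : ℤ) ∣ m := by
  by_contra hd
  obtain ⟨a, b, hab⟩ := (Nat.prime_iff_prime_int.1 hp).coprime_iff_not_dvd.2 hd
  apply v.isPrime.ne_top
  rw [Ideal.eq_top_iff_one]
  have : (1 : 𝓞 K) = a * p + b * m := by exact_mod_cast (congrArg (Int.cast : ℤ → 𝓞 K) hab).symm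
  rw [this]
  exact Ideal.add_mem _ (Ideal.mul_mem_left _ _ hv) (Ideal.mul_mem_left _ _ hm)

theorem int_mem_iff {v : HeightOneSpectrum (𝓞 K)} {p : ℕ} (hp : p.Prime)
    (hv : (p : 𝓞 K) ∈ v.asIdeal) {m : ℤ} : (m : 𝓞 K) ∈ v.asIdeal ↔ (p : ℤ) ∣ m := by
  refine ⟨dvd_of_int_mem hp hv, ?_⟩
  rintro ⟨c, rfl⟩
  push_cast
  exact Ideal.mul_mem_right _ _ hv

theorem prime_unique {v : HeightOneSpectrum (𝓞 K)} {p q : ℕ} (hp : p.Prime) (hq : q.Prime)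
    (hpv : (p : 𝓞 K) ∈ v.asIdeal) (hqv : (q : 𝓞 K) ∈ v.asIdeal) : p = q := by
  have := dvd_of_int_mem hp hpv (m := q) (by simpa using hqv)
  exact (Nat.prime_dvd_prime_iff_eq hp hq).1 (by exact_mod_cast this)

theorem mem_iff_dvd_span {v : HeightOneSpectrum (𝓞 K)} {x : 𝓞 K} :
    x ∈ v.asIdeal ↔ v.asIdeal ∣ Ideal.span {x} := by
  rw [Ideal.dvd_span_singleton]

theorem eq_of_dvd {v w : HeightOneSpectrum (𝓞 K)} (h : v.asIdeal ∣ w.asIdeal) : v = w :=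
  HeightOneSpectrum.ext ((w.isMaximal.eq_of_le v.isPrime.ne_top (Ideal.dvd_iff_le.1 h)).symm)

/-- Two primes above the same prime number are equal or conjugate: a prime `v` contains the norms
of its elements, so it is covered by `w` and its conjugate. -/
theorem IsQuadratic.eq_or_eq_conjPrime (h : IsQuadratic B₀ s σ) {p : ℕ} (hp : p.Prime)
    {v w : HeightOneSpectrum (𝓞 K)} (hv : (p : 𝓞 K) ∈ v.asIdeal) (hw : (p : 𝓞 K) ∈ w.asIdeal) :
    w = v ∨ w = conjPrime σ v := by
  have hsub : (v.asIdeal : Set (𝓞 K)) ⊆ w.asIdeal ∪ (conjPrime σ w).asIdeal := by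
    intro x hx
    obtain ⟨m, hm⟩ := h.exists_norm x
    have hmv : (m : 𝓞 K) ∈ v.asIdeal := by rw [← hm]; exact Ideal.mul_mem_right _ _ hx
    have hmw : x * conj σ x ∈ w.asIdeal := by
      rw [hm]; exact (int_mem_iff hp hw).2 (dvd_of_int_mem hp hv hmv)
    rcases w.isPrime.mem_or_mem hmw with h1 | h1
    · exact Or.inl h1
    · exact Or.inr (h.mem_conjIdeal.2 h1)
  rcases Ideal.subset_union.1 hsub with h1 | h1
  · exact Or.inl (eq_of_dvd (Ideal.dvd_iff_le.2 h1))
  · right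
    rw [← eq_of_dvd (Ideal.dvd_iff_le.2 h1), h.conjPrime_conjPrime]

theorem IsQuadratic.finrank_le (h : IsQuadratic B₀ s σ) : Module.finrank ℚ K ≤ 2 := by
  classical
  have htop : Submodule.span ℚ (({1, (s : K)} : Finset K) : Set K) = ⊤ := by
    rw [eq_top_iff]
    intro x _
    obtain ⟨a, b, rfl⟩ := h.exists_eq_add x
    have h1 : (1 : K) ∈ Submodule.span ℚ (({1, (s : K)} : Finset K) : Set K) :=
      Submodule.subset_span (by simp)
    have h2 : (s : K) ∈ Submodule.span ℚ (({1, (s : K)} : Finset K) : Set K) :=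
      Submodule.subset_span (by simp)
    have := Submodule.add_mem _ (Submodule.smul_mem _ a h1) (Submodule.smul_mem _ b h2)
    simpa [Algebra.smul_def] using this
  have := finrank_span_finset_le_card (R := ℚ) ({1, (s : K)} : Finset K)
  rw [Set.finrank, htop, finrank_top] at this
  exact this.trans Finset.card_le_two

theorem absNorm_span_nat (p : ℕ) :
    Ideal.absNorm (Ideal.span {(p : 𝓞 K)}) = p ^ Module.finrank ℤ (𝓞 K) := by
  have := Algebra.norm_algebraMap_of_basis (Module.Free.chooseBasis ℤ (𝓞 K)) (p : ℤ)
  rw [← Module.finrank_eq_card_chooseBasisIndex] at this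
  rw [Ideal.absNorm_span_singleton, show (p : 𝓞 K) = algebraMap ℤ (𝓞 K) (p : ℤ) by simp, this,
    Int.natAbs_pow, Int.natAbs_natCast]

/-- The decomposition law: a prime number is inert, ramified or split. -/
theorem IsQuadratic.prime_cases (h : IsQuadratic B₀ s σ) {p : ℕ} (hp : p.Prime)
    {v : HeightOneSpectrum (𝓞 K)} (hv : (p : 𝓞 K) ∈ v.asIdeal) :
    Ideal.span {(p : 𝓞 K)} = v.asIdeal ∨ RamifiesAs p v ∨ SplitsAs σ p v (conjPrime σ v) := by
  have hp0 := span_ne_bot (K := K) hp.ne_zero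
  obtain ⟨I, hI⟩ := mem_iff_dvd_span.1 hv
  have hI0 : I ≠ ⊥ := by rintro rfl; rw [Ideal.mul_bot] at hI; exact hp0 hI
  by_cases htop : I = ⊤
  · left; rw [hI, htop, Ideal.mul_top]
  right
  obtain ⟨m, hm, hIm⟩ := Ideal.exists_le_maximal I htop
  have hm0 : m ≠ ⊥ := fun h0 => hI0 (le_bot_iff.1 (h0 ▸ hIm))
  obtain ⟨I', hI'⟩ := Ideal.dvd_iff_le.2 hIm
  have hI'0 : I' ≠ ⊥ := by rintro rfl; rw [Ideal.mul_bot] at hI'; exact hI0 hI'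
  set w : HeightOneSpectrum (𝓞 K) := ⟨m, hm.isPrime, hm0⟩ with hw
  have hnorm : p ^ Module.finrank ℤ (𝓞 K) =
      Ideal.absNorm v.asIdeal * (Ideal.absNorm m * Ideal.absNorm I') := by
    rw [← map_mul, ← map_mul, ← hI', ← hI, absNorm_span_nat]
  have hI'top : I' = ⊤ := by
    rw [← Ideal.absNorm_eq_one_iff]
    have hv1 : Ideal.absNorm v.asIdeal ≠ 1 := fun h1 =>
      v.isPrime.ne_top (Ideal.absNorm_eq_one_iff.1 h1)
    have hm1 : Ideal.absNorm m ≠ 1 := fun h1 => hm.ne_top (Ideal.absNorm_eq_one_iff.1 h1)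
    obtain ⟨i, -, hi⟩ := (Nat.dvd_prime_pow hp).1 (Dvd.intro _ hnorm.symm)
    obtain ⟨j, -, hj⟩ := (Nat.dvd_prime_pow hp).1
      ((Dvd.intro _ rfl).trans (Dvd.intro_left _ hnorm.symm))
    obtain ⟨k, -, hk⟩ := (Nat.dvd_prime_pow hp).1
      ((Dvd.intro_left _ rfl).trans (Dvd.intro_left _ hnorm.symm))
    rw [hi, hj, hk, ← pow_add, ← pow_add] at hnorm
    have h1 := Nat.pow_right_injective hp.two_le hnorm
    have h2 := h.finrank_le
    rw [← RingOfIntegers.rank K] at h2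
    have hi0 : i ≠ 0 := by rintro rfl; exact hv1 (by rw [hi, pow_zero])
    have hj0 : j ≠ 0 := by rintro rfl; exact hm1 (by rw [hj, pow_zero])
    have hk0 : k = 0 := by omega
    rw [hk, hk0, pow_zero]
  rw [hI'top, Ideal.mul_top] at hI'
  rw [hI'] at hI
  have hwp : (p : 𝓞 K) ∈ w.asIdeal := mem_iff_dvd_span.2 ⟨v.asIdeal, by rw [hI, mul_comm]⟩
  by_cases hwv : w = v
  · left
    refine ⟨hp, ?_⟩
    rw [hI, show m = v.asIdeal from congrArg HeightOneSpectrum.asIdeal hwv]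
    exact (pow_two _).symm
  · right
    rcases h.eq_or_eq_conjPrime hp hv hwp with h1 | h1
    · exact absurd h1 hwv
    · rw [← h1]
      refine ⟨hp, ?_, fun h2 => hwv h2.symm, hI⟩
      rw [h1]; rfl

end

section

variable {B₀ : ℤ} {s : 𝓞 K} {σ : K ≃ₐ[ℚ] K}

theorem SplitsAs.mem {p : ℕ} {v w : HeightOneSpectrum (𝓞 K)} (h : SplitsAs σ p v w) :
    (p : 𝓞 K) ∈ v.asIdeal := mem_iff_dvd_span.2 ⟨_, h.2.2.2⟩

theorem SplitsAs.eq_conjPrime {p : ℕ} {v w : HeightOneSpectrum (𝓞 K)} (h : SplitsAs σ p v w) :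
    w = conjPrime σ v := HeightOneSpectrum.ext h.2.1

theorem RamifiesAs.mem {p : ℕ} {v : HeightOneSpectrum (𝓞 K)} (h : RamifiesAs p v) :
    (p : 𝓞 K) ∈ v.asIdeal := mem_iff_dvd_span.2 ⟨v.asIdeal, h.2.trans (sq _)⟩

theorem iord_self (v : HeightOneSpectrum (𝓞 K)) : iord v v.asIdeal = 1 := by
  classical rw [iord_asIdeal, if_pos rfl]

theorem iord_of_ne {v w : HeightOneSpectrum (𝓞 K)} (h : w ≠ v) : iord v w.asIdeal = 0 := by
  classical rw [iord_asIdeal, if_neg h]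

theorem SplitsAs.iord_eq_one {p : ℕ} {v w : HeightOneSpectrum (𝓞 K)} (h : SplitsAs σ p v w) :
    iord v (Ideal.span {(p : 𝓞 K)}) = 1 := by
  rw [h.2.2.2, iord_mul v v.ne_bot w.ne_bot, iord_self, iord_of_ne h.2.2.1.symm, add_zero]

theorem RamifiesAs.iord_eq_two {p : ℕ} {v : HeightOneSpectrum (𝓞 K)} (h : RamifiesAs p v) :
    iord v (Ideal.span {(p : 𝓞 K)}) = 2 := by
  rw [h.2, iord_pow, iord_self]; norm_num

/-- The primes above split prime numbers are those that differ from their conjugates. -/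
theorem IsQuadratic.isSplitPrime_iff (h : IsQuadratic B₀ s σ) {v : HeightOneSpectrum (𝓞 K)} :
    IsSplitPrime σ v ↔ conjPrime σ v ≠ v := by
  constructor
  · rintro ⟨p, w, hs⟩
    rw [← hs.eq_conjPrime]
    exact hs.2.2.1.symm
  · intro hne
    obtain ⟨p, hp, hv⟩ := exists_prime_mem v
    rcases h.prime_cases hp hv with h1 | h1 | h1
    · exfalso
      apply hne
      refine HeightOneSpectrum.ext ?_
      change conjIdeal σ v.asIdeal = v.asIdeal
      rw [← h1, conjIdeal_span_nat]
    · exfalso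
      apply hne
      refine (eq_of_dvd ?_).symm
      refine (Prime.dvd_of_dvd_pow (v.prime) (n := 2) ?_)
      change v.asIdeal ∣ conjIdeal σ v.asIdeal ^ 2
      rw [← conjIdeal_pow, ← h1.2, conjIdeal_span_nat, h1.2]
      exact dvd_pow_self _ two_ne_zero
    · exact ⟨p, _, h1⟩

theorem IsQuadratic.isSplitPrime_conj (h : IsQuadratic B₀ s σ) {v : HeightOneSpectrum (𝓞 K)} :
    IsSplitPrime σ (conjPrime σ v) ↔ IsSplitPrime σ v := by
  rw [h.isSplitPrime_iff, h.isSplitPrime_iff, h.conjPrime_conjPrime, ne_comm]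

theorem IsQuadratic.int_mem_conjPrime (h : IsQuadratic B₀ s σ) {v : HeightOneSpectrum (𝓞 K)} {m : ℤ} :
    (m : 𝓞 K) ∈ (conjPrime σ v).asIdeal ↔ (m : 𝓞 K) ∈ v.asIdeal := by
  change (m : 𝓞 K) ∈ conjIdeal σ v.asIdeal ↔ _
  rw [h.mem_conjIdeal, map_intCast]

theorem IsQuadratic.iord_conjPrime_int (h : IsQuadratic B₀ s σ) (v : HeightOneSpectrum (𝓞 K)) {m : ℤ}
    (hm : m ≠ 0) : iord (conjPrime σ v) (Ideal.span {(m : 𝓞 K)}) = iord v (Ideal.span {(m : 𝓞 K)}) := by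
  rw [h.iord_conjPrime v (span_int_ne_bot hm), conjIdeal_span_int]

theorem IsRamifiedPrime.not_isSplitPrime {v : HeightOneSpectrum (𝓞 K)} (hr : IsRamifiedPrime v) :
    ¬ IsSplitPrime σ v := by
  rintro ⟨q, w, hs⟩
  obtain ⟨p, hp⟩ := hr
  have := prime_unique hp.1 hs.1 hp.mem hs.mem
  subst this
  have h1 := hs.iord_eq_one
  rw [hp.iord_eq_two] at h1
  norm_num at h1

theorem IsInert.span_eq {p : ℕ} (hp : IsInert K p) {v : HeightOneSpectrum (𝓞 K)}
    (hv : (p : 𝓞 K) ∈ v.asIdeal) : Ideal.span {(p : 𝓞 K)} = v.asIdeal := by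
  have hmax := hp.2.isMaximal (span_ne_bot hp.1.ne_zero)
  exact hmax.eq_of_le v.isPrime.ne_top ((Ideal.span_singleton_le_iff_mem _).2 hv)

theorem span_int_mul (a b : ℤ) : Ideal.span {((a * b : ℤ) : 𝓞 K)} =
    Ideal.span {(a : 𝓞 K)} * Ideal.span {(b : 𝓞 K)} := by
  rw [Ideal.span_singleton_mul_span_singleton]; push_cast; rfl

theorem iord_int_eq_zero {v : HeightOneSpectrum (𝓞 K)} {m : ℤ} (hm0 : m ≠ 0)
    (hm : (m : 𝓞 K) ∉ v.asIdeal) : iord v (Ideal.span {(m : 𝓞 K)}) = 0 := by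
  rw [iord_eq_zero_iff v (span_int_ne_bot hm0), ← mem_iff_dvd_span]; exact hm

theorem iord_int {v : HeightOneSpectrum (𝓞 K)} {p : ℕ} (hp : p.Prime) (hv : (p : 𝓞 K) ∈ v.asIdeal)
    {m : ℤ} (hm : m ≠ 0) : iord v (Ideal.span {(m : 𝓞 K)}) =
      padicValInt p m * iord v (Ideal.span {(p : 𝓞 K)}) := by
  have := Fact.mk hp
  have hfin : FiniteMultiplicity (p : ℤ) m := by
    rw [Int.finiteMultiplicity_iff]
    exact ⟨by simpa using hp.ne_one, hm⟩
  obtain ⟨c, hc, hcd⟩ := hfin.exists_eq_pow_mul_and_not_dvd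
  have he : multiplicity (p : ℤ) m = padicValInt p m := by
    rw [padicValInt.of_ne_one_ne_zero hp.ne_one hm]
  rw [he] at hc
  have hc0 : c ≠ 0 := by rintro rfl; exact hcd (dvd_zero _)
  have hpk : ((p : ℤ) ^ padicValInt p m) ≠ 0 := pow_ne_zero _ (by exact_mod_cast hp.ne_zero)
  conv_lhs => rw [hc]
  rw [span_int_mul, iord_mul v (span_int_ne_bot hpk) (span_int_ne_bot hc0),
    iord_int_eq_zero hc0 (fun h => hcd ((int_mem_iff hp hv).1 h)), add_zero]
  have : Ideal.span {(((p : ℤ) ^ padicValInt p m : ℤ) : 𝓞 K)} =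
      Ideal.span {(p : 𝓞 K)} ^ padicValInt p m := by
    rw [Ideal.span_singleton_pow]; push_cast; rfl
  rw [this, iord_pow]

theorem isCoprime_of_forall {A B : Ideal (𝓞 K)} (hA : A ≠ ⊥)
    (h : ∀ v : HeightOneSpectrum (𝓞 K), v.asIdeal ∣ A → ¬ v.asIdeal ∣ B) : IsCoprime A B := by
  rw [Ideal.isCoprime_iff_sup_eq]
  by_contra hne
  obtain ⟨m, hm, hle⟩ := Ideal.exists_le_maximal _ hne
  have hA' : A ≤ m := le_sup_left.trans hle
  have hB' : B ≤ m := le_sup_right.trans hle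
  have hm0 : m ≠ ⊥ := fun h0 => hA (le_bot_iff.1 (h0 ▸ hA'))
  exact h ⟨m, hm.isPrime, hm0⟩ (Ideal.dvd_iff_le.2 hA') (Ideal.dvd_iff_le.2 hB')

theorem not_dvd_of_isCoprime {A B : Ideal (𝓞 K)} (h : IsCoprime A B) (v : HeightOneSpectrum (𝓞 K))
    (hA : v.asIdeal ∣ A) : ¬ v.asIdeal ∣ B := by
  intro hB
  rw [Ideal.isCoprime_iff_sup_eq] at h
  exact v.isPrime.ne_top (top_le_iff.1 (h ▸ sup_le (Ideal.dvd_iff_le.1 hA) (Ideal.dvd_iff_le.1 hB)))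

theorem IsPrimeTo.not_mem {A : Ideal (𝓞 K)} {g : ℕ} (h : IsPrimeTo g A)
    {v : HeightOneSpectrum (𝓞 K)} (hv : v.asIdeal ∣ A) : (g : 𝓞 K) ∉ v.asIdeal :=
  fun hg => not_dvd_of_isCoprime h v hv (mem_iff_dvd_span.1 hg)

/-- The norm of an ideal: the product of an ideal with its conjugate is generated by an integer. -/
theorem IsQuadratic.exists_mul_conjIdeal (h : IsQuadratic B₀ s σ) (I : Ideal (𝓞 K)) :
    ∃ N : ℕ, I * conjIdeal σ I = Ideal.span {(N : 𝓞 K)} := by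
  induction I using UniqueFactorizationMonoid.induction_on_prime with
  | h₁ => exact ⟨0, by simp⟩
  | h₂ I hI =>
    refine ⟨1, ?_⟩
    rw [Ideal.isUnit_iff.1 hI, Ideal.top_mul, Nat.cast_one, Ideal.span_singleton_one]
    rw [← Ideal.span_singleton_one, conjIdeal_span, map_one]
  | h₃ I q hI hq ih =>
    obtain ⟨N, hN⟩ := ih
    have hqp := Ideal.isPrime_of_prime hq
    set v : HeightOneSpectrum (𝓞 K) := ⟨q, hqp, hq.ne_zero⟩
    obtain ⟨p, hp, hv⟩ := exists_prime_mem v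
    have key : ∃ m : ℕ, q * conjIdeal σ q = Ideal.span {(m : 𝓞 K)} := by
      rcases h.prime_cases hp hv with h1 | h1 | h1
      · refine ⟨p * p, ?_⟩
        change _ = q at h1
        rw [← h1, conjIdeal_span_nat, Ideal.span_singleton_mul_span_singleton]; push_cast; rfl
      · refine ⟨p, ?_⟩
        have h2 : conjPrime σ v = v := by
          by_contra hne
          exact IsRamifiedPrime.not_isSplitPrime ⟨p, h1⟩ (h.isSplitPrime_iff.2 hne)
        have h3 : conjIdeal σ q = q := congrArg HeightOneSpectrum.asIdeal h2
        rw [h3, h1.2]; exact (pow_two _).symm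
      · exact ⟨p, h1.2.2.2.symm⟩
    obtain ⟨m, hm⟩ := key
    refine ⟨m * N, ?_⟩
    rw [conjIdeal_mul, mul_mul_mul_comm, hN, hm, Ideal.span_singleton_mul_span_singleton]
    push_cast; rfl

/-- Ramified primes divide `2 B₀`: if `x ∈ v` is not divisible by `p`, where `v² = (p)`, then the trace
and the norm of `x` are divisible by `p`, hence so is its discriminant. -/
theorem IsQuadratic.ramified_mem (h : IsQuadratic B₀ s σ) {v : HeightOneSpectrum (𝓞 K)}
    (hv : IsRamifiedPrime v) : ((2 * B₀ : ℤ) : 𝓞 K) ∈ v.asIdeal := by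
  have hvc : conjPrime σ v = v := by
    by_contra hne
    exact hv.not_isSplitPrime (h.isSplitPrime_iff.2 hne)
  obtain ⟨p, hp⟩ := hv
  have hpr := Nat.prime_iff_prime_int.1 hp.1
  obtain ⟨x, hx, hx2⟩ : ∃ x ∈ v.asIdeal, x ∉ v.asIdeal ^ 2 := by
    by_contra! hle
    have := (le_iord_iff v v.ne_bot 2).2 (Ideal.dvd_iff_le.2 hle)
    rw [iord_self] at this
    norm_num at this
  have hcx : conj σ x ∈ v.asIdeal := by
    have := mem_conjIdeal_of_mem σ hx
    rwa [show conjIdeal σ v.asIdeal = v.asIdeal from congrArg HeightOneSpectrum.asIdeal hvc] at this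
  obtain ⟨m, q, N, h1, h2⟩ := h.exists_two_mul x
  have h3 : 2 * conj σ x = m - q * s := by
    have := congrArg (conj σ) h1
    simpa [h.conj_s, sub_eq_add_neg, conj_two] using this
  have hm : (m : 𝓞 K) = x + conj σ x :=
    mul_left_cancel₀ (two_ne_zero : (2 : 𝓞 K) ≠ 0) (by linear_combination -h1 - h3)
  have hpm : (p : ℤ) ∣ m := dvd_of_int_mem hp.1 hp.mem (by rw [hm]; exact Ideal.add_mem _ hx hcx)
  have hN : (N : 𝓞 K) = x * conj σ x := by
    have h4 : ((m : 𝓞 K) ^ 2 + B₀ * q ^ 2) = 4 * N := by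
      exact_mod_cast congrArg (Int.cast : ℤ → 𝓞 K) h2
    refine mul_left_cancel₀ (by norm_num : (4 : 𝓞 K) ≠ 0) ?_
    rw [← h4, show (4 : 𝓞 K) * (x * conj σ x) = (2 * x) * (2 * conj σ x) by ring, h1, h3]
    linear_combination (q : 𝓞 K) ^ 2 * h.sq
  have hpN : (p : ℤ) ∣ N := dvd_of_int_mem hp.1 hp.mem (by rw [hN]; exact Ideal.mul_mem_left _ _ hcx)
  rw [int_mem_iff hp.1 hp.mem]
  by_contra hd
  have hB : ¬ (p : ℤ) ∣ B₀ := fun hB => hd (dvd_mul_of_dvd_right hB _)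
  have h2' : ¬ (p : ℤ) ∣ 2 := fun hB => hd (dvd_mul_of_dvd_left hB _)
  have hq : (p : ℤ) ∣ q := by
    have h5 : (p : ℤ) ∣ B₀ * q ^ 2 := by
      have : B₀ * q ^ 2 = 4 * N - m * m := by linear_combination h2
      rw [this]
      exact dvd_sub (hpN.mul_left _) (hpm.mul_left _)
    exact hpr.dvd_of_dvd_pow ((hpr.dvd_or_dvd h5).resolve_left hB)
  have h2x : 2 * x ∈ v.asIdeal ^ 2 := by
    rw [← hp.2, Ideal.mem_span_singleton, h1]
    have hc : ∀ t : ℤ, (p : ℤ) ∣ t → (p : 𝓞 K) ∣ (t : 𝓞 K) := by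
      rintro t ⟨c, rfl⟩; exact ⟨c, by push_cast; rfl⟩
    exact dvd_add (hc m hpm) ((hc q hq).mul_right _)
  obtain ⟨a, b, hab⟩ := hpr.coprime_iff_not_dvd.2 h2'
  apply hx2
  have hab' : (a : 𝓞 K) * p + b * 2 = 1 := by exact_mod_cast congrArg (Int.cast : ℤ → 𝓞 K) hab
  have : x = a * x * p + b * (2 * x) := by linear_combination (-x) * hab'
  rw [this]
  refine Ideal.add_mem _ (Ideal.mul_mem_left _ _ ?_) (Ideal.mul_mem_left _ _ h2x)
  rw [← hp.2]; exact Ideal.mem_span_singleton_self _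

end

/-! ### Factorizations of `C` -/

section

variable {B₀ C : ℤ} {s : 𝓞 K} {σ : K ≃ₐ[ℚ] K}

theorem iord_prod_primes (T : Finset (HeightOneSpectrum (𝓞 K))) (v : HeightOneSpectrum (𝓞 K))
    [Decidable (v ∈ T)] : iord v (∏ w ∈ T, w.asIdeal) = if v ∈ T then 1 else 0 := by
  classical
  have hprod : ((∏ w ∈ T, w.asIdeal : Ideal (𝓞 K)) : FractionalIdeal (𝓞 K)⁰ K) =
      ∏ w ∈ T, (w.asIdeal : FractionalIdeal (𝓞 K)⁰ K) :=
    map_prod (FractionalIdeal.coeIdealHom (𝓞 K)⁰ K) _ _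
  rw [iord, hprod, FractionalIdeal.count_prod]
  · simp_rw [FractionalIdeal.count_maximal]
    by_cases hv : v ∈ T <;> simp [Finset.sum_ite_eq', hv]
  · exact fun w _ => FractionalIdeal.coeIdeal_ne_zero.2 w.ne_bot

/-- The condition on `C` that inert primes do not divide it and ramified primes divide it at most
once. -/
def IsAdmissibleConstant (K : Type*) [Field K] [NumberField K] (C : ℤ) : Prop :=
  (∀ p : ℕ, IsInert K p → ¬ (p : ℤ) ∣ C) ∧
    ∀ (p : ℕ) (v : HeightOneSpectrum (𝓞 K)), RamifiesAs p v → padicValInt p C ≤ 1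

theorem IsQuadratic.ramified_of_not_split (h : IsQuadratic B₀ s σ) (hC : C ≠ 0)
    (hadm : IsAdmissibleConstant K C) {v : HeightOneSpectrum (𝓞 K)}
    (hv : (C : 𝓞 K) ∈ v.asIdeal) (hs : ¬ IsSplitPrime σ v) :
    IsRamifiedPrime v ∧ iord v (Ideal.span {(C : 𝓞 K)}) = 2 := by
  obtain ⟨p, hp, hpv⟩ := exists_prime_mem v
  have hpC : (p : ℤ) ∣ C := (int_mem_iff hp hpv).1 hv
  rcases h.prime_cases hp hpv with h1 | h1 | h1
  · exact absurd hpC (hadm.1 p ⟨hp, h1 ▸ v.isPrime⟩)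
  · refine ⟨⟨p, h1⟩, ?_⟩
    have h2 := hadm.2 p v h1
    have h3 : 0 < iord v (Ideal.span {(C : 𝓞 K)}) :=
      (iord_pos_iff v (span_int_ne_bot hC)).2 (mem_iff_dvd_span.1 hv)
    rw [iord_int hp hpv hC, h1.iord_eq_two] at h3 ⊢
    have h4 : 0 < padicValInt p C := by
      rcases Nat.eq_zero_or_pos (padicValInt p C) with h0 | h0
      · rw [h0] at h3; simp at h3
      · exact h0
    have h5 : padicValInt p C = 1 := by omega
    rw [h5]; norm_num
  · exact absurd ⟨p, _, h1⟩ hs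

/-- A set of primes that contains exactly one of each pair of conjugate split primes dividing `C`,
and no other primes. -/
structure IsHalf (σ : K ≃ₐ[ℚ] K) (C : ℤ) (pos : HeightOneSpectrum (𝓞 K) → Prop) : Prop where
  split : ∀ v, pos v → IsSplitPrime σ v
  mem : ∀ v, pos v → (C : 𝓞 K) ∈ v.asIdeal
  conj : ∀ v, IsSplitPrime σ v → (C : 𝓞 K) ∈ v.asIdeal → (pos v ↔ ¬ pos (conjPrime σ v))

/-- The ideals `jp`, `jm` and `r` are the parts of `C` supported on the set `pos`, on its
conjugate, and on the set `T` of ramified primes. -/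
structure IsFactorization (σ : K ≃ₐ[ℚ] K) (C : ℤ) (pos : HeightOneSpectrum (𝓞 K) → Prop)
    (jp jm r : Ideal (𝓞 K)) (T : Finset (HeightOneSpectrum (𝓞 K))) : Prop where
  jp_ne : jp ≠ ⊥
  jm_ne : jm ≠ ⊥
  r_ne : r ≠ ⊥
  span_eq : Ideal.span {(C : 𝓞 K)} = jp * jm * r ^ 2
  jp_eq : jp = conjIdeal σ jm
  iord_pos : ∀ v, pos v → iord v jp = iord v (Ideal.span {(C : 𝓞 K)})
  iord_not_pos : ∀ v, ¬ pos v → iord v jp = 0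
  iord_jm : ∀ v, iord v jm = iord (conjPrime σ v) jp
  r_eq : r = ∏ v ∈ T, v.asIdeal
  ramified : ∀ v ∈ T, IsRamifiedPrime v

theorem IsQuadratic.exists_factorization (h : IsQuadratic B₀ s σ) (hC : C ≠ 0)
    (hadm : IsAdmissibleConstant K C) {pos : HeightOneSpectrum (𝓞 K) → Prop}
    (hpos : IsHalf σ C pos) :
    ∃ (jp jm r : Ideal (𝓞 K)) (T : Finset (HeightOneSpectrum (𝓞 K))),
      IsFactorization σ C pos jp jm r T := by
  classical
  have hC0 := span_int_ne_bot (K := K) hC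
  have hzero : ∀ v : HeightOneSpectrum (𝓞 K), iord v (Ideal.span {(C : 𝓞 K)}) ≠ 0 ↔
      (C : 𝓞 K) ∈ v.asIdeal := fun v => by
    rw [Ne, iord_eq_zero_iff v hC0, not_not, mem_iff_dvd_span]
  obtain ⟨jp, hjp, hjpe⟩ := exists_iord_eq
    (fun v => if pos v then (iord v (Ideal.span {(C : 𝓞 K)})).toNat else 0)
    ((finite_iord_ne_zero hC0).subset fun v hv => by
      have hv' : (if pos v then (iord v (Ideal.span {(C : 𝓞 K)})).toNat else 0) ≠ 0 := hv
      split_ifs at hv' with h1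
      · exact (hzero v).2 (hpos.mem v h1)
      · exact absurd rfl hv')
  have hjp1 : ∀ v, pos v → iord v jp = iord v (Ideal.span {(C : 𝓞 K)}) := fun v hv => by
    rw [hjpe, if_pos hv, Int.toNat_of_nonneg (iord_nonneg _ _)]
  have hjp2 : ∀ v, ¬ pos v → iord v jp = 0 := fun v hv => by rw [hjpe, if_neg hv, Nat.cast_zero]
  have hTfin : {v : HeightOneSpectrum (𝓞 K) | (C : 𝓞 K) ∈ v.asIdeal ∧ ¬ IsSplitPrime σ v}.Finite :=
    (finite_iord_ne_zero hC0).subset fun v hv => (hzero v).2 hv.1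
  have hT : ∀ v, v ∈ hTfin.toFinset ↔ (C : 𝓞 K) ∈ v.asIdeal ∧ ¬ IsSplitPrime σ v := fun v => by
    simp
  have hr : (∏ v ∈ hTfin.toFinset, v.asIdeal) ≠ ⊥ :=
    Finset.prod_ne_zero_iff.2 fun v _ => v.ne_bot
  have hjm := h.conjIdeal_ne_bot hjp
  refine ⟨jp, conjIdeal σ jp, ∏ v ∈ hTfin.toFinset, v.asIdeal, hTfin.toFinset, hjp, hjm, hr, ?_,
    (h.conjIdeal_conjIdeal jp).symm, hjp1, hjp2, fun v => (h.iord_conjPrime v hjp).symm, rfl,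
    fun v hv => (h.ramified_of_not_split hC hadm ((hT v).1 hv).1 ((hT v).1 hv).2).1⟩
  refine ext_iord hC0 (mul_ne_zero (mul_ne_zero hjp hjm) (pow_ne_zero 2 hr)) fun v => ?_
  rw [iord_mul v (mul_ne_zero hjp hjm) (pow_ne_zero 2 hr), iord_mul v hjp hjm, iord_pow,
    iord_prod_primes, ← h.iord_conjPrime v hjp]
  by_cases hCv : (C : 𝓞 K) ∈ v.asIdeal
  · by_cases hs : IsSplitPrime σ v
    · rw [if_neg fun hT' => ((hT v).1 hT').2 hs]
      by_cases hp : pos v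
      · rw [hjp1 v hp, hjp2 _ ((hpos.conj v hs hCv).1 hp)]; ring
      · have hp' : pos (conjPrime σ v) := by
          by_contra hp'; exact hp ((hpos.conj v hs hCv).2 hp')
        rw [hjp2 v hp, hjp1 _ hp', h.iord_conjPrime_int v hC]; ring
    · rw [if_pos ((hT v).2 ⟨hCv, hs⟩), hjp2 v fun hp => hs (hpos.split v hp),
        hjp2 _ fun hp => hs (h.isSplitPrime_conj.1 (hpos.split _ hp)),
        (h.ramified_of_not_split hC hadm hCv hs).2]
      norm_num
  · rw [if_neg fun hT' => hCv ((hT v).1 hT').1, hjp2 v fun hp => hCv (hpos.mem v hp),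
      hjp2 _ fun hp => hCv (h.int_mem_conjPrime.1 (hpos.mem _ hp)), iord_int_eq_zero hC hCv]
    norm_num

variable {O : Subalgebra ℤ (𝓞 K)} {g n : ℕ}

theorem toPrincipalIdeal_mem_nthClasses {x : Kˣ} (hx : x ∈ orderUnits O g) :
    toPrincipalIdeal (𝓞 K) K x ∈ nthClasses O g n :=
  mem_nthClasses.2 ⟨x, hx, 1, one_mem _, by simp⟩

theorem pow_mem_nthClasses {L : (FractionalIdeal (𝓞 K)⁰ K)ˣ} (hL : L ∈ primeToGroup K g) :
    L ^ n ∈ nthClasses O g n :=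
  mem_nthClasses.2 ⟨1, one_mem _, L, hL, by simp⟩

/-- The product of an ideal prime to `g` and its conjugate is generated by an integer, which belongs to
every order and is prime to `g`. -/
theorem IsQuadratic.exists_mul_conjIdeal_orderUnits (h : IsQuadratic B₀ s σ) {I : Ideal (𝓞 K)}
    (hI : I ≠ ⊥) (hIg : IsPrimeTo g I) (hIg' : IsPrimeTo g (conjIdeal σ I)) :
    ∃ N : ℕ, ∃ hN : (N : 𝓞 K) ≠ 0, I * conjIdeal σ I = Ideal.span {(N : 𝓞 K)} ∧
      fieldUnit (N : 𝓞 K) hN ∈ orderUnits O g := by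
  obtain ⟨N, hN⟩ := h.exists_mul_conjIdeal I
  have hN0 : (N : 𝓞 K) ≠ 0 := by
    intro h0
    rw [h0, Ideal.span_singleton_eq_bot.2 rfl] at hN
    exact mul_ne_zero hI (h.conjIdeal_ne_bot hI) hN
  refine ⟨N, hN0, hN, fieldUnit_mem_orderUnits hN0 ?_ ?_⟩
  · simp
  · rw [← isPrimeTo_span_iff, ← hN]; exact hIg.mul hIg'

/-- The class of an ideal that equals its conjugate is killed by `2`, hence an `n`-th power if `n` is
odd. -/
theorem IsQuadratic.mem_nthClasses_of_conjIdeal_eq (h : IsQuadratic B₀ s σ) (hn : Odd n)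
    {I : (Ideal (𝓞 K))⁰} (hI : conjIdeal σ (I : Ideal (𝓞 K)) = I)
    (hIg : IsPrimeTo g (I : Ideal (𝓞 K))) :
    FractionalIdeal.mk0 K I ∈ nthClasses O g n := by
  obtain ⟨N, hN0, hN, hNO⟩ := h.exists_mul_conjIdeal_orderUnits (O := O)
    (nonZeroDivisors.coe_ne_zero I) hIg (hI.symm ▸ hIg)
  obtain ⟨k, rfl⟩ := hn
  have h2 : FractionalIdeal.mk0 K I ^ 2 = toPrincipalIdeal (𝓞 K) K (fieldUnit (N : 𝓞 K) hN0) := by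
    rw [← map_pow]
    refine mk0_eq_of_eq_span hN0 ?_
    rw [← hN, hI, ← pow_two]; rfl
  have h3 : FractionalIdeal.mk0 K I = FractionalIdeal.mk0 K I ^ (2 * k + 1) *
      (toPrincipalIdeal (𝓞 K) K (fieldUnit (N : 𝓞 K) hN0) ^ k)⁻¹ := by
    rw [← h2, ← pow_mul, pow_succ', mul_inv_cancel_right]
  rw [h3]
  exact mul_mem (pow_mem_nthClasses (mk0_mem_primeToGroup hIg))
    (inv_mem (pow_mem (toPrincipalIdeal_mem_nthClasses hNO) k))

section

variable {pos : HeightOneSpectrum (𝓞 K) → Prop} {jp jm r : Ideal (𝓞 K)}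
  {T : Finset (HeightOneSpectrum (𝓞 K))}

theorem IsFactorization.jp_dvd (hF : IsFactorization σ C pos jp jm r T) :
    jp ∣ Ideal.span {(C : 𝓞 K)} := ⟨jm * r ^ 2, by rw [hF.span_eq]; ring⟩

theorem IsFactorization.jm_dvd (hF : IsFactorization σ C pos jp jm r T) :
    jm ∣ Ideal.span {(C : 𝓞 K)} := ⟨jp * r ^ 2, by rw [hF.span_eq]; ring⟩

theorem IsFactorization.r_dvd (hF : IsFactorization σ C pos jp jm r T) :
    r ∣ Ideal.span {(C : 𝓞 K)} := ⟨jp * jm * r, by rw [hF.span_eq]; ring⟩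

theorem IsQuadratic.conjIdeal_eq_of_ramified (h : IsQuadratic B₀ s σ)
    (hT : ∀ v ∈ T, IsRamifiedPrime v) :
    conjIdeal σ (∏ v ∈ T, v.asIdeal) = ∏ v ∈ T, v.asIdeal := by
  rw [conjIdeal, ← Ideal.mapHom_apply, map_prod]
  refine Finset.prod_congr rfl fun v hv => ?_
  have hvc : conjPrime σ v = v := by
    by_contra hne
    exact (hT v hv).not_isSplitPrime (h.isSplitPrime_iff.2 hne)
  exact congrArg HeightOneSpectrum.asIdeal hvc

theorem isPrimeTo_of_dvd_span (hCg : IsCoprime (C : 𝓞 K) (g : 𝓞 K)) {I : Ideal (𝓞 K)}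
    (hI : I ∣ Ideal.span {(C : 𝓞 K)}) : IsPrimeTo g I :=
  (isPrimeTo_span_iff.2 hCg).of_dvd hI

theorem IsFactorization.conjIdeal_jp (h : IsQuadratic B₀ s σ)
    (hF : IsFactorization σ C pos jp jm r T) : conjIdeal σ jp = jm := by
  rw [hF.jp_eq, h.conjIdeal_conjIdeal]

theorem IsFactorization.r_mem_nthClasses (h : IsQuadratic B₀ s σ) (hn : Odd n)
    (hF : IsFactorization σ C pos jp jm r T) (hCg : IsCoprime (C : 𝓞 K) (g : 𝓞 K)) :
    FractionalIdeal.mk0 K ⟨r, mem_nonZeroDivisors_of_ne_zero hF.r_ne⟩ ∈ nthClasses O g n :=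
  h.mem_nthClasses_of_conjIdeal_eq hn
    (by
      have hT := h.conjIdeal_eq_of_ramified hF.ramified
      rwa [← hF.r_eq] at hT)
    (isPrimeTo_of_dvd_span hCg hF.r_dvd)

theorem IsFactorization.hasClassFactorization (h : IsQuadratic B₀ s σ)
    (hpos : IsHalf σ C pos) (hF : IsFactorization σ C pos jp jm r T) {f : ℤ} (hg : g ≠ 0)
    (hO : ∀ t : 𝓞 K, (g : 𝓞 K) * t ∈ quadOrder s f B₀ C) (hCg : IsCoprime (C : 𝓞 K) (g : 𝓞 K))
    (hjp : FractionalIdeal.mk0 K ⟨jp, mem_nonZeroDivisors_of_ne_zero hF.jp_ne⟩ ∈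
      nthClasses (quadOrder s f B₀ C) g n) :
    HasClassFactorization σ s n f B₀ C := by
  have hdvd : ∀ v : HeightOneSpectrum (𝓞 K), v.asIdeal ∣ jp → pos v := fun v hv => by
    by_contra hp
    exact ((iord_eq_zero_iff v hF.jp_ne).1 (hF.iord_not_pos v hp)) hv
  have hdvd' : ∀ v : HeightOneSpectrum (𝓞 K), v.asIdeal ∣ jm → pos (conjPrime σ v) := fun v hv => by
    by_contra hp
    exact ((iord_eq_zero_iff v hF.jm_ne).1 (by rw [hF.iord_jm, hF.iord_not_pos _ hp])) hv
  have hjpg := isPrimeTo_of_dvd_span hCg hF.jp_dvd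
  have hjmg := isPrimeTo_of_dvd_span hCg hF.jm_dvd
  obtain ⟨N, hN0, hN, hNO⟩ := h.exists_mul_conjIdeal_orderUnits (O := quadOrder s f B₀ C) hF.jp_ne hjpg
    (by rw [hF.conjIdeal_jp h]; exact hjmg)
  rw [hF.conjIdeal_jp h] at hN
  refine ⟨jp, jm, r, T, hF.span_eq, isCoprime_of_forall hF.jp_ne fun v hv hv' => ?_, hF.jp_eq,
    fun v hv => hpos.split v (hdvd v hv),
    fun v hv => h.isSplitPrime_conj.1 (hpos.split _ (hdvd' v hv)),
    (classMemMultiples_iff hg hO n ⟨jp, mem_nonZeroDivisors_of_ne_zero hF.jp_ne⟩ hjpg).2 hjp,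
    (classMemMultiples_iff hg hO n ⟨jm, mem_nonZeroDivisors_of_ne_zero hF.jm_ne⟩ hjmg).2 ?_,
    hF.r_eq, hF.ramified⟩
  · have hp := hdvd v hv
    exact (hpos.conj v (hpos.split v hp) (hpos.mem v hp)).1 hp (hdvd' v hv')
  · have hmul : FractionalIdeal.mk0 K ⟨jp, mem_nonZeroDivisors_of_ne_zero hF.jp_ne⟩ *
        FractionalIdeal.mk0 K ⟨jm, mem_nonZeroDivisors_of_ne_zero hF.jm_ne⟩ =
        toPrincipalIdeal (𝓞 K) K (fieldUnit (N : 𝓞 K) hN0) := by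
      rw [← map_mul]; exact mk0_eq_of_eq_span hN0 hN
    rw [eq_inv_mul_of_mul_eq hmul]
    exact mul_mem (inv_mem hjp) (toPrincipalIdeal_mem_nthClasses hNO)

end

end

/-! ### From points to factorizations of `C` -/

section

variable {B₀ C : ℤ} {s : 𝓞 K} {σ : K ≃ₐ[ℚ] K} {n g : ℕ}

theorem mul_dvd_of_ne {v w : HeightOneSpectrum (𝓞 K)} (hvw : v ≠ w) {A : Ideal (𝓞 K)}
    (hv : v.asIdeal ∣ A) (hw : w.asIdeal ∣ A) : v.asIdeal * w.asIdeal ∣ A := by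
  refine IsCoprime.mul_dvd (isCoprime_of_forall v.ne_bot fun u hu hu' => hvw ?_) hv hw
  rw [← eq_of_dvd hu, ← eq_of_dvd hu']

theorem IsRamifiedPrime.conjPrime_eq (h : IsQuadratic B₀ s σ) {v : HeightOneSpectrum (𝓞 K)}
    (hv : IsRamifiedPrime v) : conjPrime σ v = v := by
  by_contra hne
  exact hv.not_isSplitPrime (h.isSplitPrime_iff.2 hne)

theorem IsQuadratic.conjPrime_eq_of_not_split (h : IsQuadratic B₀ s σ)
    {v : HeightOneSpectrum (𝓞 K)} (hv : ¬ IsSplitPrime σ v) : conjPrime σ v = v := by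
  by_contra hne
  exact hv (h.isSplitPrime_iff.2 hne)

/-- An ideal of `𝓞 K` that is not divisible by a prime number. -/
def IsPrimitiveIdeal (A : Ideal (𝓞 K)) : Prop :=
  ∀ p : ℕ, p.Prime → ¬ Ideal.span {(p : 𝓞 K)} ∣ A

section

variable {A : Ideal (𝓞 K)}

theorem IsPrimitiveIdeal.iord_inert (hA : IsPrimitiveIdeal A) (hA0 : A ≠ ⊥) {p : ℕ} (hp : p.Prime)
    {v : HeightOneSpectrum (𝓞 K)} (hv : Ideal.span {(p : 𝓞 K)} = v.asIdeal) : iord v A = 0 :=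
  (iord_eq_zero_iff v hA0).2 fun h => hA p hp (hv ▸ h)

theorem IsPrimitiveIdeal.iord_ramified (hA : IsPrimitiveIdeal A) (hA0 : A ≠ ⊥) {p : ℕ}
    {v : HeightOneSpectrum (𝓞 K)} (hv : RamifiesAs p v) : iord v A ≤ 1 := by
  by_contra hlt
  refine hA p hv.1 (hv.2 ▸ (le_iord_iff v hA0 2).1 ?_)
  push_cast
  omega

theorem IsPrimitiveIdeal.iord_split (hA : IsPrimitiveIdeal A)
    (hA0 : A ≠ ⊥) {v : HeightOneSpectrum (𝓞 K)} (hv : IsSplitPrime σ v) :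
    iord v A = 0 ∨ iord (conjPrime σ v) A = 0 := by
  obtain ⟨p, w, hw⟩ := hv
  rw [← hw.eq_conjPrime, iord_eq_zero_iff v hA0, iord_eq_zero_iff w hA0, ← not_and_or]
  rintro ⟨h1, h2⟩
  exact hA p hw.1 (hw.2.2.2 ▸ mul_dvd_of_ne hw.2.2.1 h1 h2)

end

/-- The data extracted from a `*⁰` point `(x, y, z)` with `z` prime to `C`: the element
`α = x + f √(-B₀) y` has norm `C zⁿ` and is not divisible by a prime number. -/
structure IsPointElement (σ : K ≃ₐ[ℚ] K) (C : ℤ) (n : ℕ) (α : 𝓞 K) (z : ℤ) : Prop where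
  norm : α * conj σ α = ((C * z ^ n : ℤ) : 𝓞 K)
  coprime : IsCoprime z C
  primitive : IsPrimitiveIdeal (Ideal.span {α})

section

variable {α : 𝓞 K} {z : ℤ}

theorem IsPointElement.ne_zero (hα : IsPointElement σ C n α z) : α ≠ 0 := by
  rintro rfl
  exact hα.primitive 2 Nat.prime_two (by simp)

theorem IsPointElement.z_ne_zero (hα : IsPointElement σ C n α z) (hn : n ≠ 0) : z ≠ 0 := by
  rintro rfl
  have := hα.norm
  rw [zero_pow hn, mul_zero, Int.cast_zero, mul_eq_zero] at this
  rcases this with h | h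
  · exact hα.ne_zero h
  · exact hα.ne_zero ((map_eq_zero_iff _ (conj σ).injective).1 h)

theorem IsPointElement.iord_add (h : IsQuadratic B₀ s σ) (hα : IsPointElement σ C n α z)
    (hn : n ≠ 0) (hC : C ≠ 0) (v : HeightOneSpectrum (𝓞 K)) :
    iord v (Ideal.span {α}) + iord (conjPrime σ v) (Ideal.span {α}) =
      iord v (Ideal.span {(C : 𝓞 K)}) + n * iord v (Ideal.span {(z : 𝓞 K)}) := by
  have h0 : Ideal.span {α} ≠ ⊥ := by
    rw [Ne, Ideal.span_singleton_eq_bot]; exact hα.ne_zero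
  have hz := hα.z_ne_zero hn
  rw [h.iord_conjPrime v h0, ← iord_mul v h0 (h.conjIdeal_ne_bot h0), conjIdeal_span,
    Ideal.span_singleton_mul_span_singleton, hα.norm, span_int_mul,
    iord_mul v (span_int_ne_bot hC) (span_int_ne_bot (pow_ne_zero n hz)), ← iord_pow,
    Ideal.span_singleton_pow]
  push_cast
  rfl

theorem IsPointElement.iord_z (hα : IsPointElement σ C n α z) (hn : n ≠ 0)
    {v : HeightOneSpectrum (𝓞 K)} (hv : (C : 𝓞 K) ∈ v.asIdeal) :
    iord v (Ideal.span {(z : 𝓞 K)}) = 0 := by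
  refine iord_int_eq_zero (hα.z_ne_zero hn) fun hz => v.isPrime.ne_top ?_
  obtain ⟨a, b, hab⟩ := hα.coprime
  rw [Ideal.eq_top_iff_one]
  have : (1 : 𝓞 K) = a * z + b * C := by exact_mod_cast hab.symm
  rw [this]
  exact Ideal.add_mem _ (Ideal.mul_mem_left _ _ hz) (Ideal.mul_mem_left _ _ hv)

theorem IsPointElement.span_ne_bot (hα : IsPointElement σ C n α z) : Ideal.span {α} ≠ ⊥ := by
  rw [Ne, Ideal.span_singleton_eq_bot]; exact hα.ne_zero

theorem iord_int_pos (hC : C ≠ 0) {v : HeightOneSpectrum (𝓞 K)} (hv : (C : 𝓞 K) ∈ v.asIdeal) :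
    0 < iord v (Ideal.span {(C : 𝓞 K)}) :=
  (iord_pos_iff v (span_int_ne_bot hC)).2 (mem_iff_dvd_span.1 hv)

theorem IsPointElement.isAdmissibleConstant (h : IsQuadratic B₀ s σ)
    (hα : IsPointElement σ C n α z) (hn : n ≠ 0) (hC : C ≠ 0) : IsAdmissibleConstant K C := by
  refine ⟨fun p hp hpC => ?_, fun p v hv => ?_⟩
  · let v : HeightOneSpectrum (𝓞 K) := ⟨_, hp.2, FermatDescent.span_ne_bot hp.1.ne_zero⟩
    have hpv : (p : 𝓞 K) ∈ v.asIdeal := Ideal.mem_span_singleton_self _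
    have hpv' : (p : 𝓞 K) ∈ (conjPrime σ v).asIdeal := by
      have := (h.int_mem_conjPrime (v := v) (m := p)).2 (by simpa using hpv)
      simpa using this
    have hc := iord_int_pos hC ((int_mem_iff hp.1 hpv).2 hpC)
    have h1 := hα.iord_add h hn hC v
    rw [hα.primitive.iord_inert hα.span_ne_bot hp.1 (v := v) rfl,
      hα.primitive.iord_inert hα.span_ne_bot hp.1 (hp.span_eq hpv')] at h1
    have h2 := mul_nonneg (Int.natCast_nonneg n) (iord_nonneg v (Ideal.span {(z : 𝓞 K)}))
    omega
  · have h1 := hα.iord_add h hn hC v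
    rw [IsRamifiedPrime.conjPrime_eq h ⟨p, hv⟩, iord_int hv.1 hv.mem hC, hv.iord_eq_two] at h1
    have h2 := mul_nonneg (Int.natCast_nonneg n) (iord_nonneg v (Ideal.span {(z : 𝓞 K)}))
    have h3 := hα.primitive.iord_ramified hα.span_ne_bot hv
    omega

/-- The primes dividing both `C` and `α` form one half of the split primes dividing `C`. -/
theorem IsPointElement.isHalf (h : IsQuadratic B₀ s σ) (hα : IsPointElement σ C n α z)
    (hn : n ≠ 0) (hC : C ≠ 0) :
    IsHalf σ C fun v => IsSplitPrime σ v ∧ (C : 𝓞 K) ∈ v.asIdeal ∧ α ∈ v.asIdeal where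
  split := fun v hv => hv.1
  mem := fun v hv => hv.2.1
  conj := fun v hv hCv => by
    have hmem : ∀ w : HeightOneSpectrum (𝓞 K), α ∈ w.asIdeal ↔ 0 < iord w (Ideal.span {α}) :=
      fun w => by rw [iord_pos_iff w hα.span_ne_bot, mem_iff_dvd_span]
    have h1 := hα.iord_add h hn hC v
    rw [hα.iord_z hn hCv] at h1
    have h2 := iord_int_pos hC hCv
    have h3 := hα.primitive.iord_split hα.span_ne_bot hv
    simp only [hv, hCv, h.isSplitPrime_conj.2 hv, h.int_mem_conjPrime.2 hCv, true_and, hmem]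
    omega

end

section

variable {pos : HeightOneSpectrum (𝓞 K) → Prop} {jp jm r : Ideal (𝓞 K)}
  {T : Finset (HeightOneSpectrum (𝓞 K))}

theorem IsFactorization.iord_span (hF : IsFactorization σ C pos jp jm r T)
    (v : HeightOneSpectrum (𝓞 K)) :
    iord v (Ideal.span {(C : 𝓞 K)}) = iord v jp + iord v jm + 2 * iord v r := by
  rw [hF.span_eq, iord_mul v (mul_ne_zero hF.jp_ne hF.jm_ne) (pow_ne_zero 2 hF.r_ne),
    iord_mul v hF.jp_ne hF.jm_ne, iord_pow]
  norm_num

theorem IsFactorization.iord_of_not_mem (hF : IsFactorization σ C pos jp jm r T) (hC : C ≠ 0)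
    {v : HeightOneSpectrum (𝓞 K)} (hv : (C : 𝓞 K) ∉ v.asIdeal) :
    iord v jp = 0 ∧ iord v jm = 0 ∧ iord v r = 0 := by
  have h1 := hF.iord_span v
  rw [iord_int_eq_zero hC hv] at h1
  have := iord_nonneg v jp
  have := iord_nonneg v jm
  have := iord_nonneg v r
  omega

/-- Membership in `nthClasses` only depends on the exponents modulo `n`. -/
theorem mem_nthClasses_of_dvd_ord {O : Subalgebra ℤ (𝓞 K)} (hn : n ≠ 0)
    {J I : (FractionalIdeal (𝓞 K)⁰ K)ˣ} (hJ : J ∈ primeToGroup K g) (hI : I ∈ nthClasses O g n)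
    (hI' : I ∈ primeToGroup K g) (h : ∀ v, (n : ℤ) ∣ ord v I - ord v J) : J ∈ nthClasses O g n := by
  obtain ⟨L, hL, hLn⟩ := exists_pow_eq_of_dvd_ord (g := g) hn (mul_mem hI' (inv_mem hJ))
    (fun v => by rw [ord_mul, ord_inv]; exact h v)
  have : J = I * (L ^ n)⁻¹ := by rw [hLn, mul_inv, inv_inv, mul_inv_cancel_left]
  rw [this]
  exact mul_mem hI (inv_mem (pow_mem_nthClasses hL))

theorem IsPointElement.hasClassFactorization (h : IsQuadratic B₀ s σ) {f : ℤ} {α : 𝓞 K} {z : ℤ}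
    (hα : IsPointElement σ C n α z) (hn : Odd n) (hC : C ≠ 0) (hg : g ≠ 0)
    (hO : ∀ t : 𝓞 K, (g : 𝓞 K) * t ∈ quadOrder s f B₀ C) (hCg : IsCoprime (C : 𝓞 K) (g : 𝓞 K))
    (hαO : α ∈ quadOrder s f B₀ C) (hzg : IsCoprime (z : 𝓞 K) (g : 𝓞 K)) :
    HasClassFactorization σ s n f B₀ C := by
  have hn0 : n ≠ 0 := by rintro rfl; simp at hn
  have hpos := hα.isHalf h hn0 hC
  obtain ⟨jp, jm, r, T, hF⟩ :=
    h.exists_factorization hC (hα.isAdmissibleConstant h hn0 hC) hpos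
  have hαg : IsCoprime α (g : 𝓞 K) := by
    refine IsCoprime.of_mul_left_left (y := conj σ α) ?_
    rw [hα.norm]
    push_cast
    exact hCg.mul_left hzg.pow_left
  have hαu := fieldUnit_mem_orderUnits hα.ne_zero hαO hαg
  have hr := hF.r_mem_nthClasses (O := quadOrder s f B₀ C) h hn hCg
  refine hF.hasClassFactorization h hpos hg hO hCg (mem_nthClasses_of_dvd_ord hn0
    (mk0_mem_primeToGroup (isPrimeTo_of_dvd_span hCg hF.jp_dvd))
    (mul_mem (toPrincipalIdeal_mem_nthClasses hαu) (inv_mem hr))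
    (mul_mem (toPrincipalIdeal_mem_primeToGroup hαu)
      (inv_mem (mk0_mem_primeToGroup (isPrimeTo_of_dvd_span hCg hF.r_dvd)))) fun v => ?_)
  rw [ord_mul, ord_inv, ← mk0_span, ord_mk0, ord_mk0, ord_mk0]
  -- The ideal `(α) r⁻¹ jp⁻¹` has exponent `0` at the primes dividing `C`, and exponents divisible by `n`
  -- elsewhere.
  change (n : ℤ) ∣ iord v (Ideal.span {α}) + -iord v r - iord v jp
  have h1 := hα.iord_add h hn0 hC v
  have h2 := hF.iord_span v
  have h3 := hF.iord_jm v
  have hn2 : ∀ a b : ℤ, a + a = n * b → (n : ℤ) ∣ a := fun a b hab => by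
    have hcop : IsCoprime (n : ℤ) 2 := by
      exact_mod_cast Nat.isCoprime_iff_coprime.2 (Nat.coprime_two_right.2 hn)
    exact hcop.dvd_of_dvd_mul_left ⟨b, by rw [← hab]; ring⟩
  by_cases hv : IsSplitPrime σ v
  · have h4 := hα.primitive.iord_split hα.span_ne_bot hv
    by_cases hCv : (C : 𝓞 K) ∈ v.asIdeal
    · rw [hα.iord_z hn0 hCv] at h1
      have hc := hpos.conj v hv hCv
      refine ⟨0, ?_⟩
      by_cases hp : IsSplitPrime σ v ∧ (C : 𝓞 K) ∈ v.asIdeal ∧ α ∈ v.asIdeal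
      · have h5 := hF.iord_pos v hp
        have h6 := hF.iord_not_pos _ (hc.1 hp)
        have h7 := (iord_pos_iff v hα.span_ne_bot).2 (mem_iff_dvd_span.1 hp.2.2)
        omega
      · have h5 := hF.iord_not_pos v hp
        have h6 := hF.iord_pos _ (not_not.1 (mt hc.2 hp))
        rw [h.iord_conjPrime_int v hC] at h6
        have h7 : iord v (Ideal.span {α}) = 0 := (iord_eq_zero_iff v hα.span_ne_bot).2
          fun hd => hp ⟨hv, hCv, mem_iff_dvd_span.2 hd⟩
        omega
    · obtain ⟨h5, h6, h7⟩ := hF.iord_of_not_mem hC hCv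
      rw [iord_int_eq_zero hC hCv] at h1
      rcases h4 with h4 | h4
      · exact ⟨0, by omega⟩
      · exact ⟨iord v (Ideal.span {(z : 𝓞 K)}), by omega⟩
  · have h4 : iord v jp = 0 := hF.iord_not_pos v fun hp => hv hp.1
    rw [h.conjPrime_eq_of_not_split hv] at h1 h3
    by_cases hCv : (C : 𝓞 K) ∈ v.asIdeal
    · rw [hα.iord_z hn0 hCv] at h1
      exact ⟨0, by omega⟩
    · obtain ⟨h5, h6, h7⟩ := hF.iord_of_not_mem hC hCv
      rw [iord_int_eq_zero hC hCv, zero_add] at h1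
      have := hn2 _ _ h1
      rwa [h4, h7, neg_zero, add_zero, sub_zero]

end

end

/-! ### Admissible twists and factorizations of `C` -/

section

variable {B₀ C : ℤ} {s : 𝓞 K} {σ : K ≃ₐ[ℚ] K} {n g : ℕ}

/-- If `Q` holds for one prime of each conjugate pair dividing `C`, it holds on some half. -/
theorem IsQuadratic.exists_isHalf (h : IsQuadratic B₀ s σ) {Q : HeightOneSpectrum (𝓞 K) → Prop}
    (hQ : ∀ v, IsSplitPrime σ v → (C : 𝓞 K) ∈ v.asIdeal → Q v ∨ Q (conjPrime σ v)) :
    ∃ pos, IsHalf σ C pos ∧ ∀ v, pos v → Q v := by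
  -- Where `Q` holds for both members of a pair, a well-ordering selects one of them.
  let lt := WellOrderingRel (α := HeightOneSpectrum (𝓞 K))
  refine ⟨fun v => IsSplitPrime σ v ∧ (C : 𝓞 K) ∈ v.asIdeal ∧ Q v ∧
    (Q (conjPrime σ v) → lt v (conjPrime σ v)), ⟨fun v hv => hv.1, fun v hv => hv.2.1,
    fun v hv hCv => ?_⟩, fun v hv => hv.2.2.1⟩
  have h1 := hQ v hv hCv
  have h2 : ¬ (lt v (conjPrime σ v) ∧ lt (conjPrime σ v) v) := fun h2 =>
    asymm_of WellOrderingRel h2.1 h2.2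
  have h3 : lt v (conjPrime σ v) ∨ v = conjPrime σ v ∨ lt (conjPrime σ v) v :=
    trichotomous_of WellOrderingRel _ _
  have h4 := (h.isSplitPrime_iff.1 hv).symm
  simp only [hv, hCv, h.isSplitPrime_conj.2 hv, h.int_mem_conjPrime.2 hCv, true_and,
    h.conjPrime_conjPrime]
  tauto

theorem SplitsAs.symm (h : IsQuadratic B₀ s σ) {p : ℕ} {v w : HeightOneSpectrum (𝓞 K)}
    (hs : SplitsAs σ p v w) : SplitsAs σ p w v := by
  refine ⟨hs.1, ?_, hs.2.2.1.symm, by rw [hs.2.2.2, mul_comm]⟩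
  rw [hs.2.1, h.conjIdeal_conjIdeal]

theorem SplitsAs.iord_int {p : ℕ} {v w : HeightOneSpectrum (𝓞 K)} (hs : SplitsAs σ p v w)
    {m : ℤ} (hm : m ≠ 0) : iord v (Ideal.span {(m : 𝓞 K)}) = padicValInt p m := by
  rw [FermatDescent.iord_int hs.1 hs.mem hm, hs.iord_eq_one, mul_one]

theorem IsInert.conjPrime_eq (h : IsQuadratic B₀ s σ) {p : ℕ} (hp : IsInert K p)
    {v : HeightOneSpectrum (𝓞 K)} (hv : (p : 𝓞 K) ∈ v.asIdeal) : conjPrime σ v = v := by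
  refine HeightOneSpectrum.ext ?_
  rw [← hp.span_eq hv]
  exact (hp.span_eq (by
    have := (h.int_mem_conjPrime (v := v) (m := p)).2 (by simpa using hv)
    simpa using this)).symm

theorem IsInert.not_isRamifiedPrime {p : ℕ} (hp : IsInert K p)
    {v : HeightOneSpectrum (𝓞 K)} (hv : (p : 𝓞 K) ∈ v.asIdeal) : ¬ IsRamifiedPrime v := by
  rintro ⟨q, hq⟩
  obtain rfl := prime_unique hq.1 hp.1 hq.mem hv
  have h1 := hq.iord_eq_two
  rw [hp.span_eq hv, iord_self] at h1
  norm_num at h1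

section

variable {pos : HeightOneSpectrum (𝓞 K) → Prop} {jp jm r : Ideal (𝓞 K)}
  {T : Finset (HeightOneSpectrum (𝓞 K))}

theorem IsFactorization.iord_r_of_split (hF : IsFactorization σ C pos jp jm r T)
    {v : HeightOneSpectrum (𝓞 K)} (hv : IsSplitPrime σ v) : iord v r = 0 := by
  classical
  rw [hF.r_eq, iord_prod_primes, if_neg fun hT => (hF.ramified v hT).not_isSplitPrime hv]

/-- At a split prime dividing `C`, one of `jp` and `jm` carries the whole exponent of `C` and the other
is trivial; at all other primes both are trivial. -/
theorem IsFactorization.iord_eq (h : IsQuadratic B₀ s σ) (hpos : IsHalf σ C pos)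
    (hF : IsFactorization σ C pos jp jm r T) (hC : C ≠ 0) (v : HeightOneSpectrum (𝓞 K)) :
    (pos v → iord v jp = iord v (Ideal.span {(C : 𝓞 K)}) ∧ iord v jm = 0) ∧
    (pos (conjPrime σ v) → iord v jp = 0 ∧ iord v jm = iord v (Ideal.span {(C : 𝓞 K)})) ∧
    (¬ (IsSplitPrime σ v ∧ (C : 𝓞 K) ∈ v.asIdeal) → iord v jp = 0 ∧ iord v jm = 0) := by
  refine ⟨fun hv => ⟨hF.iord_pos v hv, ?_⟩, fun hv => ⟨?_, ?_⟩, fun hv => ⟨?_, ?_⟩⟩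
  · rw [hF.iord_jm, hF.iord_not_pos _ ((hpos.conj v (hpos.split v hv) (hpos.mem v hv)).1 hv)]
  · have hs := hpos.split _ hv
    have hm := hpos.mem _ hv
    have := (hpos.conj _ hs hm).1 hv
    rw [h.conjPrime_conjPrime] at this
    exact hF.iord_not_pos v this
  · rw [hF.iord_jm, hF.iord_pos _ hv, h.iord_conjPrime_int v hC]
  · exact hF.iord_not_pos v fun hp => hv ⟨hpos.split v hp, hpos.mem v hp⟩
  · rw [hF.iord_jm, hF.iord_not_pos]
    exact fun hp => hv ⟨h.isSplitPrime_conj.1 (hpos.split _ hp),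
      h.int_mem_conjPrime.1 (hpos.mem _ hp)⟩

theorem IsFactorization.exists_span_eq (h : IsQuadratic B₀ s σ)
    (hF : IsFactorization σ C pos jp jm r T) (O : Subalgebra ℤ (𝓞 K))
    (hCg : IsCoprime (C : 𝓞 K) (g : 𝓞 K)) : ∃ N ∈ orderUnits O g, ∀ v,
      val v (N : K) = iord v jp + iord v jm := by
  obtain ⟨N, hN0, hN, hNO⟩ := h.exists_mul_conjIdeal_orderUnits (O := O) hF.jp_ne
    (isPrimeTo_of_dvd_span hCg hF.jp_dvd)
    (by rw [hF.conjIdeal_jp h]; exact isPrimeTo_of_dvd_span hCg hF.jm_dvd)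
  refine ⟨_, hNO, fun v => ?_⟩
  change val v (algebraMap (𝓞 K) K (N : 𝓞 K)) = _
  rw [← FermatDescent.iord_span, ← hN, hF.conjIdeal_jp h, iord_mul v hF.jp_ne hF.jm_ne]

theorem val_eq_of_toPrincipalIdeal_eq {d α β : Kˣ}
    (hd : toPrincipalIdeal (𝓞 K) K d = toPrincipalIdeal (𝓞 K) K α * toPrincipalIdeal (𝓞 K) K β ^ n)
    (v : HeightOneSpectrum (𝓞 K)) : val v (d : K) = val v (α : K) + n * val v (β : K) := by
  rw [← ord_toPrincipalIdeal, hd, ord_mul, ord_pow, ord_toPrincipalIdeal, ord_toPrincipalIdeal]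

/-- An admissible twist gives a factorization: up to `n`-th powers, its divisor is `(jp jm)ᵏ jp`, where
`n = 2k + 1`, and `jp jm` is principal. -/
theorem IsQuadratic.hasClassFactorization_of_isAdmissible (h : IsQuadratic B₀ s σ) {f : ℤ}
    (hn : Odd n) (hC : C ≠ 0) (hadm : IsAdmissibleConstant K C) (hg : quadConductor f B₀ C ≠ 0)
    (hO : ∀ t : 𝓞 K, (quadConductor f B₀ C : 𝓞 K) * t ∈ quadOrder s f B₀ C)
    (hCg : IsCoprime (C : 𝓞 K) (quadConductor f B₀ C : 𝓞 K))
    {S : Set (HeightOneSpectrum (𝓞 K))} (hS : IsInvertedSet n C f S) (d : (S.integer K)ˣ)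
    (hd : IsAdmissible σ s n f B₀ C S ((d : S.integer K) : K)) :
    HasClassFactorization σ s n f B₀ C := by
  obtain ⟨hd1, hd2, hd3⟩ := hd
  have hn0 : n ≠ 0 := by rintro rfl; simp at hn
  obtain ⟨k, hk⟩ := hn
  have hk1 : ((n : ℤ) + 1) / 2 = k + 1 := by omega
  have hk2 : ((n : ℤ) - 1) / 2 = k := by omega
  rw [hk1, hk2] at hd1
  let c : HeightOneSpectrum (𝓞 K) → ℤ := fun v => iord v (Ideal.span {(C : 𝓞 K)})
  let D : Kˣ := sUnitVal S d
  obtain ⟨pos, hpos, hQ⟩ := h.exists_isHalf (C := C)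
    (Q := fun v => val v (D : K) ≡ c v * (k + 1) [ZMOD n] ∧
      val (conjPrime σ v) (D : K) ≡ c v * k [ZMOD n]) (by
    rintro v ⟨p, w, hs⟩ hCv
    obtain rfl := hs.eq_conjPrime
    have hcc : c (conjPrime σ v) = c v := h.iord_conjPrime_int v hC
    have hcv : c v = padicValInt p C := hs.iord_int hC
    rw [hcc, h.conjPrime_conjPrime, hcv]
    exact (hd1 p v _ hs ((int_mem_iff hs.1 hs.mem).1 hCv)).imp id And.symm)
  obtain ⟨jp, jm, r, T, hF⟩ := h.exists_factorization hC hadm hpos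
  obtain ⟨N, hNO, hN⟩ := hF.exists_span_eq h (quadOrder s f B₀ C) hCg
  obtain ⟨α, hα, β, hdαβ⟩ := (divMemImagePsi_iff hg hO n D).1 hd3
  refine hF.hasClassFactorization h hpos hg hO hCg (mem_nthClasses_of_dvd_ord hn0
    (mk0_mem_primeToGroup (isPrimeTo_of_dvd_span hCg hF.jp_dvd))
    (toPrincipalIdeal_mem_nthClasses (mul_mem hα (inv_mem (pow_mem hNO k))))
    (toPrincipalIdeal_mem_primeToGroup (mul_mem hα (inv_mem (pow_mem hNO k)))) fun v => ?_)
  have h1 := val_eq_of_toPrincipalIdeal_eq hdαβ v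
  rw [map_mul, map_inv, map_pow, ord_mul, ord_inv, ord_pow, ord_toPrincipalIdeal,
    ord_toPrincipalIdeal, ord_mk0, hN]
  change (n : ℤ) ∣ val v (α : K) + -(k * (iord v jp + iord v jm)) - iord v jp
  -- It suffices to compare the exponent of `d` with that of `(jp jm)ᵏ jp`.
  suffices hmain : val v (D : K) ≡ k * (iord v jp + iord v jm) + iord v jp [ZMOD n] by
    obtain ⟨q, hq⟩ := hmain.symm.dvd
    exact ⟨q - val v (β : K), by linear_combination hq - h1⟩
  obtain ⟨e1, e2, e3⟩ := hF.iord_eq h hpos hC v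
  by_cases hv : IsSplitPrime σ v ∧ (C : 𝓞 K) ∈ v.asIdeal
  · by_cases hp : pos v
    · obtain ⟨h2, h3⟩ := e1 hp
      rw [h2, h3]
      convert (hQ v hp).1 using 1
      ring
    · have hp' : pos (conjPrime σ v) := not_not.1 (mt (hpos.conj v hv.1 hv.2).2 hp)
      obtain ⟨h2, h3⟩ := e2 hp'
      have h4 := (hQ _ hp').2
      rw [h.conjPrime_conjPrime] at h4
      rw [h2, h3, ← h.iord_conjPrime_int v hC]
      convert h4 using 1
      ring
  · obtain ⟨h2, h3⟩ := e3 hv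
    rw [h2, h3]
    simp only [add_zero, mul_zero]
    by_cases hvS : v ∈ S
    · exact hd2 v hvS hv
    · have : val v (D : K) = 0 := val_sUnit d hvS
      rw [this]

/-- A factorization of `C` as in `HasClassFactorization` is a factorization attached to the half of
primes dividing `jp`. -/
theorem IsQuadratic.exists_of_hasClassFactorization (h : IsQuadratic B₀ s σ) {f : ℤ} (hC : C ≠ 0)
    (hfac : HasClassFactorization σ s n f B₀ C) :
    ∃ (jp jm r : Ideal (𝓞 K)) (T : Finset (HeightOneSpectrum (𝓞 K)))
      (pos : HeightOneSpectrum (𝓞 K) → Prop), IsHalf σ C pos ∧ IsFactorization σ C pos jp jm r T ∧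
      ClassMemMultiples (quadOrder s f B₀ C) n jp := by
  obtain ⟨jp, jm, r, T, hspan, hcop, hjp, hsp, hsm, hcl, -, hr, hT⟩ := hfac
  have hC0 := span_int_ne_bot (K := K) hC
  have hr0 : r ≠ ⊥ := by rw [hr]; exact Finset.prod_ne_zero_iff.2 fun v _ => v.ne_bot
  have hne : jp ≠ ⊥ ∧ jm ≠ ⊥ := by
    rw [hspan] at hC0
    exact ⟨fun h0 => hC0 (by rw [h0]; simp), fun h0 => hC0 (by rw [h0]; simp)⟩
  obtain ⟨hjp0, hjm0⟩ := hne
  have hjm : ∀ v, iord v jm = iord (conjPrime σ v) jp := fun v => by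
    rw [h.iord_conjPrime v hjp0, hjp, h.conjIdeal_conjIdeal]
  have hC' : ∀ v, iord v (Ideal.span {(C : 𝓞 K)}) = iord v jp + iord v jm + 2 * iord v r :=
    fun v => by
      rw [hspan, iord_mul v (mul_ne_zero hjp0 hjm0) (pow_ne_zero 2 hr0), iord_mul v hjp0 hjm0,
        iord_pow]
      norm_num
  have hrs : ∀ v, IsSplitPrime σ v → iord v r = 0 := fun v hv => by
    classical
    rw [hr, iord_prod_primes, if_neg fun hv' => (hT v hv').not_isSplitPrime hv]
  have hcop' : ∀ v : HeightOneSpectrum (𝓞 K), v.asIdeal ∣ jp → iord v jm = 0 := fun v hv =>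
    (iord_eq_zero_iff v hjm0).2 (not_dvd_of_isCoprime hcop v hv)
  refine ⟨jp, jm, r, T, fun v => v.asIdeal ∣ jp, ⟨hsp, fun v hv => ?_, fun v hv hCv => ?_⟩,
    ⟨hjp0, hjm0, hr0, hspan, hjp, fun v hv => ?_, fun v hv => (iord_eq_zero_iff v hjp0).2 hv,
      hjm, hr, hT⟩, hcl⟩
  · exact mem_iff_dvd_span.2 (hv.trans ⟨jm * r ^ 2, by rw [hspan]; ring⟩)
  · have h1 := iord_int_pos hC hCv
    rw [hC', hrs v hv, hjm] at h1
    have h2 := hcop' v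
    rw [hjm] at h2
    rw [← iord_pos_iff v hjp0] at h2 ⊢
    rw [← iord_pos_iff _ hjp0]
    have := iord_nonneg v jp
    have := iord_nonneg (conjPrime σ v) jp
    constructor
    · intro h3; have := h2 h3; omega
    · omega
  · rw [hC', hcop' v hv, hrs v (hsp v hv)]; ring

theorem IsFactorization.isAdmissibleConstant (h : IsQuadratic B₀ s σ) (hpos : IsHalf σ C pos)
    (hF : IsFactorization σ C pos jp jm r T) (hC : C ≠ 0) : IsAdmissibleConstant K C := by
  classical
  have key : ∀ v : HeightOneSpectrum (𝓞 K), ¬ IsSplitPrime σ v →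
      iord v (Ideal.span {(C : 𝓞 K)}) = if v ∈ T then 2 else 0 := fun v hv => by
    obtain ⟨h1, h2⟩ := (hF.iord_eq h hpos hC v).2.2 fun h' => hv h'.1
    rw [hF.iord_span, h1, h2, hF.r_eq, iord_prod_primes]
    split_ifs <;> rfl
  refine ⟨fun p hp hpC => ?_, fun p v hv => ?_⟩
  · let v : HeightOneSpectrum (𝓞 K) := ⟨_, hp.2, span_ne_bot hp.1.ne_zero⟩
    have hpv : (p : 𝓞 K) ∈ v.asIdeal := Ideal.mem_span_singleton_self _
    have hc := iord_int_pos hC ((int_mem_iff hp.1 hpv).2 hpC)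
    rw [key v fun hs => h.isSplitPrime_iff.1 hs (hp.conjPrime_eq h hpv),
      if_neg fun hT => hp.not_isRamifiedPrime hpv (hF.ramified v hT)] at hc
    exact lt_irrefl _ hc
  · have h1 := key v (IsRamifiedPrime.not_isSplitPrime ⟨p, hv⟩)
    rw [iord_int hv.1 hv.mem hC, hv.iord_eq_two] at h1
    split_ifs at h1 <;> omega

/-- Primes whose classes generate the class group generate, together with principal ideals, all
fractional ideals. -/
theorem exists_toPrincipalIdeal_mul {S : Set (HeightOneSpectrum (𝓞 K))}
    (hS : Subgroup.closure {c : ClassGroup (𝓞 K) | ∃ v ∈ S,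
      c = ClassGroup.mk0 ⟨v.asIdeal, mem_nonZeroDivisors_of_ne_zero v.ne_bot⟩} = ⊤)
    (L : (FractionalIdeal (𝓞 K)⁰ K)ˣ) : ∃ (b : Kˣ) (A : (FractionalIdeal (𝓞 K)⁰ K)ˣ),
      L = toPrincipalIdeal (𝓞 K) K b * A ∧ ∀ v ∉ S, ord v A = 0 := by
  let H : Subgroup (FractionalIdeal (𝓞 K)⁰ K)ˣ :=
    { carrier := {A | ∀ v ∉ S, ord v A = 0}
      one_mem' := fun v _ => ord_one v
      mul_mem' := fun {a b} ha hb v hv => by rw [ord_mul, ha v hv, hb v hv, add_zero]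
      inv_mem' := fun {a} ha v hv => by rw [ord_inv, ha v hv, neg_zero] }
  have hle : Subgroup.closure {c : ClassGroup (𝓞 K) | ∃ v ∈ S,
      c = ClassGroup.mk0 ⟨v.asIdeal, mem_nonZeroDivisors_of_ne_zero v.ne_bot⟩} ≤
      H.map (ClassGroup.mk K) := by
    rw [Subgroup.closure_le]
    rintro _ ⟨v, hv, rfl⟩
    refine ⟨FractionalIdeal.mk0 K ⟨v.asIdeal, mem_nonZeroDivisors_of_ne_zero v.ne_bot⟩,
      fun w hw => ?_, ClassGroup.mk_mk0 K _⟩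
    rw [ord_mk0]
    exact iord_of_ne fun hvw => hw (hvw ▸ hv)
  rw [hS] at hle
  obtain ⟨A, hA, hAL⟩ := hle (Subgroup.mem_top (ClassGroup.mk K L))
  have h1 : ClassGroup.mk K (L * A⁻¹) = 1 := by rw [map_mul, map_inv, hAL, mul_inv_cancel]
  obtain ⟨b, hb⟩ := (FractionalIdeal.isPrincipal_iff _).1 (ClassGroup.mk_eq_one_iff.1 h1)
  have hb0 : b ≠ 0 := by
    rintro rfl
    rw [FractionalIdeal.spanSingleton_zero] at hb
    exact (L * A⁻¹).ne_zero hb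
  refine ⟨Units.mk0 b hb0, A, ?_, hA⟩
  have h2 : toPrincipalIdeal (𝓞 K) K (Units.mk0 b hb0) = L * A⁻¹ := by
    ext1
    rw [coe_toPrincipalIdeal, hb]
    rfl
  rw [h2, inv_mul_cancel_right]

theorem exists_sUnit {S : Set (HeightOneSpectrum (𝓞 K))} (x : Kˣ)
    (hx : ∀ v ∉ S, val v (x : K) = 0) : ∃ d : (S.integer K)ˣ, ((d : S.integer K) : K) = x :=
  ⟨S.unitEquivUnitsInteger K ⟨x, fun v hv => (valuation_eq_one_iff v x).2 (hx v hv)⟩, rfl⟩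

/-- If the class of `jp` is an `n`-th power, then, up to `n`-th powers, `(jp jm)ᵏ jp` is the divisor of an
element, where `n = 2k + 1`, and this element can be chosen to be an `S`-unit. -/
theorem IsFactorization.exists_isAdmissible (h : IsQuadratic B₀ s σ) (hpos : IsHalf σ C pos)
    (hF : IsFactorization σ C pos jp jm r T) {f : ℤ} (hn : Odd n) (hC : C ≠ 0)
    (hg : quadConductor f B₀ C ≠ 0)
    (hO : ∀ t : 𝓞 K, (quadConductor f B₀ C : 𝓞 K) * t ∈ quadOrder s f B₀ C)
    (hCg : IsCoprime (C : 𝓞 K) (quadConductor f B₀ C : 𝓞 K))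
    {S : Set (HeightOneSpectrum (𝓞 K))} (hS : IsInvertedSet n C f S)
    (hcl : ClassMemMultiples (quadOrder s f B₀ C) n jp) :
    (admissibleTwists σ s n f B₀ C S).Nonempty := by
  obtain ⟨k, hk⟩ := hn
  have hk1 : ((n : ℤ) + 1) / 2 = k + 1 := by omega
  have hk2 : ((n : ℤ) - 1) / 2 = k := by omega
  have hjp := (classMemMultiples_iff hg hO n ⟨jp, mem_nonZeroDivisors_of_ne_zero hF.jp_ne⟩
    (isPrimeTo_of_dvd_span hCg hF.jp_dvd)).1 hcl
  obtain ⟨x, hx, L, -, hxL⟩ := mem_nthClasses.1 hjp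
  obtain ⟨b, A, hbA, hA⟩ := exists_toPrincipalIdeal_mul hS.2.2 L
  obtain ⟨N, hNO, hN⟩ := hF.exists_span_eq h (quadOrder s f B₀ C) hCg
  have hval : ∀ v, val v ((N ^ k * x * b ^ n : Kˣ) : K) =
      k * (iord v jp + iord v jm) + iord v jp - n * ord v A := fun v => by
    have h1 : iord v jp = val v (x : K) + n * (val v (b : K) + ord v A) := by
      have h1 := congrArg (ord v) hxL
      rw [ord_mk0, ord_mul, ord_pow, hbA, ord_mul, ord_toPrincipalIdeal, ord_toPrincipalIdeal] at h1
      exact h1.symm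
    rw [← ord_toPrincipalIdeal, map_mul, map_mul, map_pow, map_pow, ord_mul, ord_mul, ord_pow,
      ord_pow, ord_toPrincipalIdeal, ord_toPrincipalIdeal, ord_toPrincipalIdeal, hN]
    linear_combination -h1
  have hmod : ∀ v, val v ((N ^ k * x * b ^ n : Kˣ) : K) ≡
      k * (iord v jp + iord v jm) + iord v jp [ZMOD n] := fun v => by
    rw [hval]
    exact Int.modEq_iff_dvd.2 ⟨ord v A, by ring⟩
  obtain ⟨d, hd⟩ := exists_sUnit (S := S) (N ^ k * x * b ^ n) fun v hv => by
    have hCv : (C : 𝓞 K) ∉ v.asIdeal := fun hCv => hv (hS.2.1 v (by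
      push_cast
      exact Ideal.mul_mem_right _ _ (Ideal.mul_mem_left _ _ hCv)))
    obtain ⟨h1, h2⟩ := (hF.iord_eq h hpos hC v).2.2 fun h' => hCv h'.2
    rw [hval, h1, h2, hA v hv]
    ring
  refine ⟨_, d, rfl, ?_, ?_, ?_⟩
  · intro p v w hs hpC
    rw [hk1, hk2, hd, ← hs.iord_int hC]
    obtain rfl := hs.eq_conjPrime
    have hCv := (int_mem_iff hs.1 hs.mem).2 hpC
    have hcw := h.iord_conjPrime_int v hC
    have hsv : IsSplitPrime σ v := ⟨p, _, hs⟩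
    have e := hF.iord_eq h hpos hC v
    have e' := hF.iord_eq h hpos hC (conjPrime σ v)
    rw [h.conjPrime_conjPrime, hcw] at e'
    by_cases hp : pos v
    · left
      obtain ⟨h1, h2⟩ := e.1 hp
      obtain ⟨h3, h4⟩ := e'.2.1 hp
      have m1 := hmod v
      have m2 := hmod (conjPrime σ v)
      rw [h1, h2] at m1
      rw [h3, h4] at m2
      constructor
      · convert m1 using 1; ring
      · convert m2 using 1; ring
    · right
      have hp' : pos (conjPrime σ v) := not_not.1 (mt (hpos.conj v hsv hCv).2 hp)
      obtain ⟨h1, h2⟩ := e.2.1 hp'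
      obtain ⟨h3, h4⟩ := e'.1 hp'
      have m1 := hmod v
      have m2 := hmod (conjPrime σ v)
      rw [h1, h2] at m1
      rw [h3, h4] at m2
      constructor
      · convert m1 using 1; ring
      · convert m2 using 1; ring
  · intro v _ hv
    obtain ⟨h1, h2⟩ := (hF.iord_eq h hpos hC v).2.2 hv
    have m := hmod v
    rw [hd]
    rw [h1, h2] at m
    simpa using m
  · rw [hd]
    refine (divMemImagePsi_iff hg hO n _).2
      ⟨N ^ k * x, mul_mem (pow_mem hNO k) hx, b, by rw [map_mul, map_pow]⟩

end

end

/-! ### From factorizations of `C` to points -/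

section

variable {B₀ C : ℤ} {s : 𝓞 K} {σ : K ≃ₐ[ℚ] K} {n g : ℕ}

theorem IsQuadratic.sq_mem_orderUnits (h : IsQuadratic B₀ s σ) (f : ℤ)
    (hC : B₀ ≡ 3 [ZMOD 4] → Odd C) {x : Kˣ}
    (hx : x ∈ orderUnits (quadOrder s f B₀ C) (rootConductor f B₀)) :
    x ^ 2 ∈ orderUnits (rootOrder s f) (rootConductor f B₀) := by
  obtain ⟨a, ha, b, hb, ha0, hb0, hag, hbg, hx⟩ := hx
  refine ⟨a ^ 2, h.sq_mem_rootOrder f hC ha hag, b ^ 2, h.sq_mem_rootOrder f hC hb hbg,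
    pow_ne_zero 2 ha0, pow_ne_zero 2 hb0, hag.pow_left, hbg.pow_left, ?_⟩
  rw [Units.val_pow_eq_pow_val, map_pow, map_pow, ← mul_pow, hx]

/-- The map `Cl(ℤ[f √(-B₀)]) → Cl(𝓞)` has a kernel killed by `2`. As `n` is odd, passing to the
smaller order does not change which classes are `n`-th powers. -/
theorem IsQuadratic.mem_nthClasses_rootOrder (h : IsQuadratic B₀ s σ) (f : ℤ) (hn : Odd n)
    (hC : B₀ ≡ 3 [ZMOD 4] → Odd C) {I : (FractionalIdeal (𝓞 K)⁰ K)ˣ}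
    (hI : I ∈ primeToGroup K (rootConductor f B₀))
    (hI' : I ∈ nthClasses (quadOrder s f B₀ C) (rootConductor f B₀) n) :
    I ∈ nthClasses (rootOrder s f) (rootConductor f B₀) n := by
  obtain ⟨x, hx, L, hL, hxL⟩ := mem_nthClasses.1 hI'
  have h2 : I ^ 2 ∈ nthClasses (rootOrder s f) (rootConductor f B₀) n :=
    mem_nthClasses.2 ⟨x ^ 2, h.sq_mem_orderUnits f hC hx, L ^ 2, pow_mem hL 2, by
      rw [← hxL, map_pow, mul_pow, ← pow_mul, ← pow_mul, mul_comm 2 n]⟩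
  obtain ⟨k, hk⟩ := hn
  have h3 : I = I ^ n * ((I ^ 2) ^ k)⁻¹ := by
    rw [hk, ← pow_mul, pow_succ', mul_inv_cancel_right]
  rw [h3]
  exact mul_mem (pow_mem_nthClasses hI) (inv_mem (pow_mem h2 k))

theorem exists_mem_asIdeal {p : ℕ} (hp : p.Prime) :
    ∃ v : HeightOneSpectrum (𝓞 K), (p : 𝓞 K) ∈ v.asIdeal := by
  have hne : Ideal.span {(p : 𝓞 K)} ≠ ⊤ := by
    rw [Ne, Ideal.span_singleton_eq_top, natCast_isUnit_iff]; exact hp.ne_one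
  obtain ⟨m, hm, hle⟩ := Ideal.exists_le_maximal _ hne
  refine ⟨⟨m, hm.isPrime, ?_⟩, hle (Ideal.mem_span_singleton_self _)⟩
  rintro rfl
  exact span_ne_bot hp.ne_zero (le_bot_iff.1 hle)

theorem iord_le_of_dvd {A D : Ideal (𝓞 K)} (hA : A ≠ ⊥) (hD : D ∣ A)
    (v : HeightOneSpectrum (𝓞 K)) : iord v D ≤ iord v A := by
  obtain ⟨E, rfl⟩ := hD
  rw [iord_mul v (left_ne_zero_of_mul hA) (right_ne_zero_of_mul hA)]
  have := iord_nonneg v E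
  omega

theorem int_dvd_natAbs_cast {a b : ℤ} (h : a ∣ b) : (a : 𝓞 K) ∣ (b.natAbs : 𝓞 K) := by
  have := map_dvd (Int.castRingHom (𝓞 K)) (Int.dvd_natAbs.2 h)
  rwa [eq_intCast, eq_intCast, Int.cast_natCast] at this

theorem isCoprime_int_of_isCoprime {a b : ℤ} (h : IsCoprime (a : 𝓞 K) (b : 𝓞 K)) :
    IsCoprime a b := by
  rw [Int.isCoprime_iff_gcd_eq_one, ← natCast_isUnit_iff (K := K)]
  have key : ∀ m : ℤ, (Int.gcd a b : ℤ) ∣ m → ((Int.gcd a b : ℕ) : 𝓞 K) ∣ (m : 𝓞 K) := fun m hm => by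
    have := map_dvd (Int.castRingHom (𝓞 K)) hm
    simpa using this
  exact h.isUnit_of_dvd' (key a (Int.gcd_dvd_left a b)) (key b (Int.gcd_dvd_right a b))

theorem IsQuadratic.int_dvd_of_dvd (h : IsQuadratic B₀ s σ) {a b : ℤ} (ha : a ≠ 0)
    (hab : (a : 𝓞 K) ∣ (b : 𝓞 K)) : a ∣ b := by
  obtain ⟨c, hc⟩ := hab
  have ha' : (a : 𝓞 K) ≠ 0 := by exact_mod_cast ha
  obtain ⟨m, rfl⟩ := h.exists_int_of_conj_eq (x := c) (mul_left_cancel₀ ha' (by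
    have := congrArg (conj σ) hc
    rw [map_mul, map_intCast, map_intCast] at this
    rw [← this, hc]))
  exact ⟨m, by exact_mod_cast hc⟩

theorem IsQuadratic.mul_conj_eq (h : IsQuadratic B₀ s σ) (f x y : ℤ) :
    ((x : 𝓞 K) + f * s * y) * conj σ ((x : 𝓞 K) + f * s * y) =
      ((x ^ 2 + f ^ 2 * B₀ * y ^ 2 : ℤ) : 𝓞 K) := by
  rw [_root_.map_add, map_mul, map_mul, map_intCast, map_intCast, map_intCast, h.conj_s]
  push_cast
  linear_combination (-f ^ 2 * y ^ 2 : 𝓞 K) * h.sq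

theorem IsQuadratic.eq_or_eq_neg_of_span_eq (h : IsQuadratic B₀ s σ) {a b : ℤ} (ha : a ≠ 0)
    (hb : b ≠ 0) (hab : Ideal.span {(a : 𝓞 K)} = Ideal.span {(b : 𝓞 K)}) : a = b ∨ a = -b := by
  rw [← Int.natAbs_eq_natAbs_iff]
  refine Nat.dvd_antisymm (Int.natAbs_dvd_natAbs.2 (h.int_dvd_of_dvd ha ?_))
    (Int.natAbs_dvd_natAbs.2 (h.int_dvd_of_dvd hb ?_))
  · rw [← Ideal.mem_span_singleton, hab]; exact Ideal.mem_span_singleton_self _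
  · rw [← Ideal.mem_span_singleton, ← hab]; exact Ideal.mem_span_singleton_self _

theorem IsPrimeTo.conjIdeal {Z : Ideal (𝓞 K)} (hZ : IsPrimeTo g Z) :
    IsPrimeTo g (conjIdeal σ Z) := by
  obtain ⟨a, ha, b, hab⟩ := isPrimeTo_iff.1 hZ
  refine isPrimeTo_iff.2 ⟨conj σ a, mem_conjIdeal_of_mem σ ha, conj σ b, ?_⟩
  have := congrArg (conj σ) hab
  simpa using this

/-- As in `exists_mul_pow_eq_span`, but with an ideal `Z` that is not divisible by prime numbers: a
factor `p` of `Z` can be cancelled against a factor `pⁿ` of `β`. -/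
theorem exists_mul_pow_eq_span_primitive {O : Subalgebra ℤ (𝓞 K)} (hn : n ≠ 0) (hg : g ≠ 0)
    (hO : ∀ t : 𝓞 K, (g : 𝓞 K) * t ∈ O) {J : (Ideal (𝓞 K))⁰}
    (hJ : FractionalIdeal.mk0 K J ∈ nthClasses O g n) (M : ℕ) (hM : M ≠ 0) :
    ∃ β ∈ O, ∃ Z : Ideal (𝓞 K), β ≠ 0 ∧ Z ≠ ⊥ ∧ IsPrimitiveIdeal Z ∧ IsPrimeTo (g * M) Z ∧
      (J : Ideal (𝓞 K)) * Z ^ n = Ideal.span {β} := by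
  have hne : ∀ {β : 𝓞 K} {Z : Ideal (𝓞 K)}, β ≠ 0 → (J : Ideal (𝓞 K)) * Z ^ n = Ideal.span {β} →
      Z ≠ ⊥ := fun {β Z} hβ hZ h0 => by
    rw [h0, Ideal.bot_pow hn, Ideal.mul_bot] at hZ
    exact hβ (Ideal.span_singleton_eq_bot.1 hZ.symm)
  have descent : ∀ m : ℕ, ∀ β ∈ O, ∀ Z : Ideal (𝓞 K), β ≠ 0 → IsPrimeTo (g * M) Z →
      (J : Ideal (𝓞 K)) * Z ^ n = Ideal.span {β} → Ideal.absNorm Z = m →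
      ∃ β ∈ O, ∃ Z : Ideal (𝓞 K), β ≠ 0 ∧ Z ≠ ⊥ ∧ IsPrimitiveIdeal Z ∧ IsPrimeTo (g * M) Z ∧
        (J : Ideal (𝓞 K)) * Z ^ n = Ideal.span {β} := by
    intro m
    induction m using Nat.strong_induction_on with
    | _ m ih =>
      intro β hβ Z hβ0 hZ hJZ hm
      by_cases hprim : IsPrimitiveIdeal Z
      · exact ⟨β, hβ, Z, hβ0, hne hβ0 hJZ, hprim, hZ, hJZ⟩
      · simp only [IsPrimitiveIdeal, not_forall, not_not] at hprim
        obtain ⟨p, hp, Z', rfl⟩ := hprim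
        have hZ0 := hne hβ0 hJZ
        have hβp : ((p : 𝓞 K) ^ n) ∣ β := by
          rw [← Ideal.span_singleton_le_span_singleton, ← hJZ, mul_pow, Ideal.span_singleton_pow]
          exact Ideal.mul_le_right.trans Ideal.mul_le_left
        obtain ⟨β', rfl⟩ := hβp
        have hpg : IsCoprime (p : 𝓞 K) (g : 𝓞 K) := by
          rw [← isPrimeTo_span_iff]
          exact (hZ.of_dvd (Dvd.intro _ rfl)).of_dvd_right (Dvd.intro _ rfl)
        have hp0 : (p : 𝓞 K) ^ n ≠ 0 := pow_ne_zero n (by exact_mod_cast hp.ne_zero)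
        refine ih _ ?_ β' (mem_of_mul_mem hg hO (pow_mem (by simp) n) hpg.pow_left hβ) Z'
          (right_ne_zero_of_mul hβ0) (hZ.of_dvd (Dvd.intro_left _ rfl)) ?_ rfl
        · have h1 : Ideal.absNorm Z' ≠ 0 := by
            rw [Ne, Ideal.absNorm_eq_zero_iff]; exact right_ne_zero_of_mul hZ0
          have h2 : Ideal.absNorm (Ideal.span {(p : 𝓞 K)}) ≠ 0 := by
            rw [Ne, Ideal.absNorm_eq_zero_iff]; exact left_ne_zero_of_mul hZ0
          have h3 : Ideal.absNorm (Ideal.span {(p : 𝓞 K)}) ≠ 1 := by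
            rw [Ne, Ideal.absNorm_eq_one_iff, Ideal.span_singleton_eq_top, natCast_isUnit_iff]
            exact hp.ne_one
          rw [← hm, map_mul]
          exact lt_mul_of_one_lt_left (by omega) (by omega)
        · refine mul_left_cancel₀ (a := Ideal.span {(p : 𝓞 K) ^ n})
            (by rwa [Ne, Ideal.zero_eq_bot, Ideal.span_singleton_eq_bot]) ?_
          rw [Ideal.span_singleton_mul_span_singleton, ← hJZ, mul_pow, Ideal.span_singleton_pow]
          ac_rfl
  obtain ⟨β, hβ, Z, hβ0, hZ, hJZ⟩ := exists_mul_pow_eq_span hg hO hJ M hM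
  exact descent _ β hβ Z hβ0 hZ hJZ rfl

section

variable {pos : HeightOneSpectrum (𝓞 K) → Prop} {jp jm r : Ideal (𝓞 K)}
  {T : Finset (HeightOneSpectrum (𝓞 K))}

theorem IsFactorization.isPrimitiveIdeal (h : IsQuadratic B₀ s σ) (hpos : IsHalf σ C pos)
    (hF : IsFactorization σ C pos jp jm r T) (hC : C ≠ 0) {Z : Ideal (𝓞 K)} (hZ0 : Z ≠ ⊥)
    (hZ : IsPrimitiveIdeal Z) (hZC : ∀ v : HeightOneSpectrum (𝓞 K), v.asIdeal ∣ Z →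
      (C : 𝓞 K) ∉ v.asIdeal ∧ ((2 * B₀ : ℤ) : 𝓞 K) ∉ v.asIdeal) :
    IsPrimitiveIdeal (jp * r * Z ^ n) := by
  classical
  intro p hp hpA
  have hJ0 : jp * r ≠ ⊥ := mul_ne_zero hF.jp_ne hF.r_ne
  have hle : ∀ v, iord v (Ideal.span {(p : 𝓞 K)}) ≤ iord v jp + iord v r + n * iord v Z :=
    fun v => by
      have h1 := iord_le_of_dvd (mul_ne_zero hJ0 (pow_ne_zero n hZ0)) hpA v
      rwa [iord_mul v hJ0 (pow_ne_zero n hZ0), iord_mul v hF.jp_ne hF.r_ne, iord_pow] at h1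
  have hZdvd : ∀ v : HeightOneSpectrum (𝓞 K), 0 < n * iord v Z → v.asIdeal ∣ Z := fun v hv => by
    rw [← iord_pos_iff v hZ0]
    exact pos_of_mul_pos_right hv (Int.natCast_nonneg n)
  have hZzero : ∀ v : HeightOneSpectrum (𝓞 K), ¬ v.asIdeal ∣ Z → iord v Z = 0 := fun v =>
    (iord_eq_zero_iff v hZ0).2
  have hr : ∀ v, iord v r = if v ∈ T then 1 else 0 := fun v => by rw [hF.r_eq, iord_prod_primes]
  have hjp : ∀ v, ¬ IsSplitPrime σ v → iord v jp = 0 := fun v hv =>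
    ((hF.iord_eq h hpos hC v).2.2 fun h' => hv h'.1).1
  obtain ⟨v, hv⟩ := exists_mem_asIdeal (K := K) hp
  have h1 := hle v
  rcases h.prime_cases hp hv with hpv | hpv | hpv
  · have hin : IsInert K p := ⟨hp, hpv ▸ v.isPrime⟩
    rw [hjp v fun hs => h.isSplitPrime_iff.1 hs (hin.conjPrime_eq h hv), hr,
      if_neg fun hT => hin.not_isRamifiedPrime hv (hF.ramified v hT), hpv, iord_self] at h1
    exact hZ p hp (hpv ▸ hZdvd v (by omega))
  · have hram : IsRamifiedPrime v := ⟨p, hpv⟩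
    rw [hjp v hram.not_isSplitPrime, hr, hpv.iord_eq_two,
      hZzero v fun hd => (hZC v hd).2 (h.ramified_mem hram)] at h1
    split_ifs at h1 <;> omega
  · have hs : IsSplitPrime σ v := ⟨p, _, hpv⟩
    have hs' := h.isSplitPrime_conj.2 hs
    have h2 := hle (conjPrime σ v)
    rw [hF.iord_r_of_split hs, hpv.iord_eq_one] at h1
    rw [hF.iord_r_of_split hs', (hpv.symm h).iord_eq_one] at h2
    by_cases hCv : (C : 𝓞 K) ∈ v.asIdeal
    · have hCw := h.int_mem_conjPrime.2 hCv
      rw [hZzero v fun hd => (hZC v hd).1 hCv] at h1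
      rw [hZzero _ fun hd => (hZC _ hd).1 hCw] at h2
      by_cases hpos' : pos v
      · have := ((hF.iord_eq h hpos hC v).1 hpos').2
        rw [hF.iord_jm] at this
        omega
      · have := hF.iord_not_pos v hpos'
        omega
    · have hCw := mt h.int_mem_conjPrime.1 hCv
      rw [(hF.iord_of_not_mem hC hCv).1] at h1
      rw [(hF.iord_of_not_mem hC hCw).1] at h2
      exact hZ p hp (hpv.2.2.2 ▸ mul_dvd_of_ne hpv.2.2.1 (hZdvd v (by omega))
        (hZdvd _ (by omega)))

/-- A factorization of `C` yields an element of `ℤ[f √(-B₀)]` of norm `C zⁿ`, up to the sign of `z`,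
that is not divisible by a prime number; and `z` can be taken prime to any given integer. -/
theorem IsFactorization.exists_element (h : IsQuadratic B₀ s σ) (hpos : IsHalf σ C pos)
    (hF : IsFactorization σ C pos jp jm r T) {f : ℤ} (hn : Odd n) (hC0 : C ≠ 0)
    (hC : B₀ ≡ 3 [ZMOD 4] → Odd C) (hCg : IsCoprime (C : 𝓞 K) (rootConductor f B₀ : 𝓞 K))
    (hg : rootConductor f B₀ ≠ 0)
    (hcl : ClassMemMultiples (quadOrder s f B₀ C) n jp) {M : ℤ} (hM : M ≠ 0) :
    ∃ x y z : ℤ, x ^ 2 + f ^ 2 * B₀ * y ^ 2 = C * z ^ n ∧ StarZero s f x y ∧ IsCoprime z M := by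
  have hn0 : n ≠ 0 := by rintro rfl; simp at hn
  have hO := h.conductor_mul_mem_rootOrder f
  have hjpg := isPrimeTo_of_dvd_span hCg hF.jp_dvd
  -- The conductor of the smaller order serves as the auxiliary integer for both orders.
  have hjp := (classMemMultiples_iff hg (fun t => h.rootOrder_le f hC (hO t)) n
    ⟨jp, mem_nonZeroDivisors_of_ne_zero hF.jp_ne⟩ hjpg).1 hcl
  replace hjp := h.mem_nthClasses_rootOrder f hn hC (mk0_mem_primeToGroup
    (I := ⟨jp, mem_nonZeroDivisors_of_ne_zero hF.jp_ne⟩) hjpg) hjp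
  have hJ := mul_mem hjp (hF.r_mem_nthClasses (O := rootOrder s f) h hn hCg)
  rw [← map_mul] at hJ
  have hB0 : B₀ ≠ 0 := h.squarefree.ne_zero
  have hm0 : 2 * B₀ * C * M ≠ 0 := by positivity
  obtain ⟨β, hβ, Z, hβ0, hZ0, hZ, hZm, hJZ⟩ :=
    exists_mul_pow_eq_span_primitive hn0 hg hO hJ _ (Int.natAbs_ne_zero.2 hm0)
  change jp * r * Z ^ n = Ideal.span {β} at hJZ
  have hZm' : IsPrimeTo (2 * B₀ * C * M).natAbs Z := hZm.of_dvd_right (Dvd.intro_left _ rfl)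
  have hdvd : ∀ {m : ℤ}, m ∣ 2 * B₀ * C * M → ∀ v : HeightOneSpectrum (𝓞 K), v.asIdeal ∣ Z →
      (m : 𝓞 K) ∉ v.asIdeal := fun {m} hm v hv hmv => by
    refine hZm'.not_mem hv ?_
    obtain ⟨c, hc⟩ := int_dvd_natAbs_cast (K := K) hm
    rw [hc]
    exact Ideal.mul_mem_right _ _ hmv
  have hprim : IsPrimitiveIdeal (Ideal.span {β}) := hJZ ▸ hF.isPrimitiveIdeal h hpos hC0 hZ0 hZ
    fun v hv => ⟨hdvd ⟨2 * B₀ * M, by ring⟩ v hv, hdvd ⟨C * M, by ring⟩ v hv⟩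
  obtain ⟨x, y, rfl⟩ := h.mem_rootOrder hβ
  have hnorm := h.mul_conj_eq f x y
  obtain ⟨N, hN⟩ := h.exists_mul_conjIdeal Z
  have hspan : Ideal.span {((x ^ 2 + f ^ 2 * B₀ * y ^ 2 : ℤ) : 𝓞 K)} =
      Ideal.span {((C * (N : ℤ) ^ n : ℤ) : 𝓞 K)} := by
    have hr : conjIdeal σ r = r := by
      have := h.conjIdeal_eq_of_ramified hF.ramified
      rwa [← hF.r_eq] at this
    have hNn : Ideal.span {(((N : ℤ) ^ n : ℤ) : 𝓞 K)} = (Z * conjIdeal σ Z) ^ n := by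
      rw [hN, Ideal.span_singleton_pow]; push_cast; rfl
    rw [← hnorm, ← Ideal.span_singleton_mul_span_singleton, ← conjIdeal_span, ← hJZ, conjIdeal_mul,
      conjIdeal_mul, conjIdeal_pow, hF.conjIdeal_jp h, hr, span_int_mul, hF.span_eq, hNn, mul_pow]
    ring
  have hN0 : (N : ℤ) ≠ 0 := by
    rintro h0
    have h0' : (N : 𝓞 K) = 0 := by exact_mod_cast congrArg (Int.cast : ℤ → 𝓞 K) h0
    rw [h0', Ideal.span_singleton_eq_bot.2 rfl] at hN
    exact mul_ne_zero hZ0 (h.conjIdeal_ne_bot hZ0) hN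
  have hNM : IsCoprime (N : ℤ) M := by
    refine isCoprime_int_of_isCoprime (K := K) ?_
    have h1 : IsPrimeTo (2 * B₀ * C * M).natAbs (Ideal.span {(N : 𝓞 K)}) := by
      rw [← hN]; exact hZm'.mul hZm'.conjIdeal
    have h2 := isPrimeTo_span_iff.1 h1
    rw [Int.cast_natCast]
    exact h2.of_isCoprime_of_dvd_right (int_dvd_natAbs_cast (Dvd.intro_left _ rfl))
  have hstar : StarZero s f x y := fun p hp hmem =>
    hprim p hp (Ideal.dvd_span_singleton.2 hmem)
  have hne : x ^ 2 + f ^ 2 * B₀ * y ^ 2 ≠ 0 := fun h0 => by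
    rw [h0, Int.cast_zero, mul_eq_zero] at hnorm
    exact hnorm.elim hβ0 fun h' => hβ0 ((map_eq_zero_iff _ (conj σ).injective).1 h')
  rcases h.eq_or_eq_neg_of_span_eq hne (mul_ne_zero hC0 (pow_ne_zero n hN0)) hspan with h1 | h1
  · exact ⟨x, y, N, h1, hstar, hNM⟩
  · exact ⟨x, y, -N, by rw [h1, hn.neg_pow, mul_neg], hstar, hNM.neg_left⟩

end

end

/-! ### Points and conductors -/

section

variable {B₀ C f : ℤ} {s : 𝓞 K} {σ : K ≃ₐ[ℚ] K} {n : ℕ}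

theorem StarZero.gcd_eq_one {x y : ℤ} (h : StarZero s f x y) : Int.gcd x y = 1 := by
  by_contra hne
  obtain ⟨p, hp, hpd⟩ := Nat.exists_prime_and_dvd hne
  obtain ⟨a, rfl⟩ := (Int.natCast_dvd_natCast.2 hpd).trans (Int.gcd_dvd_left x y)
  obtain ⟨b, hb⟩ := (Int.natCast_dvd_natCast.2 hpd).trans (Int.gcd_dvd_right (p * a) y)
  refine h p hp (Ideal.mem_span_singleton.2 ⟨a + f * s * b, ?_⟩)
  rw [hb]
  push_cast
  ring

/-- If `B₀ ≡ 3 (mod 4)` and `C` is even, then `x ≡ y (mod 2)` on every solution, so that `2` divides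
`x + f √(-B₀) y`. -/
theorem IsQuadratic.not_starZero (h : IsQuadratic B₀ s σ) (hB : B₀ ≡ 3 [ZMOD 4]) (hC : Even C)
    (hfC : Int.gcd f C = 1) {x y z : ℤ} (hxy : x ^ 2 + f ^ 2 * B₀ * y ^ 2 = C * z ^ n) :
    ¬ StarZero s f x y := by
  intro hst
  have hf : Odd f := by
    rw [← Int.not_even_iff_odd]
    intro hf
    have := Int.dvd_coe_gcd hf.two_dvd hC.two_dvd
    rw [hfC] at this
    norm_num at this
  have hB2 : Odd B₀ := by
    rw [Int.odd_iff]; rw [Int.ModEq] at hB; omega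
  have heven : Even (x - f * y) := by
    have h1 : Even (x ^ 2 + f ^ 2 * B₀ * y ^ 2) := hxy ▸ hC.mul_right _
    have hf' := Int.not_even_iff_odd.2 hf
    have hB' := Int.not_even_iff_odd.2 hB2
    rw [Int.even_add, Int.even_mul, Int.even_mul, Int.even_pow' two_ne_zero,
      Int.even_pow' two_ne_zero, Int.even_pow' two_ne_zero] at h1
    rw [Int.even_sub, Int.even_mul]
    tauto
  obtain ⟨ω, hω⟩ := h.exists_omega hB
  obtain ⟨c, hc⟩ := heven.two_dvd
  have hc' : (x : 𝓞 K) - f * y = 2 * c := by exact_mod_cast congrArg (Int.cast : ℤ → 𝓞 K) hc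
  refine hst 2 Nat.prime_two (Ideal.mem_span_singleton.2 ⟨c + f * ω * y, ?_⟩)
  rw [Nat.cast_ofNat]
  linear_combination hc' - f * y * hω

theorem rootConductor_ne_zero (hf : f ≠ 0) : rootConductor f B₀ ≠ 0 := by
  rw [rootConductor]; split_ifs <;> simp [hf]

theorem quadConductor_ne_zero (hf : f ≠ 0) : quadConductor f B₀ C ≠ 0 := by
  rw [quadConductor]; split_ifs <;> simp [hf]

theorem quadConductor_dvd : (quadConductor f B₀ C : ℤ) ∣ 2 * f := by
  rw [quadConductor]
  split_ifs
  · rw [Nat.cast_mul]; exact mul_dvd_mul_left _ (Int.natAbs_dvd.2 dvd_rfl)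
  · exact Int.natAbs_dvd.2 (Dvd.intro_left _ rfl)

theorem isCoprime_natAbs (hfC : Int.gcd f C = 1) : IsCoprime C (f.natAbs : ℤ) := by
  rw [Int.isCoprime_iff_gcd_eq_one, Int.gcd_comm, Int.gcd, Int.natAbs_natCast]; exact hfC

theorem isCoprime_two_natAbs (hfC : Int.gcd f C = 1) (hC : Odd C) :
    IsCoprime C ((2 * f.natAbs : ℕ) : ℤ) := by
  rw [Nat.cast_mul]
  exact IsCoprime.mul_right (Int.isCoprime_two_right.2 hC) (isCoprime_natAbs hfC)

theorem isCoprime_cast {m : ℕ} (h : IsCoprime C (m : ℤ)) : IsCoprime (C : 𝓞 K) (m : 𝓞 K) := by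
  have := h.map (Int.castRingHom (𝓞 K))
  simpa using this

theorem isCoprime_rootConductor (hfC : Int.gcd f C = 1) (hC : B₀ ≡ 3 [ZMOD 4] → Odd C) :
    IsCoprime (C : 𝓞 K) (rootConductor f B₀ : 𝓞 K) := by
  rw [rootConductor]
  split_ifs with hB
  · exact isCoprime_cast (isCoprime_two_natAbs hfC (hC hB))
  · exact isCoprime_cast (isCoprime_natAbs hfC)

theorem isCoprime_quadConductor (hfC : Int.gcd f C = 1) :
    IsCoprime (C : 𝓞 K) (quadConductor f B₀ C : 𝓞 K) := by
  rw [quadConductor]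
  split_ifs with hB
  · exact isCoprime_cast (isCoprime_two_natAbs hfC hB.2)
  · exact isCoprime_cast (isCoprime_natAbs hfC)

theorem IsQuadratic.isPointElement (h : IsQuadratic B₀ s σ) {x y z : ℤ}
    (hxy : x ^ 2 + f ^ 2 * B₀ * y ^ 2 = C * z ^ n) (hst : StarZero s f x y) (hz : IsCoprime z C) :
    IsPointElement σ C n ((x : 𝓞 K) + f * s * y) z where
  norm := by rw [h.mul_conj_eq, hxy]
  coprime := hz
  primitive := fun p hp hd => hst p hp (Ideal.dvd_span_singleton.1 hd)

end

end FermatDescent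

end

open FermatDescent in
theorem theoremA {K : Type*} [Field K] [NumberField K]
    (B B₀ f C : ℤ) (n : ℕ) (hn : Odd n) (hn3 : 3 ≤ n)
    (hB : B = f ^ 2 * B₀) (hB₀ : Squarefree B₀) (hB₀' : B₀ ≠ -1)
    (hf : f ≠ 0) (hC : C ≠ 0) (hfC : Int.gcd f C = 1)
    (s : 𝓞 K) (hs : s ^ 2 = -(B₀ : 𝓞 K))
    (hK : IntermediateField.adjoin ℚ {(s : K)} = ⊤)
    (σ : K ≃ₐ[ℚ] K) (hσ : σ ≠ 1)
    (S : Set (HeightOneSpectrum (𝓞 K))) (hS : FermatDescent.IsInvertedSet n C f S) :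
    (FermatDescent.admissibleTwists σ s n f B₀ C S).Finite ∧
    ((B₀ ≡ 3 [ZMOD 4] → Odd C) →
      List.TFAE [
        ∀ M : ℤ, M ≠ 0 → ∃ x y z : ℤ, FermatDescent.IsPrimitiveSolution B C n x y z ∧
          FermatDescent.StarZero s f x y ∧ Int.gcd z M = 1,
        (∀ p : ℕ, FermatDescent.IsInert K p → ¬ (p : ℤ) ∣ C) ∧
          (∀ (p : ℕ) (v : HeightOneSpectrum (𝓞 K)),
            FermatDescent.RamifiesAs p v → padicValInt p C ≤ 1) ∧
          (FermatDescent.admissibleTwists σ s n f B₀ C S).Nonempty,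
        FermatDescent.HasClassFactorization σ s n f B₀ C]) ∧
    (B₀ ≡ 3 [ZMOD 4] → Even C → ∀ x y z : ℤ,
      FermatDescent.IsPrimitiveSolution B C n x y z → ¬ FermatDescent.StarZero s f x y) := by
  have h : IsQuadratic B₀ s σ := ⟨hB₀, hs, hK, hσ⟩
  subst hB
  refine ⟨?_, fun hC' => ?_, fun hB4 hCe x y z hxyz => h.not_starZero hB4 hCe hfC hxyz.1⟩
  · have := finite_quotient_sUnits hS.1 (n := n) (by omega)
    exact Set.toFinite _
  have hg : quadConductor f B₀ C ≠ 0 := quadConductor_ne_zero hf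
  have hO := h.conductor_mul_mem_quadOrder f hC'
  have hCg : IsCoprime (C : 𝓞 K) (quadConductor f B₀ C : 𝓞 K) := isCoprime_quadConductor hfC
  tfae_have 1 → 3 := fun h1 => by
    obtain ⟨x, y, z, ⟨hxy, -⟩, hst, hz⟩ := h1 (2 * f * C) (by positivity)
    rw [← Int.isCoprime_iff_gcd_eq_one] at hz
    exact (h.isPointElement hxy hst hz.of_mul_right_right).hasClassFactorization h hn hC hg hO hCg
      (h.rootOrder_le f hC' (add_mem_rootOrder s f x y))
      (isCoprime_cast (hz.of_mul_right_left.of_isCoprime_of_dvd_right quadConductor_dvd))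
  tfae_have 2 → 3 := by
    rintro ⟨h1, h2, _, d, -, hd⟩
    exact h.hasClassFactorization_of_isAdmissible hn hC ⟨h1, h2⟩ hg hO hCg hS d hd
  tfae_have 3 → 2 := fun h3 => by
    obtain ⟨jp, jm, r, T, pos, hpos, hF, hcl⟩ := h.exists_of_hasClassFactorization hC h3
    have hadm := hF.isAdmissibleConstant h hpos hC
    exact ⟨hadm.1, hadm.2, hF.exists_isAdmissible h hpos hn hC hg hO hCg hS hcl⟩
  tfae_have 3 → 1 := fun h3 M hM => by
    obtain ⟨jp, jm, r, T, pos, hpos, hF, hcl⟩ := h.exists_of_hasClassFactorization hC h3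
    obtain ⟨x, y, z, hxy, hst, hz⟩ := hF.exists_element h hpos hn hC hC'
      (isCoprime_rootConductor hfC hC') (rootConductor_ne_zero hf) hcl hM
    refine ⟨x, y, z, ⟨hxy, ?_⟩, hst, Int.isCoprime_iff_gcd_eq_one.1 hz⟩
    rw [hst.gcd_eq_one]
    simp
  tfae_finish
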